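/- **Setting.** An oriented singular link $K$ is an oriented link in $S^3$ with finitely many double points (contracted thick edges). A projection $P$ of $K$ is an oriented four-valent diagram, possibly disconnected and possibly with closed circles without crossings, each of whose crossings is positive, negative or singular; at every crossing, drawn with both strands running upwards, the four quadrants are called $A$ (left), $B$ (top), $C$ (right) and $D$ (bottom). A decorated projection is a non-empty projection together with an initial point $Q$ on one of its edges. Let $K^+$, $K^-$, $K^o$ denote the singular links obtained from $K$ by replacing a singular point by a positive crossing, by a negative crossing, and by the oriented resolution, respectively. **Alexander polynomial.** There is a unique function $K\mapsto\Delta_K(T)\in\mathbb Z[T^{1/2},T^{-1/2}]$ (on diagrams of oriented singular links) such that * for an ordinary link, $\Delta_K$ is a symmetrized Alexander polynomial: up to units $\pm T^{k/2}$ it is the determinant of the Alexander matrix (crossings $\times$ regions) with the columns of two regions adjacent along an edge deleted (and $0$ if this matrix is not square), $\Delta_K(T^{-1})=\pm\Delta_K(T)$, and the value of $\Delta_K$ at $T^{1/2}=1$ is $1$ if $K$ is a knot; * at every singular point, $\Delta_{K^+}=\Delta_K+T^{1/2}\Delta_{K^o}$ and $\Delta_{K^-}=\Delta_K+T^{-1/2}\Delta_{K^o}$.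 **Kauffman states.** For a decorated projection $P$ let $\mathrm{Cr}(P)$ be its set of crossings (ordinary and singular), let $R(P)$ be the set of regions of the complement, and let $X,Y\in R(P)$ be the two regions containing the edge on which $Q$ lies. A Kauffman state $x\in X(P)$ assigns to each crossing $v$ one of the four quadrants at $v$, such that the regions containing the assigned quadrants give a bijection $\mathrm{Cr}(P)\to R(P)\setminus\{X,Y\}$. The local contribution $Z_v(x)$ is given by the quadrant that $x$ assigns to $v$: | | $A$ | $B$ | $C$ | $D$ | |---|---|---|---|---| | $v$ positive | $1$ | $T^{1/2}$ | $1$ | $-T^{-1/2}$ | | $v$ negative | $1$ | $T^{-1/2}$ | $1$ | $-T^{1/2}$ | | $v$ singular | $1$ | $0$ | $1$ | $-T^{1/2}-T^{-1/2}$ | **Proposition.** For every decorated projection $P$ of an oriented singular link $K$, $$\Delta_K(T)=\sum_{x\in X(P)}\ \prod_{v\in \mathrm{Cr}(P)} Z_v(x).$$ -/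

import Mathlib

open scoped LaurentPolynomial

/-- The ring `ℤ[T^{1/2}, T^{-1/2}]`: Laurent polynomials in the variable `T^{1/2}`.
Thus `LaurentPolynomial.T n` stands for `T^{n/2}`. -/
abbrev HalfLaurent : Type := ℤ[T;T⁻¹]

/-- The power `T^{n/2}`. -/
noncomputable def halfPow (n : ℤ) : HalfLaurent := LaurentPolynomial.T n

/-- The type of a vertex of a diagram. A vertex of type `positive` or `negative` is an ordinary
crossing with that sign, one of type `singular` is a double point (a contracted thick edge).
At a vertex of type `smoothed` there is no crossing: the two strands have been resolved
compatibly with their orientation and just pass by each other. -/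
inductive VertexKind
  | positive
  | negative
  | singular
  | smoothed
  deriving DecidableEq

/-- The four quadrants at a vertex drawn with both strands running upwards: `A` is the left one,
`B` the top one, `C` the right one and `D` the bottom one. -/
inductive Corner
  | A
  | B
  | C
  | D
  deriving DecidableEq

instance : Fintype Corner where
  elems := {Corner.A, Corner.B, Corner.C, Corner.D}
  complete := by intro c; cases c <;> simp

/-- A (non-empty) oriented singular link diagram on the sphere, given by its vertices `V`, its
oriented edges `E`, and the regions `R` of the complement.

Each vertex has four edge ends. Drawn with both strands running upwards, these are `inL`
(bottom left) and `inR` (bottom right), which point into the vertex, and `outL` (top left) and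
`outR` (top right), which leave it. An edge which does not start at any vertex is a closed circle.
`left e` and `right e` are the regions on the two sides of `e`. -/
structure SingularLinkDiagram where
  V : Type
  E : Type
  R : Type
  [fintypeV : Fintype V]
  [fintypeE : Fintype E]
  [fintypeR : Fintype R]
  [nonemptyE : Nonempty E]
  inL : V → E
  inR : V → E
  outL : V → E
  outR : V → E
  left : E → R
  right : E → R
  kind : V → VertexKind
  /-- An edge starts at most once. -/
  out_injective : Function.Injective (Sum.elim outL outR)
  /-- An edge ends at most once. -/
  in_injective : Function.Injective (Sum.elim inL inR)
  /-- An edge that starts at a vertex also ends at one, and conversely. -/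
  range_out_eq_range_in : Set.range (Sum.elim outL outR) = Set.range (Sum.elim inL inR)
  corner_A : ∀ v, left (inL v) = left (outL v)
  corner_B : ∀ v, right (outL v) = left (outR v)
  corner_C : ∀ v, right (inR v) = right (outR v)
  corner_D : ∀ v, right (inL v) = left (inR v)
  /-- The surface carrying the diagram is connected: any two regions are joined by a path that
  crosses edges. -/
  connected : ∀ r s : R, Relation.EqvGen (fun r s => ∃ e, r = left e ∧ s = right e) r s
  /-- Euler's formula for a diagram on the sphere:
  `#regions = #vertices + #connected components of the projection + 1`. (Every vertex has
  valency four. Together with `connected` this says that the surface is a sphere.) -/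
  euler : Nat.card R = Nat.card V +
    Nat.card (Quot fun e e' : E => ∃ v, e ∈ ({inL v, inR v, outL v, outR v} : Set E) ∧
      e' ∈ ({inL v, inR v, outL v, outR v} : Set E)) + 1

namespace SingularLinkDiagram

attribute [instance] fintypeV fintypeE fintypeR nonemptyE

/-- The crossings of the diagram, ordinary and singular. -/
abbrev Crossing (P : SingularLinkDiagram) : Type :=
  {v : P.V // P.kind v ≠ VertexKind.smoothed}

/-- The regions of the complement of the diagram. At a smoothed vertex the top and the bottom
quadrant belong to the same region. -/
def Region (P : SingularLinkDiagram) : Type :=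
  Quot fun r s : P.R => ∃ v, P.kind v = VertexKind.smoothed ∧
    r = P.right (P.outL v) ∧ s = P.right (P.inL v)

/-- The region in which a quadrant at a vertex lies. -/
def regionAt (P : SingularLinkDiagram) (v : P.V) : Corner → P.Region
  | Corner.A => Quot.mk _ (P.left (P.inL v))
  | Corner.B => Quot.mk _ (P.right (P.outL v))
  | Corner.C => Quot.mk _ (P.right (P.inR v))
  | Corner.D => Quot.mk _ (P.right (P.inL v))

/-- The regions other than the two regions `X` and `Y` that contain the edge `e`. -/
def AllowedRegion (P : SingularLinkDiagram) (e : P.E) : Set P.Region :=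
  {r | r ≠ Quot.mk _ (P.left e) ∧ r ≠ Quot.mk _ (P.right e)}

/-- The diagram represents an ordinary (non-singular) link. -/
def Nonsingular (P : SingularLinkDiagram) : Prop :=
  ∀ v, P.kind v ≠ VertexKind.singular

/-- `P.setKind v k` is the diagram obtained from `P` by making `v` a vertex of type `k`. -/
noncomputable def setKind (P : SingularLinkDiagram) (v : P.V) (k : VertexKind) :
    SingularLinkDiagram :=
  open Classical in { P with kind := Function.update P.kind v k }

/-- The edge `e'` follows the edge `e` when one travels along the link: strands go straight
through crossings, and turn at smoothed vertices. -/
def Follows (P : SingularLinkDiagram) (e e' : P.E) : Prop :=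
  ∃ v, (P.kind v ≠ VertexKind.smoothed ∧
      (e = P.inL v ∧ e' = P.outR v ∨ e = P.inR v ∧ e' = P.outL v)) ∨
    (P.kind v = VertexKind.smoothed ∧
      (e = P.inL v ∧ e' = P.outL v ∨ e = P.inR v ∧ e' = P.outR v))

/-- The link has exactly one component. -/
def IsKnot (P : SingularLinkDiagram) : Prop :=
  ∀ e e' : P.E, Relation.EqvGen P.Follows e e'

/-! ### Kauffman states and the state sum -/

/-- The local contribution of a quadrant at a crossing of the given type
(the value at `smoothed` is irrelevant, as such a vertex is not a crossing). -/
noncomputable def localContribution : VertexKind → Corner → HalfLaurent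
  | VertexKind.positive, Corner.A => 1
  | VertexKind.positive, Corner.B => halfPow 1
  | VertexKind.positive, Corner.C => 1
  | VertexKind.positive, Corner.D => -halfPow (-1)
  | VertexKind.negative, Corner.A => 1
  | VertexKind.negative, Corner.B => halfPow (-1)
  | VertexKind.negative, Corner.C => 1
  | VertexKind.negative, Corner.D => -halfPow 1
  | VertexKind.singular, Corner.A => 1
  | VertexKind.singular, Corner.B => 0
  | VertexKind.singular, Corner.C => 1
  | VertexKind.singular, Corner.D => -halfPow 1 - halfPow (-1)
  | VertexKind.smoothed, _ => 0

/-- `x` is a Kauffman state of `P` with initial point on the edge `Q`: it assigns to each crossing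
one of the four quadrants at it, in such a way that the regions containing these quadrants give a
bijection from the crossings to the regions other than the two that contain `Q`. -/
def IsKauffmanState (P : SingularLinkDiagram) (Q : P.E) (x : P.Crossing → Corner) : Prop :=
  Set.BijOn (fun v : P.Crossing => P.regionAt v.1 (x v)) Set.univ (P.AllowedRegion Q)

open Classical in
/-- The sum over all Kauffman states of the product of the local contributions. -/
noncomputable def stateSum (P : SingularLinkDiagram) (Q : P.E) : HalfLaurent :=
  ∑ x : {x : P.Crossing → Corner // P.IsKauffmanState Q x},
    ∏ v : P.Crossing, localContribution (P.kind v.1) (x.1 v)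

/-! ### The Alexander polynomial -/

/-- The coefficients of Alexander's relation at an ordinary crossing. Going around the crossing
the signs alternate, and the two corners to the right of the lower strand carry a factor `T`.
(At a positive crossing the lower strand runs from bottom right to top left, at a negative one
from bottom left to top right.) -/
noncomputable def alexanderCoeff : VertexKind → Corner → HalfLaurent
  | VertexKind.positive, Corner.A => 1
  | VertexKind.positive, Corner.B => -halfPow 2
  | VertexKind.positive, Corner.C => halfPow 2
  | VertexKind.positive, Corner.D => -1
  | VertexKind.negative, Corner.A => 1
  | VertexKind.negative, Corner.B => -1
  | VertexKind.negative, Corner.C => halfPow 2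
  | VertexKind.negative, Corner.D => -halfPow 2
  | _, _ => 0

open Classical in
/-- The Alexander matrix of an ordinary link diagram, with rows indexed by the crossings and
columns by the regions. -/
noncomputable def alexanderMatrix (P : SingularLinkDiagram) :
    Matrix P.Crossing P.Region HalfLaurent :=
  fun v r => ∑ c : Corner, if P.regionAt v.1 c = r then alexanderCoeff (P.kind v.1) c else 0

open Classical in
/-- The determinant of the Alexander matrix after deleting the columns of the two regions on the
sides of the edge `e`. It is defined up to sign, as the remaining columns have to be matched with
the rows. If the matrix is not square (it then has more columns than rows, and the
projection is disconnected), the value is `0`. -/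
noncomputable def alexanderDet (P : SingularLinkDiagram) (e : P.E) : HalfLaurent :=
  if h : Nonempty (P.Crossing ≃ P.AllowedRegion e) then
    (P.alexanderMatrix.submatrix id fun v => (h.some v).1).det
  else 0

/-- `p` is a symmetrized Alexander polynomial of the ordinary link with diagram `P`: up to units
`± T^{k/2}` it is Alexander's determinant, it is invariant up to sign under `T ↦ T⁻¹`, and for
a knot its value at `T^{1/2} = 1` is `1`. For links with several components this determines `p`
up to sign. -/
structure IsSymmetrizedAlexander (P : SingularLinkDiagram) (p : HalfLaurent) : Prop where
  associated : ∀ e, Associated p (P.alexanderDet e)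
  symmetric : LaurentPolynomial.invert p = p ∨ LaurentPolynomial.invert p = -p
  eval_one : P.IsKnot → LaurentPolynomial.eval₂ (RingHom.id ℤ) (1 : ℤˣ) p = 1

/-- `Δ` is the Alexander polynomial of oriented singular links: on ordinary links it is the
symmetrized Alexander polynomial, and it satisfies the two skein relations at each singular point.

The difference of the two skein relations is the ordinary skein relation
`Δ(K⁺) - Δ(K⁻) = (T^{1/2} - T^{-1/2}) Δ(K°)`; this fixes the signs of the polynomials of
ordinary links with several components. -/
structure IsAlexanderPolynomial (Δ : SingularLinkDiagram → HalfLaurent) : Prop where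
  ordinary : ∀ P : SingularLinkDiagram, P.Nonsingular → P.IsSymmetrizedAlexander (Δ P)
  skein_positive : ∀ (P : SingularLinkDiagram) (v : P.V), P.kind v = VertexKind.singular →
    Δ (P.setKind v VertexKind.positive) = Δ P + halfPow 1 * Δ (P.setKind v VertexKind.smoothed)
  skein_negative : ∀ (P : SingularLinkDiagram) (v : P.V), P.kind v = VertexKind.singular →
    Δ (P.setKind v VertexKind.negative) = Δ P + halfPow (-1) * Δ (P.setKind v VertexKind.smoothed)

end SingularLinkDiagram

/-! ### Signs of selections of corners -/

/-! The state sum is shown to satisfy the axioms of the Alexander polynomial, and the axioms are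
shown to leave only one solution. Giving a smoothed vertex weight 1 at its top and bottom corners
and 0 at the others turns all state sums over one projection into sums `kindSum` over corner choices
at all its vertices. Both skein relations then become identities between the weights at a single
vertex.

Two determinant formulas control these sums. First, with the top corner signed negatively, the
corner matrix of a connected spherical projection is invertible for all positive weights
(`eq_zero_of_weighted_relations`). Two selections of opposite sign would contradict this by the
intermediate value theorem, so determinant and unsigned sum agree up to one global sign
(`exists_sign_det_cornerMatrix`). Rescaling by monomials in the Alexander index identifies the sum
with Alexander's determinant up to a unit.

Second, the weights of ordinary and smoothed vertices are, up to such monomials, those of a flow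
which splits at each vertex. For these weights the sum equals a principal minor of `1 - transition`
(`selectionSum_flowWeight`); flows and gradients of regions form the unimodular basis that compares
the two matrices. The minor shows independence of the initial point, equals 1 for a descending knot
diagram by triangularity, and vanishes when one component lies above the rest, by a singular
diagonal block.

Crossing changes lead from any ordinary diagram to one of these two cases, and the error term in the
skein relation has fewer crossings. Hence a solution of the skein relation is zero as soon as every
diagram can be changed into one where it vanishes (`eq_zero_of_skein`). This gives the symmetry of
the state sum and its agreement with any given `Δ`: for knots the symmetrized Alexander polynomial
is unique, for split diagrams it is zero. Singular points are then removed by the positive skein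
relation. -/

section Corners

/-- The signs of the four corners in Alexander's relation. -/
def cornerSign : Corner → ℤ
  | Corner.B => -1
  | _ => 1

theorem Corner.sum_eq {M : Type*} [AddCommMonoid M] (f : Corner → M) :
    ∑ c, f c = f Corner.A + f Corner.B + f Corner.C + f Corner.D := by
  have : (Finset.univ : Finset Corner) = {Corner.A, Corner.B, Corner.C, Corner.D} := rfl
  rw [this]
  simp [add_assoc]

open Classical in
/-- The signed weight matrix of a system of corners: the entry at `(v, u)` is the sum of the signed
weights of the corners of `v` that lie in the region `ι u`. -/
noncomputable def cornerMatrix {V R A : Type} [CommRing A] (reg : V → Corner → R) (ι : V → R)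
    (w : V → Corner → A) : Matrix V V A :=
  Matrix.of fun v u => ∑ c, if reg v c = ι u then (cornerSign c : A) * w v c else 0

/-- A selection of a corner at each vertex that hits each region of the range of `ι` once. -/
def IsSelection {V R : Type} (reg : V → Corner → R) (S : Set R) (x : V → Corner) : Prop :=
  Set.BijOn (fun v => reg v (x v)) Set.univ S

open Classical in
/-- The weighted count of selections. -/
noncomputable def selectionSum {V R A : Type} [Fintype V] [CommRing A] (reg : V → Corner → R)
    (S : Set R) (w : V → Corner → A) : A :=
  ∑ x : V → Corner, if IsSelection reg S x then ∏ v, w v (x v) else 0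

open Classical in
/-- The determinant of the incidence matrix of a choice of corners. -/
noncomputable def choiceDet {V R : Type} [Fintype V] (reg : V → Corner → R) (ι : V → R)
    (x : V → Corner) : ℤ :=
  Matrix.det (Matrix.of fun v u : V => if reg v (x v) = ι u then (1 : ℤ) else 0)

-- Multilinearity in the rows: choosing a summand in each row means choosing a corner at each
-- vertex.
open Classical in
theorem det_cornerMatrix {V R A : Type} [Fintype V] [CommRing A] (reg : V → Corner → R)
    (ι : V → R) (w : V → Corner → A) :
    (cornerMatrix reg ι w).det =
      ∑ x : V → Corner, ((choiceDet reg ι x * ∏ v, cornerSign (x v) : ℤ) : A) * ∏ v, w v (x v) := by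
  have h1 : cornerMatrix reg ι w = fun v => ∑ c, ((cornerSign c : A) * w v c) •
      (fun u => if reg v c = ι u then (1 : A) else 0) := by
    funext v u
    simp [cornerMatrix, Finset.sum_apply]
  rw [h1]
  have h2 := (Matrix.detRowAlternating (n := V) (R := A)).toMultilinearMap.map_sum
    (fun v c => ((cornerSign c : A) * w v c) •
      (fun u => if reg v c = ι u then (1 : A) else 0))
  refine h2.trans (Finset.sum_congr rfl fun x _ => ?_)
  rw [MultilinearMap.map_smul_univ, smul_eq_mul, Finset.prod_mul_distrib]
  have h3 : (choiceDet reg ι x : A) = Matrix.detRowAlternating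
      (fun v : V => fun u : V => if reg v (x v) = ι u then (1 : A) else 0) := by
    rw [choiceDet, Int.cast_det]
    change Matrix.det _ = Matrix.det _
    congr 1
    ext v u
    simp
  push_cast
  rw [h3]
  change _ * Matrix.det _ = Matrix.det _ * _ * _
  ring

/-- A choice that is not a selection either misses the range of `ι` at some vertex (a zero row) or
uses one region twice (two equal rows). -/
theorem choiceDet_eq_zero {V R : Type} [Fintype V] {reg : V → Corner → R} {ι : V → R}
    (hι : Function.Injective ι) {x : V → Corner} (hx : ¬ IsSelection reg (Set.range ι) x) :
    choiceDet reg ι x = 0 := by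
  classical
  unfold choiceDet
  by_cases h1 : ∀ v, ∃ u, reg v (x v) = ι u
  · choose g hg using h1
    by_cases h2 : Function.Injective g
    · exfalso
      apply hx
      refine ⟨fun v _ => ⟨g v, (hg v).symm⟩, ?_, ?_⟩
      · intro a _ b _ hab
        simp only [hg] at hab
        exact h2 (hι hab)
      · rintro _ ⟨u, rfl⟩
        obtain ⟨v, rfl⟩ := (Finite.injective_iff_surjective.mp h2) u
        exact ⟨v, trivial, hg v⟩
    · simp only [Function.Injective, not_forall] at h2
      obtain ⟨a, b, hab, hne⟩ := h2
      refine Matrix.det_zero_of_row_eq hne ?_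
      ext u
      simp [hg, hab]
  · push Not at h1
    obtain ⟨v, hv⟩ := h1
    refine Matrix.det_eq_zero_of_row_eq_zero v fun u => ?_
    simp [hv u]

theorem choiceDet_isUnit {V R : Type} [Fintype V] {reg : V → Corner → R} {ι : V → R}
    (hι : Function.Injective ι) {x : V → Corner} (hx : IsSelection reg (Set.range ι) x) :
    IsUnit (choiceDet reg ι x) := by
  classical
  have h1 : ∀ v, ∃ u, reg v (x v) = ι u := fun v => by
    obtain ⟨u, hu⟩ := hx.mapsTo (Set.mem_univ v)
    exact ⟨u, hu.symm⟩
  choose g hg using h1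
  have hinj : Function.Injective g := fun a b hab =>
    hx.injOn (Set.mem_univ a) (Set.mem_univ b) (by simp only [hg, hab])
  have h3 : (Matrix.of fun v u : V => if reg v (x v) = ι u then (1 : ℤ) else 0) =
      Equiv.Perm.permMatrix ℤ (Equiv.ofBijective g (Finite.injective_iff_bijective.mp hinj)) := by
    ext v u
    simp [hg, hι.eq_iff, Equiv.Perm.permMatrix, PEquiv.toMatrix_apply, eq_comm]
  rw [choiceDet, h3, Matrix.det_permutation]
  exact Units.isUnit _

theorem isUnit_prod_cornerSign {V : Type} [Fintype V] (x : V → Corner) :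
    IsUnit (∏ v, cornerSign (x v)) := by
  refine IsUnit.prod_univ_iff.mpr fun v => ?_
  cases x v <;> simp [cornerSign]

open Classical in
/-- If the signed weight matrix is invertible for all positive weights, then its determinant is,
up to a global sign, the weighted count of the selections. -/
theorem exists_sign_det_cornerMatrix {V R : Type} [Fintype V] {reg : V → Corner → R}
    {ι : V → R} (hι : Function.Injective ι)
    (h : ∀ w : V → Corner → ℝ, (∀ v c, 0 < w v c) → (cornerMatrix reg ι w).det ≠ 0) :
    ∃ ε : ℤˣ, ∀ (A : Type) [CommRing A] (w : V → Corner → A),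
      (cornerMatrix reg ι w).det = ((ε : ℤ) : A) * selectionSum reg (Set.range ι) w := by
  classical
  set sg : (V → Corner) → ℤ := fun x => choiceDet reg ι x * ∏ v, cornerSign (x v) with hsg
  have hdet : ∀ (A : Type) [CommRing A] (w : V → Corner → A),
      (cornerMatrix reg ι w).det = ∑ x, (sg x : A) * ∏ v, w v (x v) := by
    intro A _ w
    exact det_cornerMatrix reg ι w
  have hunit : ∀ x, IsSelection reg (Set.range ι) x → IsUnit (sg x) := fun x hx =>
    (choiceDet_isUnit hι hx).mul (isUnit_prod_cornerSign x)
  have hzero : ∀ x, ¬ IsSelection reg (Set.range ι) x → sg x = 0 := fun x hx => by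
    simp [hsg, choiceDet_eq_zero hι hx]
  have key : ∀ x y, ¬ (0 < sg x ∧ sg y < 0) := by
    rintro x y ⟨hx, hy⟩
    -- A path of weights from the indicator of `x` to that of `y`; the term `s * (1 - s)` makes all
    -- weights positive strictly between the endpoints. The determinant goes from `sg x > 0` to `sg
    -- y < 0`, so it vanishes at an interior point.
    let w : ℝ → V → Corner → ℝ := fun s v c =>
      (1 - s) * (if c = x v then 1 else 0) + s * (if c = y v then 1 else 0) + s * (1 - s)
    have hcont : Continuous fun s => (cornerMatrix reg ι (w s)).det := by
      simp only [hdet]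
      fun_prop
    have hev : ∀ (z : V → Corner), ∑ x', (sg x' : ℝ) * ∏ v, (if x' v = z v then (1 : ℝ) else 0)
        = sg z := by
      intro z
      rw [Finset.sum_eq_single z]
      · simp
      · intro b _ hb
        obtain ⟨v, hv⟩ := Function.ne_iff.mp hb
        rw [Finset.prod_eq_zero (Finset.mem_univ v) (by simp [hv]), mul_zero]
      · simp
    have h0 : (cornerMatrix reg ι (w 0)).det = sg x := by
      rw [hdet, ← hev x]
      simp [w]
    have h1 : (cornerMatrix reg ι (w 1)).det = sg y := by
      rw [hdet, ← hev y]
      simp [w]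
    have hmem : (0 : ℝ) ∈ (fun s => (cornerMatrix reg ι (w s)).det) '' Set.Icc 0 1 := by
      apply intermediate_value_Icc' zero_le_one hcont.continuousOn
      simp only [h0, h1]
      constructor
      · exact_mod_cast hy.le
      · exact_mod_cast hx.le
    obtain ⟨s, ⟨hs0, hs1⟩, hs⟩ := hmem
    have hs0' : s ≠ 0 := by
      rintro rfl
      simp only [h0] at hs
      exact hx.ne' (by exact_mod_cast hs)
    have hs1' : s ≠ 1 := by
      rintro rfl
      simp only [h1] at hs
      exact hy.ne (by exact_mod_cast hs)
    have hs0 : 0 < s := lt_of_le_of_ne hs0 hs0'.symm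
    have hs1 : 0 < 1 - s := sub_pos.mpr (lt_of_le_of_ne hs1 hs1')
    refine h (w s) (fun v c => ?_) hs
    have := mul_pos hs0 hs1
    simp only [w]
    split_ifs <;> linarith
  have hε : ∃ ε : ℤˣ, ∀ x, IsSelection reg (Set.range ι) x → sg x = ε := by
    by_cases hex : ∃ x, IsSelection reg (Set.range ι) x
    · obtain ⟨x, hx⟩ := hex
      refine ⟨(hunit x hx).unit, fun y hy => ?_⟩
      have k1 := key x y
      have k2 := key y x
      simp only [IsUnit.unit_spec]
      rcases Int.isUnit_iff.mp (hunit x hx) with a | a <;>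
      rcases Int.isUnit_iff.mp (hunit y hy) with b | b <;> omega
    · exact ⟨1, fun x hx => (hex ⟨x, hx⟩).elim⟩
  obtain ⟨ε, hε⟩ := hε
  refine ⟨ε, fun A _ w => ?_⟩
  rw [hdet, selectionSum, Finset.mul_sum]
  refine Finset.sum_congr rfl fun x _ => ?_
  by_cases hx : IsSelection reg (Set.range ι) x
  · simp [hx, hε x hx]
  · simp [hx, hzero x hx]

end Corners

namespace SingularLinkDiagram

/-! ### Connected projections -/

/-- The edges at a vertex. -/
def star (P : SingularLinkDiagram) (v : P.V) : Set P.E :=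
  {P.inL v, P.inR v, P.outL v, P.outR v}

/-- The projection is connected. -/
def IsConnected (P : SingularLinkDiagram) : Prop :=
  Nat.card (Quot fun e e' : P.E => ∃ v, e ∈ P.star v ∧ e' ∈ P.star v) = 1

/-- The region in which a quadrant lies when all vertices are regarded as crossings. -/
def corner (P : SingularLinkDiagram) (v : P.V) : Corner → P.R
  | Corner.A => P.left (P.inL v)
  | Corner.B => P.right (P.outL v)
  | Corner.C => P.right (P.inR v)
  | Corner.D => P.right (P.inL v)

variable {P : SingularLinkDiagram}

theorem left_outL (v : P.V) : P.left (P.outL v) = P.corner v Corner.A := (P.corner_A v).symm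
theorem right_outL (v : P.V) : P.right (P.outL v) = P.corner v Corner.B := rfl
theorem left_outR (v : P.V) : P.left (P.outR v) = P.corner v Corner.B := (P.corner_B v).symm
theorem right_outR (v : P.V) : P.right (P.outR v) = P.corner v Corner.C := (P.corner_C v).symm
theorem left_inL (v : P.V) : P.left (P.inL v) = P.corner v Corner.A := rfl
theorem right_inL (v : P.V) : P.right (P.inL v) = P.corner v Corner.D := rfl
theorem left_inR (v : P.V) : P.left (P.inR v) = P.corner v Corner.D := (P.corner_D v).symm
theorem right_inR (v : P.V) : P.right (P.inR v) = P.corner v Corner.C := rfl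

theorem card_eq_of_isConnected (hc : P.IsConnected) :
    Fintype.card P.R = Fintype.card P.V + 2 := by
  have := P.euler
  simp only [Nat.card_eq_fintype_card (α := P.R), Nat.card_eq_fintype_card (α := P.V)] at this
  unfold IsConnected star at hc
  omega

theorem card_components_pos (P : SingularLinkDiagram) :
    0 < Nat.card (Quot fun e e' : P.E => ∃ v, e ∈ P.star v ∧ e' ∈ P.star v) := by
  have : Nonempty (Quot fun e e' : P.E => ∃ v, e ∈ P.star v ∧ e' ∈ P.star v) :=
    ⟨Quot.mk _ (Classical.arbitrary P.E)⟩
  exact Nat.card_pos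

/-- By Euler's formula each further component adds a region. A choice of one corner per vertex that
covers all but two regions therefore forces connectedness. -/
theorem isConnected_of_card_le (h : Fintype.card P.R ≤ Fintype.card P.V + 2) :
    P.IsConnected := by
  have h1 := P.euler
  have h2 := P.card_components_pos
  simp only [Nat.card_eq_fintype_card (α := P.R), Nat.card_eq_fintype_card (α := P.V)] at h1
  unfold IsConnected star at *
  omega

theorem edge_induction (hc : P.IsConnected) {S : P.E → Prop} {e₀ : P.E} (h0 : S e₀)
    (hS : ∀ v, ∀ e ∈ P.star v, ∀ e' ∈ P.star v, S e → S e') (e : P.E) : S e := by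
  have hsub := (Nat.card_eq_one_iff_unique.mp hc).1
  have := Quot.eqvGen_exact (Subsingleton.elim (Quot.mk _ e₀) (Quot.mk _ e) :
    (Quot.mk (fun e e' : P.E => ∃ v, e ∈ P.star v ∧ e' ∈ P.star v) e₀) = Quot.mk _ e)
  have hiff : ∀ a b, Relation.EqvGen (fun e e' : P.E => ∃ v, e ∈ P.star v ∧ e' ∈ P.star v) a b →
      (S a ↔ S b) := by
    intro a b hab
    induction hab with
    | rel a b h =>
      obtain ⟨v, ha, hb⟩ := h
      exact ⟨hS v a ha b hb, hS v b hb a ha⟩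
    | refl => rfl
    | symm _ _ _ ih => exact ih.symm
    | trans _ _ _ _ _ ih1 ih2 => exact ih1.trans ih2
  exact (hiff _ _ this).mp h0

theorem region_induction {S : P.R → Prop} {r₀ : P.R} (h0 : S r₀)
    (hS : ∀ e, S (P.left e) ↔ S (P.right e)) (r : P.R) : S r := by
  have hiff : ∀ a b, Relation.EqvGen (fun r s => ∃ e, r = P.left e ∧ s = P.right e) a b →
      (S a ↔ S b) := by
    intro a b hab
    induction hab with
    | rel a b h =>
      obtain ⟨e, rfl, rfl⟩ := h
      exact hS e
    | refl => rfl
    | symm _ _ _ ih => exact ih.symm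
    | trans _ _ _ _ _ ih1 ih2 => exact ih1.trans ih2
  exact (hiff _ _ (P.connected r₀ r)).mp h0

theorem exists_edge (r : P.R) : ∃ e, P.left e = r ∨ P.right e = r :=
  region_induction (S := fun r => ∃ e, P.left e = r ∨ P.right e = r)
    (r₀ := P.left (Classical.arbitrary P.E)) ⟨_, Or.inl rfl⟩
    (fun e => ⟨fun _ => ⟨e, Or.inr rfl⟩, fun _ => ⟨e, Or.inl rfl⟩⟩) r

/-- Both sides sum over the edges that have endpoints, each once; closed circles occur in neither.
-/
theorem sum_out_eq_sum_in {M : Type*} [AddCommMonoid M] (h : P.E → M) :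
    ∑ v, (h (P.outL v) + h (P.outR v)) = ∑ v, (h (P.inL v) + h (P.inR v)) := by
  classical
  rw [Finset.sum_add_distrib, Finset.sum_add_distrib]
  have h1 := Fintype.sum_sum_type (fun x => h (Sum.elim P.outL P.outR x))
  have h2 := Fintype.sum_sum_type (fun x => h (Sum.elim P.inL P.inR x))
  simp only [Sum.elim_inl, Sum.elim_inr] at h1 h2
  rw [← h1, ← h2, ← Finset.sum_image (f := h) P.out_injective.injOn,
    ← Finset.sum_image (f := h) P.in_injective.injOn]
  congr 1
  ext e
  have := Set.ext_iff.mp P.range_out_eq_range_in e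
  simpa using this

/-- Since `a + c = b - d`, a positive sign sum of `a, c` forces `b > d`, and a negative one `b < d`.
If one of `a, c` and one of `b, d` vanish, the relation equates the remaining two up to sign, and
the product can be zero only if both vanish. -/
theorem alternating_signs {a b c d : ℝ} (h : a - b + c + d = 0) :
    ((SignType.sign a : ℤ) + SignType.sign c) * ((SignType.sign d : ℤ) - SignType.sign b) ≤ 0 ∧
    (((SignType.sign a : ℤ) + SignType.sign c) * ((SignType.sign d : ℤ) - SignType.sign b) = 0 →
      (a = 0 ∨ c = 0) → (b = 0 ∨ d = 0) → a = 0 ∧ b = 0 ∧ c = 0 ∧ d = 0) := by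
  rcases lt_trichotomy a 0 with ha | ha | ha <;> rcases lt_trichotomy b 0 with hb | hb | hb <;>
  rcases lt_trichotomy c 0 with hc | hc | hc <;> rcases lt_trichotomy d 0 with hd | hd | hd <;>
  first
  | (exfalso; linarith)
  | (refine ⟨by simp [ha, hb, hc, hd], fun h0 h1 h2 => ?_⟩
     rcases h1 with h1 | h1 <;> rcases h2 with h2 | h2 <;>
     first
     | (exfalso; linarith)
     | exact ⟨ha, hb, hc, hd⟩
     | simp [ha, hb, hc, hd] at h0)

/-- A function on the regions which satisfies relations with positive weights at all vertices, and
vanishes on both sides of an edge, vanishes. -/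
theorem eq_zero_of_weighted_relations (hc : P.IsConnected) {w : P.V → Corner → ℝ}
    (hw : ∀ v c, 0 < w v c) {f : P.R → ℝ}
    (hf : ∀ v, w v Corner.A * f (P.corner v Corner.A) - w v Corner.B * f (P.corner v Corner.B) +
      w v Corner.C * f (P.corner v Corner.C) + w v Corner.D * f (P.corner v Corner.D) = 0)
    {Q : P.E} (hl : f (P.left Q) = 0) (hr : f (P.right Q) = 0) : f = 0 := by
  set s : P.R → ℤ := fun r => (SignType.sign (f r) : ℤ) with hs
  have hsw : ∀ v c, (SignType.sign (w v c * f (P.corner v c)) : ℤ) = s (P.corner v c) := by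
    intro v c
    rw [sign_mul, sign_pos (hw v c), one_mul]
  have h1 := fun v => alternating_signs (hf v)
  simp only [hsw, mul_eq_zero, (hw _ _).ne', false_or] at h1
  -- At each vertex this is, up to sign, the difference of the sums of `s (left e) * s (right e)`
  -- over outgoing and incoming edges, so the total telescopes. As every term is nonpositive, every
  -- term is zero.
  have h2 : ∑ v, (s (P.corner v Corner.A) + s (P.corner v Corner.C)) *
      (s (P.corner v Corner.D) - s (P.corner v Corner.B)) = 0 := by
    have := sum_out_eq_sum_in (P := P) (fun e => s (P.left e) * s (P.right e))
    simp only [left_outL, right_outL, left_outR, right_outR, left_inL, right_inL, left_inR,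
      right_inR] at this
    rw [← sub_eq_zero, ← Finset.sum_sub_distrib] at this
    rw [← neg_eq_zero, ← this, ← Finset.sum_neg_distrib]
    exact Finset.sum_congr rfl fun v _ => by ring
  have h3 := fun v => (Finset.sum_eq_zero_iff_of_nonpos (fun v _ => (h1 v).1)).mp h2 v
    (Finset.mem_univ v)
  have h4 : ∀ v, ∀ e ∈ P.star v, f (P.left e) = 0 ∧ f (P.right e) = 0 →
      ∀ c, f (P.corner v c) = 0 := by
    intro v e he ⟨ha, hb⟩
    have h5 := (h1 v).2 (mul_eq_zero.mp (h3 v))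
    have h6 : (f (P.corner v Corner.A) = 0 ∨ f (P.corner v Corner.C) = 0) ∧
        (f (P.corner v Corner.B) = 0 ∨ f (P.corner v Corner.D) = 0) := by
      rcases he with rfl | rfl | rfl | rfl
      · exact ⟨Or.inl ha, Or.inr hb⟩
      · rw [left_inR] at ha; exact ⟨Or.inr hb, Or.inr ha⟩
      · rw [left_outL] at ha; exact ⟨Or.inl ha, Or.inl hb⟩
      · rw [left_outR] at ha; rw [right_outR] at hb; exact ⟨Or.inr hb, Or.inl ha⟩
    obtain ⟨hA, hB, hC, hD⟩ := h5 h6.1 h6.2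
    intro c
    cases c <;> assumption
  -- Vanishing on both sides of one edge at a vertex forces vanishing at all four corners, and so
  -- spreads through the connected projection.
  have h5 := edge_induction hc (S := fun e => f (P.left e) = 0 ∧ f (P.right e) = 0) ⟨hl, hr⟩ (by
    intro v e he e' he' h
    have h6 := h4 v e he h
    rcases he' with rfl | rfl | rfl | rfl
    · exact ⟨h6 .A, h6 .D⟩
    · rw [left_inR]; exact ⟨h6 .D, h6 .C⟩
    · rw [left_outL]; exact ⟨h6 .A, h6 .B⟩
    · rw [left_outR, right_outR]; exact ⟨h6 _, h6 _⟩)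
  funext r
  obtain ⟨e, rfl | rfl⟩ := exists_edge r
  exacts [(h5 e).1, (h5 e).2]

end SingularLinkDiagram

namespace SingularLinkDiagram

variable {P : SingularLinkDiagram}

/-! ### Flows and potentials -/

/-- The excess of the outgoing over the incoming flow at a vertex. -/
def boundary {M : Type*} [AddCommGroup M] (g : P.E → M) (v : P.V) : M :=
  g (P.outL v) + g (P.outR v) - g (P.inL v) - g (P.inR v)

theorem sum_boundary {M : Type*} [AddCommGroup M] (g : P.E → M) : ∑ v, P.boundary g v = 0 := by
  have := sum_out_eq_sum_in g
  rw [← sub_eq_zero, ← Finset.sum_sub_distrib] at this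
  rw [← this]
  exact Finset.sum_congr rfl fun v _ => by unfold boundary; abel

theorem outL_injective : Function.Injective P.outL := fun a b h =>
  Sum.inl_injective (P.out_injective (a₁ := Sum.inl a) (a₂ := Sum.inl b) h)

theorem outR_injective : Function.Injective P.outR := fun a b h =>
  Sum.inr_injective (P.out_injective (a₁ := Sum.inr a) (a₂ := Sum.inr b) h)

theorem inL_injective : Function.Injective P.inL := fun a b h =>
  Sum.inl_injective (P.in_injective (a₁ := Sum.inl a) (a₂ := Sum.inl b) h)

theorem inR_injective : Function.Injective P.inR := fun a b h =>
  Sum.inr_injective (P.in_injective (a₁ := Sum.inr a) (a₂ := Sum.inr b) h)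

theorem outL_ne_outR (a b : P.V) : P.outL a ≠ P.outR b := fun h =>
  Sum.inl_ne_inr (P.out_injective (a₁ := Sum.inl a) (a₂ := Sum.inr b) h)

theorem inL_ne_inR (a b : P.V) : P.inL a ≠ P.inR b := fun h =>
  Sum.inl_ne_inr (P.in_injective (a₁ := Sum.inl a) (a₂ := Sum.inr b) h)

open Classical in
theorem boundary_single {M : Type*} [AddCommGroup M] {e : P.E} {v v' : P.V} (m : M)
    (h : e = P.outL v ∨ e = P.outR v) (h' : e = P.inL v' ∨ e = P.inR v') :
    P.boundary (Pi.single e m) = Pi.single v m - Pi.single v' m := by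
  funext u
  have h1 : (Pi.single e m : P.E → M) (P.outL u) + (Pi.single e m : P.E → M) (P.outR u) =
      (Pi.single v m : P.V → M) u := by
    rcases h with rfl | rfl
    · simp [Pi.single_apply, outL_injective.eq_iff, (outL_ne_outR _ _).symm]
    · simp [Pi.single_apply, outR_injective.eq_iff, outL_ne_outR]
  have h2 : (Pi.single e m : P.E → M) (P.inL u) + (Pi.single e m : P.E → M) (P.inR u) =
      (Pi.single v' m : P.V → M) u := by
    rcases h' with rfl | rfl
    · simp [Pi.single_apply, inL_injective.eq_iff, (inL_ne_inR _ _).symm]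
    · simp [Pi.single_apply, inR_injective.eq_iff, inL_ne_inR]
  rw [boundary, sub_sub, h1, h2, Pi.sub_apply]

theorem boundary_add {M : Type*} [AddCommGroup M] (g h : P.E → M) :
    P.boundary (g + h) = P.boundary g + P.boundary h := by
  funext v
  simp only [boundary, Pi.add_apply]
  abel

theorem boundary_sub {M : Type*} [AddCommGroup M] (g h : P.E → M) :
    P.boundary (g - h) = P.boundary g - P.boundary h := by
  funext v
  simp only [boundary, Pi.sub_apply]
  abel

theorem mem_star_iff {e : P.E} {v : P.V} :
    e ∈ P.star v ↔ (e = P.outL v ∨ e = P.outR v) ∨ (e = P.inL v ∨ e = P.inR v) := by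
  simp only [star, Set.mem_insert_iff, Set.mem_singleton_iff]
  tauto

open Classical in
/-- On a connected projection there is an integral flow between any two vertices. -/
theorem exists_boundary_eq (hc : P.IsConnected) (v₀ w : P.V) :
    ∃ s : P.E → ℤ, P.boundary s = Pi.single w 1 - Pi.single v₀ 1 := by
  let Reach : P.V → Prop := fun w => ∃ s : P.E → ℤ, P.boundary s = Pi.single w 1 - Pi.single v₀ 1
  have h0 : Reach v₀ := ⟨0, by funext v; simp [boundary]⟩
  have hstep : ∀ e v v', e ∈ P.star v → e ∈ P.star v' → Reach v → Reach v' := by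
    rintro e v v' hv hv' ⟨s, hs⟩
    rcases mem_star_iff.mp hv with h | h <;> rcases mem_star_iff.mp hv' with h' | h'
    · have : v = v' := by
        rcases h with rfl | rfl <;> rcases h' with h' | h'
        exacts [outL_injective h', (outL_ne_outR _ _ h').elim, (outL_ne_outR _ _ h'.symm).elim,
          outR_injective h']
      exact this ▸ ⟨s, hs⟩
    · refine ⟨s - Pi.single e 1, ?_⟩
      rw [boundary_sub, hs, boundary_single 1 h h']
      abel
    · refine ⟨s + Pi.single e 1, ?_⟩
      rw [boundary_add, hs, boundary_single 1 h' h]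
      abel
    · have : v = v' := by
        rcases h with rfl | rfl <;> rcases h' with h' | h'
        exacts [inL_injective h', (inL_ne_inR _ _ h').elim, (inL_ne_inR _ _ h'.symm).elim,
          inR_injective h']
      exact this ▸ ⟨s, hs⟩
  have h1 := edge_induction hc (S := fun e => ∀ v, e ∈ P.star v → Reach v) (e₀ := P.outL v₀)
    (fun v hv => hstep _ v₀ v (by simp [star]) hv h0)
    (fun v e he e' he' h v' hv' => hstep e' v v' he' hv' (h v he))
  exact h1 (P.outL w) w (by simp [star])

theorem range_out_eq_univ (hc : P.IsConnected) (v₀ : P.V) :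
    Set.range (Sum.elim P.outL P.outR) = Set.univ := by
  refine Set.eq_univ_of_forall (edge_induction hc (e₀ := P.outL v₀) ⟨Sum.inl v₀, rfl⟩ ?_)
  intro v e _ e' he' _
  rcases he' with rfl | rfl | rfl | rfl
  · rw [P.range_out_eq_range_in]; exact ⟨Sum.inl v, rfl⟩
  · rw [P.range_out_eq_range_in]; exact ⟨Sum.inr v, rfl⟩
  · exact ⟨Sum.inl v, rfl⟩
  · exact ⟨Sum.inr v, rfl⟩

/-- On a connected projection with at least one vertex, every edge starts at a unique vertex. -/
noncomputable def outEquiv (hc : P.IsConnected) (v₀ : P.V) : P.V ⊕ P.V ≃ P.E :=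
  Equiv.ofBijective (Sum.elim P.outL P.outR)
    ⟨P.out_injective, Set.range_eq_univ.mp (range_out_eq_univ hc v₀)⟩

/-- Likewise every edge ends at a unique vertex. -/
noncomputable def inEquiv (hc : P.IsConnected) (v₀ : P.V) : P.V ⊕ P.V ≃ P.E :=
  Equiv.ofBijective (Sum.elim P.inL P.inR)
    ⟨P.in_injective, Set.range_eq_univ.mp (P.range_out_eq_range_in ▸ range_out_eq_univ hc v₀)⟩

theorem edge_unique_of_isEmpty (hc : P.IsConnected) [IsEmpty P.V] (e e' : P.E) : e = e' :=
  edge_induction hc (S := fun e => e = e') (e₀ := e') rfl (fun v => isEmptyElim v) e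

/-- A rational flow without sources has a potential. -/
theorem exists_rat_potential (hc : P.IsConnected) {g : P.E → ℚ} (hg : P.boundary g = 0) :
    ∃ f : P.R → ℚ, ∀ e, g e = f (P.left e) - f (P.right e) := by
  classical
  let grad : (P.R → ℚ) →ₗ[ℚ] (P.E → ℚ) :=
    { toFun := fun f e => f (P.left e) - f (P.right e)
      map_add' := fun f f' => by funext e; simp only [Pi.add_apply]; ring
      map_smul' := fun c f => by funext e; simp [mul_sub] }
  let bd : (P.E → ℚ) →ₗ[ℚ] (P.V → ℚ) :=
    { toFun := P.boundary
      map_add' := boundary_add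
      map_smul' := fun c f => by
        funext e
        simp only [boundary, Pi.smul_apply, smul_eq_mul, RingHom.id_apply]
        ring }
  have hle : LinearMap.range grad ≤ LinearMap.ker bd := by
    rintro _ ⟨f, rfl⟩
    rw [LinearMap.mem_ker]
    funext v
    change P.boundary (fun e => f (P.left e) - f (P.right e)) v = 0
    simp only [boundary, left_outL, right_outL, left_outR, right_outR, left_inL, right_inL,
      left_inR, right_inR]
    ring
  -- A dimension count in place of planar homology. Only constants have zero gradient, so by Euler's
  -- formula the gradients have dimension at least `|V| + 1`.
  have hker : Module.finrank ℚ (LinearMap.ker grad) ≤ 1 := by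
    have : LinearMap.ker grad ≤ Submodule.span ℚ {(1 : P.R → ℚ)} := by
      intro f hf
      rw [LinearMap.mem_ker] at hf
      have h1 : ∀ e, f (P.left e) = f (P.right e) := fun e => sub_eq_zero.mp (congrFun hf e)
      rw [Submodule.mem_span_singleton]
      let r₀ := P.left (Classical.arbitrary P.E)
      refine ⟨f r₀, ?_⟩
      funext r
      have := region_induction (S := fun r => f r = f r₀) (r₀ := r₀) rfl (fun e => by rw [h1 e]) r
      simp [this]
    exact (Submodule.finrank_mono this).trans ((finrank_span_le_card _).trans (by simp))
  -- Conversely, if there is a vertex then `|E| = 2 |V|`, and the flows between vertices show that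
  -- the boundary has rank at least `|V| - 1`. Without vertices there is just one closed circle.
  have hbd : Module.finrank ℚ (LinearMap.ker bd) ≤ Fintype.card P.V + 1 := by
    have hrn := LinearMap.finrank_range_add_finrank_ker bd
    rw [Module.finrank_pi] at hrn
    rcases isEmpty_or_nonempty P.V with hV | ⟨⟨v₀⟩⟩
    · have : Fintype.card P.E ≤ 1 :=
        Fintype.card_le_one_iff.mpr (edge_unique_of_isEmpty hc)
      omega
    · have hE : Fintype.card P.E = Fintype.card P.V + Fintype.card P.V := by
        rw [← Fintype.card_congr (outEquiv hc v₀), Fintype.card_sum]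
      have htop : LinearMap.range bd ⊔ Submodule.span ℚ {(Pi.single v₀ 1 : P.V → ℚ)} = ⊤ := by
        rw [eq_top_iff]
        rintro y -
        have hy : y = ∑ w, y w • (Pi.single w 1 : P.V → ℚ) := by
          funext v
          simp [Finset.sum_apply, Pi.single_apply]
        rw [hy]
        refine Submodule.sum_mem _ fun w _ => Submodule.smul_mem _ _ ?_
        obtain ⟨s, hs⟩ := exists_boundary_eq hc v₀ w
        have h2 : (Pi.single w 1 : P.V → ℚ) = bd (fun e => (s e : ℚ)) + Pi.single v₀ 1 := by
          funext v
          have := congrArg (Int.cast : ℤ → ℚ) (congrFun hs v)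
          simp only [boundary, Pi.sub_apply, Pi.single_apply] at this
          push_cast at this
          change _ = P.boundary (fun e => (s e : ℚ)) v + _
          simp only [boundary, Pi.single_apply]
          linarith
        rw [h2]
        exact Submodule.add_mem_sup (LinearMap.mem_range_self _ _)
          (Submodule.mem_span_singleton_self _)
      have h3 := Submodule.finrank_add_le_finrank_add_finrank (LinearMap.range bd)
        (Submodule.span ℚ {(Pi.single v₀ 1 : P.V → ℚ)})
      rw [htop, finrank_top, Module.finrank_pi] at h3
      have h4 : Module.finrank ℚ (Submodule.span ℚ {(Pi.single v₀ 1 : P.V → ℚ)}) ≤ 1 :=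
        (finrank_span_le_card _).trans (by simp)
      omega
  have hrn := LinearMap.finrank_range_add_finrank_ker grad
  rw [Module.finrank_pi, card_eq_of_isConnected hc] at hrn
  have heq : LinearMap.range grad = LinearMap.ker bd :=
    Submodule.eq_of_le_of_finrank_le hle (by omega)
  have hmem : g ∈ LinearMap.range grad := by
    rw [heq]
    exact LinearMap.mem_ker.mpr hg
  obtain ⟨f, rfl⟩ := hmem
  exact ⟨f, fun e => rfl⟩

/-- An integral flow without sources has an integral potential, with prescribed zero. -/
theorem exists_potential (hc : P.IsConnected) {g : P.E → ℤ} (hg : P.boundary g = 0) (r₀ : P.R) :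
    ∃ f : P.R → ℤ, f r₀ = 0 ∧ ∀ e, g e = f (P.left e) - f (P.right e) := by
  have hg' : P.boundary (fun e => (g e : ℚ)) = 0 := by
    funext v
    have := congrArg (Int.cast : ℤ → ℚ) (congrFun hg v)
    simpa [boundary] using this
  obtain ⟨f, hf⟩ := exists_rat_potential hc hg'
  -- The potential jumps by the integer `g e` across `e`, so integrality of differences spreads from
  -- `r₀` to every region.
  have h1 : ∀ r, ∃ n : ℤ, f r - f r₀ = n := by
    refine region_induction (r₀ := r₀) ⟨0, by simp⟩ fun e => ⟨?_, ?_⟩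
    · rintro ⟨n, hn⟩
      exact ⟨n - g e, by push_cast; rw [hf e, ← hn]; ring⟩
    · rintro ⟨n, hn⟩
      exact ⟨n + g e, by push_cast; rw [hf e, ← hn]; ring⟩
  choose f' hf' using h1
  refine ⟨f', ?_, fun e => ?_⟩
  · have := hf' r₀
    rw [sub_self] at this
    exact_mod_cast this.symm
  · have : (g e : ℚ) = f' (P.left e) - f' (P.right e) := by
      rw [hf e, ← hf', ← hf']; ring
    exact_mod_cast this

/-- The Alexander numbering of the regions. -/
theorem exists_index (hc : P.IsConnected) :
    ∃ ind : P.R → ℤ, ∀ e, ind (P.left e) = ind (P.right e) + 1 := by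
  obtain ⟨f, -, hf⟩ := exists_potential hc (g := fun _ : P.E => (1 : ℤ))
    (by funext v; simp [boundary]) (P.left (Classical.arbitrary P.E))
  exact ⟨f, fun e => by have := hf e; omega⟩

theorem left_ne_right (hc : P.IsConnected) (e : P.E) : P.left e ≠ P.right e := by
  obtain ⟨ind, h⟩ := exists_index hc
  intro he
  have := h e
  rw [he] at this
  omega

end SingularLinkDiagram

/-! ### Transition matrices and a unimodular basis of the edge space -/

/-- The state weights at a vertex at which a flow arriving from the left (right) leaves to the left
with weight `p` (respectively `q`). -/
def flowWeight {A : Type} [CommRing A] (p q : A) : Corner → A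
  | Corner.A => 1 - p
  | Corner.B => 1
  | Corner.C => q
  | Corner.D => p - q

namespace SingularLinkDiagram

variable {P : SingularLinkDiagram}

/-- The edge leaving a vertex to the left (`inl`) or to the right (`inr`). -/
def out (P : SingularLinkDiagram) : P.V ⊕ P.V → P.E := Sum.elim P.outL P.outR

open Classical in
/-- The transition weights into the edges which leave a vertex. -/
noncomputable def transitionRow {A : Type} [CommRing A] (p q : P.V → A) : P.V ⊕ P.V → P.E → A
  | Sum.inl v => Pi.single (P.inL v) (p v) + Pi.single (P.inR v) (q v)
  | Sum.inr v => Pi.single (P.inL v) (1 - p v) + Pi.single (P.inR v) (1 - q v)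

open Classical in
/-- The matrix of transition weights between edges; rows are indexed by the target edge. -/
noncomputable def transition {A : Type} [CommRing A] (p q : P.V → A) : Matrix P.E P.E A :=
  Matrix.of fun e e' => ∑ x, if P.out x = e then transitionRow p q x e' else 0

open Classical in
/-- The principal minor of `1 - transition` at the edge `Q`. -/
noncomputable def edgeDet {A : Type} [CommRing A] (p q : P.V → A) (Q : P.E) : A :=
  ((1 - transition p q).updateRow Q (Pi.single Q 1)).det

theorem out_injective' : Function.Injective P.out := P.out_injective

theorem transition_out {A : Type} [CommRing A] (p q : P.V → A) (x : P.V ⊕ P.V) :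
    transition p q (P.out x) = transitionRow p q x := by
  funext e'
  rw [transition, Matrix.of_apply, Finset.sum_eq_single x]
  · simp
  · intro y _ hy
    rw [if_neg (out_injective'.ne hy)]
  · simp

theorem transitionRow_dot {A : Type} [CommRing A] (p q : P.V → A) (g : P.E → A) (v : P.V) :
    ∑ e, transitionRow p q (Sum.inl v) e * g e = p v * g (P.inL v) + q v * g (P.inR v) ∧
    ∑ e, transitionRow p q (Sum.inr v) e * g e =
      (1 - p v) * g (P.inL v) + (1 - q v) * g (P.inR v) := by
  classical
  simp [transitionRow, add_mul, Finset.sum_add_distrib, Pi.single_apply]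

-- Flow is conserved: what enters a vertex along an edge leaves with total weight `p + (1 - p)` or
-- `q + (1 - q)`, so each column of the transition matrix sums to 1.
open Classical in
theorem sum_one_sub_transition {A : Type} [CommRing A] (hc : P.IsConnected) (v₀ : P.V)
    (p q : P.V → A) (e' : P.E) : ∑ e, (1 - transition p q : Matrix P.E P.E A) e e' = 0 := by
  simp only [Matrix.sub_apply, Finset.sum_sub_distrib]
  rw [sub_eq_zero, ← (outEquiv hc v₀).sum_comp (fun e => transition p q e e')]
  have h1 : ∀ x, outEquiv hc v₀ x = P.out x := fun x => rfl
  simp only [h1, transition_out, Fintype.sum_sum_type, transitionRow, Pi.add_apply]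
  have h2 : ∑ e, (1 : Matrix P.E P.E A) e e' = 1 := by simp [Matrix.one_apply]
  rw [h2, ← Finset.sum_add_distrib]
  have h3 := (inEquiv hc v₀).sum_comp (fun e => (Pi.single e (1 : A) : P.E → A) e')
  have h4 : ∀ x, inEquiv hc v₀ x = Sum.elim P.inL P.inR x := fun x => rfl
  simp only [h4, Fintype.sum_sum_type, Sum.elim_inl, Sum.elim_inr] at h3
  have h5 : ∑ e, (Pi.single e (1 : A) : P.E → A) e' = 1 := by
    simp [Pi.single_apply]
  refine (Eq.trans ?_ h5).symm
  rw [← h3, ← Finset.sum_add_distrib]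
  refine Finset.sum_congr rfl fun v _ => ?_
  simp only [Pi.single_apply]
  split_ifs <;> ring

open Classical in
theorem det_one_sub_transition {A : Type} [CommRing A] [IsDomain A] (hc : P.IsConnected)
    (v₀ : P.V) (p q : P.V → A) : (1 - transition p q : Matrix P.E P.E A).det = 0 := by
  rw [← Matrix.exists_vecMul_eq_zero_iff]
  refine ⟨fun _ => 1, ?_, ?_⟩
  · intro h
    exact one_ne_zero (congrFun h (P.outL v₀))
  · funext e'
    simpa [Matrix.vecMul, dotProduct] using sum_one_sub_transition hc v₀ p q e'

theorem sum_regions {M : Type*} [AddCommMonoid M] {ι : P.V → P.R} (hι : Function.Injective ι)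
    {X Y : P.R} (hXY : X ≠ Y) (hr : Set.range ι = {r | r ≠ X ∧ r ≠ Y}) (F : P.R → M) :
    ∑ r, F r = F X + F Y + ∑ u, F (ι u) := by
  classical
  have h1 : (Finset.univ : Finset P.R) = {X, Y} ∪ Finset.univ.image ι := by
    ext r
    have := Set.ext_iff.mp hr r
    simp only [Set.mem_range, Set.mem_ofPred_eq] at this
    simp only [Finset.mem_univ, Finset.mem_union, Finset.mem_insert, Finset.mem_singleton,
      Finset.mem_image, true_and, true_iff, this]
    tauto
  rw [h1, Finset.sum_union, Finset.sum_pair hXY, Finset.sum_image hι.injOn]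
  rw [Finset.disjoint_right]
  intro r hr'
  have := Set.ext_iff.mp hr r
  simp only [Set.mem_range, Set.mem_ofPred_eq] at this
  simp only [Finset.mem_image, Finset.mem_univ, true_and, this] at hr'
  simp [hr'.1, hr'.2]

theorem exists_tail (hc : P.IsConnected) (v : P.V) (Q : P.E) :
    ∃ v₀, Q = P.outL v₀ ∨ Q = P.outR v₀ := by
  have := range_out_eq_univ hc v
  obtain ⟨x | x, rfl⟩ := Set.range_eq_univ.mp this Q
  exacts [⟨x, Or.inl rfl⟩, ⟨x, Or.inr rfl⟩]

open Classical in
/-- There is a unimodular integral matrix whose columns are flows `s w` into the vertices and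
gradients of regions. -/
theorem exists_unimodular (hc : P.IsConnected) {Q : P.E} {v₀ : P.V}
    {ι : P.V → P.R} (hι : Function.Injective ι)
    (hr : Set.range ι = {r | r ≠ P.left Q ∧ r ≠ P.right Q}) :
    ∃ (G : P.V ⊕ P.V → P.E → ℤ),
      (∀ w ≠ v₀, P.boundary (G (Sum.inl w)) = Pi.single w 1 - Pi.single v₀ 1) ∧
      P.boundary (G (Sum.inl v₀)) = 0 ∧ G (Sum.inl v₀) Q = 1 ∧
      (∀ u, G (Sum.inr u) = fun e => (Pi.single (ι u) 1 : P.R → ℤ) (P.left e) -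
        (Pi.single (ι u) 1 : P.R → ℤ) (P.right e)) ∧
      IsUnit (Matrix.of fun x y => G y (P.out x)).det := by
  have hXY := left_ne_right hc Q
  choose s hs using exists_boundary_eq hc v₀
  let gr : P.R → P.E → ℤ := fun r e =>
    (Pi.single r 1 : P.R → ℤ) (P.left e) - (Pi.single r 1 : P.R → ℤ) (P.right e)
  have hgr : ∀ r, P.boundary (gr r) = 0 := by
    intro r
    funext v
    simp only [boundary, gr, left_outL, right_outL, left_outR, right_outR, left_inL, right_inL,
      left_inR, right_inR, Pi.zero_apply]
    ring
  -- The slot of `v₀`, for which no flow is needed, holds the gradient of the excluded region `right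
  -- Q`, with the sign that makes its value on `Q` equal to 1. The region `left Q` can be omitted
  -- since all gradients add up to zero.
  let G : P.V ⊕ P.V → P.E → ℤ :=
    Sum.elim (fun w => if w = v₀ then -gr (P.right Q) else s w) (fun u => gr (ι u))
  -- Subtracting the basic flows with the right multiplicities removes all sources of a unit flow on
  -- `e`. What is left is the gradient of a potential, whose values are the coordinates of the
  -- inverse matrix.
  have hpot : ∀ e, ∃ f : P.R → ℤ, f (P.left Q) = 0 ∧ ∀ e',
      (Pi.single e 1 : P.E → ℤ) e' - ∑ w ∈ Finset.univ.erase v₀,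
        P.boundary (Pi.single e 1 : P.E → ℤ) w * s w e' = f (P.left e') - f (P.right e') := by
    intro e
    refine exists_potential hc (g := fun e' => (Pi.single e 1 : P.E → ℤ) e' -
      ∑ w ∈ Finset.univ.erase v₀, P.boundary (Pi.single e 1 : P.E → ℤ) w * s w e') ?_ _
    have h1 : ∀ v, P.boundary (fun e' => (Pi.single e 1 : P.E → ℤ) e' -
      ∑ w ∈ Finset.univ.erase v₀, P.boundary (Pi.single e 1 : P.E → ℤ) w * s w e') v =
      P.boundary (Pi.single e 1 : P.E → ℤ) v - ∑ w ∈ Finset.univ.erase v₀,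
        P.boundary (Pi.single e 1 : P.E → ℤ) w * P.boundary (s w) v := by
      intro v
      simp only [boundary, mul_sub, mul_add, Finset.sum_sub_distrib, Finset.sum_add_distrib]
      ring
    have h2 : ∑ w ∈ Finset.univ.erase v₀, P.boundary (Pi.single e 1 : P.E → ℤ) w =
        -P.boundary (Pi.single e 1 : P.E → ℤ) v₀ := by
      rw [Finset.sum_erase_eq_sub (Finset.mem_univ v₀), sum_boundary, zero_sub]
    funext v
    rw [h1]
    simp only [hs, Pi.sub_apply, mul_sub, Finset.sum_sub_distrib]
    rw [← Finset.sum_mul, h2]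
    by_cases hv : v = v₀
    · subst hv
      rw [Finset.sum_eq_zero]
      · simp
      · intro w hw
        simp [(Finset.ne_of_mem_erase hw).symm]
    · rw [Finset.sum_eq_single v]
      · simp [hv]
      · intro w _ hw
        simp [hw.symm]
      · intro h
        simp [hv] at h
  choose f hf0 hf using hpot
  refine ⟨G, ?_, ?_, ?_, ?_, ?_⟩
  · intro w hw
    simp [G, hw, hs]
  · have h1 : P.boundary (-gr (P.right Q)) = -P.boundary (gr (P.right Q)) := by
      funext v
      simp only [boundary, Pi.neg_apply]
      ring
    simp [G, h1, hgr]
  · simp [G, gr, hXY]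
  · intro u
    rfl
  · let H : Matrix (P.V ⊕ P.V) (P.V ⊕ P.V) ℤ := Matrix.of fun x y => Sum.elim
      (fun w => if w = v₀ then -f (P.out y) (P.right Q) else
        P.boundary (Pi.single (P.out y) 1 : P.E → ℤ) w) (fun u => f (P.out y) (ι u)) x
    refine Matrix.isUnit_det_of_right_inverse (B := H) ?_
    ext x y
    rw [Matrix.mul_apply, Fintype.sum_sum_type]
    have h1 := sum_regions hι hXY hr (fun r => gr r (P.out x) * f (P.out y) r)
    have h2 : ∑ r, gr r (P.out x) * f (P.out y) r =
        f (P.out y) (P.left (P.out x)) - f (P.out y) (P.right (P.out x)) := by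
      simp [gr, sub_mul, Finset.sum_sub_distrib, Pi.single_apply]
    rw [h2, ← hf, hf0] at h1
    have h3 : ∑ w, G (Sum.inl w) (P.out x) * H (Sum.inl w) y =
        gr (P.right Q) (P.out x) * f (P.out y) (P.right Q) + ∑ w ∈ Finset.univ.erase v₀,
        P.boundary (Pi.single (P.out y) 1 : P.E → ℤ) w * s w (P.out x) := by
      rw [← Finset.add_sum_erase _ _ (Finset.mem_univ v₀)]
      congr 1
      · simp [G, H]
      · refine Finset.sum_congr rfl fun w hw => ?_
        simp [G, H, Finset.ne_of_mem_erase hw]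
        ring
    have h4 : ∑ u, G (Sum.inr u) (P.out x) * H (Sum.inr u) y =
        ∑ u, gr (ι u) (P.out x) * f (P.out y) (ι u) := rfl
    simp only [Matrix.of_apply]
    rw [h3, h4, Matrix.one_apply]
    have h5 : (Pi.single (P.out y) 1 : P.E → ℤ) (P.out x) = if x = y then 1 else 0 := by
      simp [Pi.single_apply, out_injective'.eq_iff]
    rw [h5] at h1
    linarith

end SingularLinkDiagram

/-- This lets vectors on the columns be read as functions on all regions, zero on the deleted ones,
so that a kernel vector becomes a solution of the weighted vertex relations. -/
theorem cornerMatrix_mulVec {V R A : Type} [Fintype V] [CommRing A] {reg : V → Corner → R}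
    {ι : V → R} (hι : Function.Injective ι) (w : V → Corner → A) {F : R → A}
    (hF : ∀ r ∉ Set.range ι, F r = 0) (v : V) :
    (cornerMatrix reg ι w).mulVec (F ∘ ι) v =
      ∑ c, (cornerSign c : A) * w v c * F (reg v c) := by
  classical
  simp only [Matrix.mulVec, dotProduct, cornerMatrix, Matrix.of_apply, Finset.sum_mul,
    Function.comp_apply]
  rw [Finset.sum_comm]
  refine Finset.sum_congr rfl fun c _ => ?_
  by_cases h : reg v c ∈ Set.range ι
  · obtain ⟨u, hu⟩ := h
    rw [Finset.sum_eq_single u]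
    · simp [hu]
    · intro u' _ hne
      rw [if_neg (by rw [← hu]; exact hι.ne hne.symm), zero_mul]
    · simp
  · rw [hF _ h, mul_zero]
    refine Finset.sum_eq_zero fun u _ => ?_
    rw [if_neg (fun hh => h ⟨u, hh.symm⟩), zero_mul]

namespace SingularLinkDiagram

variable {P : SingularLinkDiagram}

/-- The regions not adjacent to the edge `Q`, all vertices being regarded as crossings. -/
def awayFrom (P : SingularLinkDiagram) (Q : P.E) : Set P.R :=
  {r | r ≠ P.left Q ∧ r ≠ P.right Q}

theorem exists_enumeration (hc : P.IsConnected) (Q : P.E) :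
    ∃ ι : P.V → P.R, Function.Injective ι ∧ Set.range ι = P.awayFrom Q := by
  classical
  have h1 : Fintype.card P.V = Fintype.card (P.awayFrom Q) := by
    have h2 : P.awayFrom Q = (({P.left Q, P.right Q} : Finset P.R)ᶜ : Finset P.R) := by
      ext r
      simp [awayFrom, and_comm]
    have h3 := Finset.card_compl ({P.left Q, P.right Q} : Finset P.R)
    rw [Finset.card_pair (left_ne_right hc Q), card_eq_of_isConnected hc] at h3
    rw [← Nat.card_eq_fintype_card (α := P.awayFrom Q), h2]
    simp only [Nat.card_eq_fintype_card, SetLike.coe_sort_coe, Fintype.card_coe]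
    omega
  let e := Fintype.equivOfCardEq h1
  refine ⟨fun v => (e v).1, fun a b h => e.injective (Subtype.ext h), ?_⟩
  ext r
  constructor
  · rintro ⟨v, rfl⟩
    exact (e v).2
  · intro hr
    exact ⟨e.symm ⟨r, hr⟩, by simp⟩

open Classical in
theorem det_cornerMatrix_ne_zero (hc : P.IsConnected) {Q : P.E} {ι : P.V → P.R}
    (hι : Function.Injective ι) (hr : Set.range ι = P.awayFrom Q) {w : P.V → Corner → ℝ}
    (hw : ∀ v c, 0 < w v c) : (cornerMatrix P.corner ι w).det ≠ 0 := by
  intro h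
  obtain ⟨f, hf, hf0⟩ := Matrix.exists_mulVec_eq_zero_iff.mpr h
  have hF : ∀ r ∉ Set.range ι, Function.extend ι f 0 r = 0 := fun r hr' => by
    rw [Function.extend_apply' _ _ _ (fun ⟨u, hu⟩ => hr' ⟨u, hu⟩)]
    rfl
  have hcomp : Function.extend ι f 0 ∘ ι = f := by
    funext u
    exact hι.extend_apply _ _ _
  have h1 := eq_zero_of_weighted_relations hc hw (f := Function.extend ι f 0) (Q := Q) (by
    intro v
    have := cornerMatrix_mulVec (reg := P.corner) hι w hF v
    rw [hcomp, hf0, Corner.sum_eq] at this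
    simp only [cornerSign, Pi.zero_apply] at this
    push_cast at this
    linarith) (hF _ (by rw [hr]; exact fun h => h.1 rfl)) (hF _ (by rw [hr]; exact fun h => h.2 rfl))
  apply hf
  rw [← hcomp, h1]
  rfl

open Classical in
theorem exists_sign_det (hc : P.IsConnected) {Q : P.E} {ι : P.V → P.R}
    (hι : Function.Injective ι) (hr : Set.range ι = P.awayFrom Q) :
    ∃ ε : ℤˣ, ∀ (A : Type) [CommRing A] (w : P.V → Corner → A),
      (cornerMatrix P.corner ι w).det =
        ((ε : ℤ) : A) * selectionSum P.corner (P.awayFrom Q) w := by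
  rw [← hr]
  exact exists_sign_det_cornerMatrix hι fun w hw => det_cornerMatrix_ne_zero hc hι hr hw

open Classical in
/-- Up to a sign independent of the weights, the edge determinant is the determinant of the corner
matrix. -/
theorem exists_sign_edgeDet (hc : P.IsConnected) (v : P.V) {Q : P.E} {ι : P.V → P.R}
    (hι : Function.Injective ι) (hr : Set.range ι = P.awayFrom Q) :
    ∃ c : ℤˣ, ∀ (A : Type) [CommRing A] [IsDomain A] (p q : P.V → A),
      edgeDet p q Q = ((c : ℤ) : A) *
        (cornerMatrix P.corner ι fun v => flowWeight (p v) (q v)).det := by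
  obtain ⟨v₀, hv₀⟩ := exists_tail hc v Q
  obtain ⟨G, hG1, hG2, hG3, hG4, hdet⟩ := exists_unimodular (v₀ := v₀) hc hι hr
  -- The change of basis contributes its determinant, and the block of negated corner relations
  -- contributes `(-1) ^ |V|`.
  refine ⟨hdet.unit⁻¹ * (-1) ^ Fintype.card P.V, fun A _ _ p q => ?_⟩
  -- Since `1 - transition` is singular, adding the unit vector to row `Q` has the same determinant
  -- as replacing the row by it. The added form preserves the conservation law up to one correction.
  set L : Matrix P.E P.E A := (1 - transition p q).updateRow Q
    ((1 - transition p q : Matrix P.E P.E A) Q + Pi.single Q 1) with hL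
  have hLdet : L.det = edgeDet p q Q := by
    rw [hL, Matrix.det_updateRow_add, Matrix.updateRow_eq_self, det_one_sub_transition hc v₀,
      zero_add, edgeDet]
  have hLentry : ∀ (x : P.V ⊕ P.V) (g : P.E → A), ∑ e, L (P.out x) e * g e =
      g (P.out x) - ∑ e, transitionRow p q x e * g e + (if P.out x = Q then g Q else 0) := by
    intro x g
    have h1 : ∀ e, L (P.out x) e = (1 - transition p q : Matrix P.E P.E A) (P.out x) e +
        (if P.out x = Q then (Pi.single Q 1 : P.E → A) e else 0) := by
      intro e
      rw [hL, Matrix.updateRow_apply]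
      split_ifs with h
      · rw [h]; rfl
      · rw [add_zero]
    simp only [h1, add_mul, Finset.sum_add_distrib, Matrix.sub_apply, sub_mul,
      Finset.sum_sub_distrib, transition_out]
    congr 1
    · congr 1
      simp [Matrix.one_apply]
    · split_ifs <;> simp [Pi.single_apply]
  let Gm : Matrix P.E (P.V ⊕ P.V) A := Matrix.of fun e y => (G y e : A)
  let oe := outEquiv hc v₀
  have hoe : ∀ x, oe x = P.out x := fun x => rfl
  let N : Matrix (P.V ⊕ P.V) (P.V ⊕ P.V) A := (L * Gm).submatrix oe id
  have hN : N.det = L.det * ((Matrix.of fun x y => G y (P.out x)).det : ℤ) := by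
    have h1 : N = L.submatrix oe oe * Gm.submatrix oe id := by
      rw [Matrix.submatrix_mul_equiv]
    rw [h1, Matrix.det_mul, Matrix.det_submatrix_equiv_self, Int.cast_det]
    congr 2
  have hNentry : ∀ x y, N x y = (G y (P.out x) : A) - ∑ e, transitionRow p q x e * (G y e : A) +
      (if P.out x = Q then (G y Q : A) else 0) := by
    intro x y
    exact hLentry x (fun e => (G y e : A))
  -- Adding the two rows that leave a vertex eliminates the weights: only the boundary remains, with
  -- a correction at the tail `v₀` of `Q`.
  have hrow : ∀ v y, N (Sum.inl v) y + N (Sum.inr v) y =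
      ((P.boundary (G y) v : ℤ) : A) + (if v = v₀ then (G y Q : A) else 0) := by
    intro v y
    have h1 : (if P.out (Sum.inl v) = Q then (G y Q : A) else 0) +
        (if P.out (Sum.inr v) = Q then (G y Q : A) else 0) =
        if v = v₀ then (G y Q : A) else 0 := by
      change (if P.outL v = Q then (G y Q : A) else 0) + (if P.outR v = Q then (G y Q : A) else 0) = _
      rcases hv₀ with rfl | rfl
      · simp [outL_injective.eq_iff, (outL_ne_outR _ _).symm]
      · simp [outR_injective.eq_iff, outL_ne_outR]
    rw [← h1, hNentry, hNentry, (transitionRow_dot p q (fun e => (G y e : A)) v).1,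
      (transitionRow_dot p q (fun e => (G y e : A)) v).2]
    have h2 : G y (P.out (Sum.inl v)) = G y (P.outL v) := rfl
    have h3 : G y (P.out (Sum.inr v)) = G y (P.outR v) := rfl
    simp only [boundary, h2, h3]
    push_cast
    ring
  have hgrad : ∀ u, P.boundary (G (Sum.inr u)) = 0 := by
    intro u
    rw [hG4]
    funext v
    simp only [boundary, left_outL, right_outL, left_outR, right_outR, left_inL, right_inL,
      left_inR, right_inR, Pi.zero_apply]
    ring
  have hQ : ∀ u, G (Sum.inr u) Q = 0 := by
    intro u
    have hu : ι u ∈ P.awayFrom Q := hr ▸ Set.mem_range_self u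
    rw [hG4]
    simp [hu.1.symm, hu.2.symm]
  let b : P.V → A := fun w => if w = v₀ then 1 else (G (Sum.inl w) Q : A) - 1
  have hdetb : ((1 : Matrix P.V P.V A).updateRow v₀ b).det = 1 := by
    rw [← Matrix.cramer_transpose_apply]
    simp [b]
  -- After this row operation, gradients vanish in the upper rows. In the lower rows a gradient
  -- produces the flow relation at the right outgoing edge, which is minus the corner relation with
  -- `flowWeight`.
  have hblock : Matrix.fromBlocks 1 1 0 1 * N = Matrix.fromBlocks
      ((1 : Matrix P.V P.V A).updateRow v₀ b) 0 (Matrix.of fun v w => N (Sum.inr v) (Sum.inl w))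
      (-cornerMatrix P.corner ι fun v => flowWeight (p v) (q v)) := by
    rw [← Matrix.fromBlocks_toBlocks N, Matrix.fromBlocks_multiply]
    simp only [one_mul, zero_mul, zero_add]
    congr 1
    · ext v w
      change N (Sum.inl v) (Sum.inl w) + N (Sum.inr v) (Sum.inl w) = _
      rw [hrow, Matrix.updateRow_apply]
      by_cases hw : w = v₀
      · subst hw
        by_cases hv : v = w
        · subst hv
          simp [hG2, hG3, b]
        · simp [hG2, hv]
      · rw [hG1 w hw]
        by_cases hv : v = v₀
        · subst hv
          simp [b, hw, Ne.symm hw]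
          ring
        · simp [hv, Matrix.one_apply, Pi.single_apply]
    · ext v w
      change N (Sum.inl v) (Sum.inr w) + N (Sum.inr v) (Sum.inr w) = _
      rw [hrow, hgrad, hQ]
      simp
    · ext v u
      change N (Sum.inr v) (Sum.inr u) = _
      rw [hNentry, hQ, (transitionRow_dot p q (fun e => (G (Sum.inr u) e : A)) v).2, hG4]
      simp only [out, Sum.elim_inr, left_outR, right_outR, left_inL, right_inL,
        left_inR, right_inR, Int.cast_zero, ite_self, add_zero, Matrix.neg_apply, cornerMatrix,
        Matrix.of_apply, Corner.sum_eq, cornerSign, flowWeight]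
      have h1 : ∀ r, (((Pi.single (ι u) 1 : P.R → ℤ) r : ℤ) : A) = if r = ι u then 1 else 0 := by
        intro r
        simp [Pi.single_apply]
      push_cast
      simp only [h1]
      split_ifs <;> ring
  have h2 := congrArg Matrix.det hblock
  rw [Matrix.det_mul, Matrix.det_fromBlocks_zero₂₁, Matrix.det_fromBlocks_zero₁₂, hdetb, hN, hLdet,
    Matrix.det_neg] at h2
  simp only [Matrix.det_one, one_mul] at h2
  have h3 : (((hdet.unit⁻¹ : ℤˣ) : ℤ) : A) * ((Matrix.of fun x y => G y (P.out x)).det : ℤ) = 1 := by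
    rw [← Int.cast_mul, hdet.val_inv_mul, Int.cast_one]
  push_cast
  linear_combination (((hdet.unit⁻¹ : ℤˣ) : ℤ) : A) * h2 - edgeDet p q Q * h3

end SingularLinkDiagram

/-! ### Principal minors, triangularity and positivity -/

/-- With row `i` replaced by the unit vector, the matrix sends the kernel vector `u` to `u i` times
that unit vector; applying the adjugate gives the identity without division. -/
theorem Matrix.adjugate_self_mul {n A : Type} [Fintype n] [DecidableEq n] [CommRing A]
    {W : Matrix n n A} {u : n → A} (hu : W.mulVec u = 0) (i j : n) :
    W.adjugate i i * u j = W.adjugate j i * u i := by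
  have h1 : (W.updateRow i (Pi.single i 1)).mulVec u = Pi.single i (u i) := by
    funext k
    by_cases hk : k = i
    · subst hk
      simp [Matrix.mulVec, Pi.single_apply, dotProduct]
    · have := congrFun hu k
      simpa [Matrix.mulVec, Matrix.updateRow_ne hk, hk] using this
  have h2 := congrArg (fun y => (W.updateRow i (Pi.single i 1)).adjugate.mulVec y j) h1
  simp only [Matrix.mulVec_mulVec, Matrix.adjugate_mul] at h2
  rw [Matrix.smul_mulVec, Matrix.one_mulVec, Pi.smul_apply, Matrix.mulVec_single] at h2
  simp only [Pi.smul_apply, MulOpposite.smul_eq_mul_unop, MulOpposite.unop_op,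
    smul_eq_mul, Matrix.col_apply, Matrix.adjugate_apply, Matrix.updateRow_idem] at h2
  rw [Matrix.adjugate_apply, Matrix.adjugate_apply]
  exact h2

/-- The column sums give a left kernel vector of ones, so the adjugate entries `(j, i)` and `(j, j)`
agree; the right kernel vector compares `(i, i)` with `(j, i)`. -/
theorem Matrix.adjugate_diag_mul {n A : Type} [Fintype n] [DecidableEq n] [CommRing A]
    {W : Matrix n n A} {u : n → A} (hu : W.mulVec u = 0) (hW : ∀ j, ∑ i, W i j = 0) (i j : n) :
    W.adjugate i i * u j = W.adjugate j j * u i := by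
  have h1 : W.transpose.mulVec (fun _ => 1) = 0 := by
    funext j
    simpa [Matrix.mulVec, dotProduct] using hW j
  have h2 := Matrix.adjugate_self_mul h1 j i
  simp only [mul_one, ← Matrix.adjugate_transpose, Matrix.transpose_apply] at h2
  rw [Matrix.adjugate_self_mul hu i j, h2]

namespace SingularLinkDiagram

variable {P : SingularLinkDiagram}

open Classical in
theorem edgeDet_mul {A : Type} [CommRing A] (hc : P.IsConnected) (v : P.V) {p q : P.V → A}
    {u : P.E → A} (hu : ∀ x, ∑ e, transitionRow p q x e * u e = u (P.out x)) (Q Q' : P.E) :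
    edgeDet p q Q * u Q' = edgeDet p q Q' * u Q := by
  have h1 := Matrix.adjugate_diag_mul (W := (1 - transition p q : Matrix P.E P.E A)) (u := u) (by
    funext e
    obtain ⟨x, rfl⟩ := (outEquiv hc v).surjective e
    rw [Matrix.sub_mulVec, Matrix.one_mulVec, Pi.sub_apply, Pi.zero_apply, sub_eq_zero]
    exact (hu x ▸ transition_out p q x ▸ rfl)) (sum_one_sub_transition hc v p q) Q Q'
  rwa [Matrix.adjugate_apply, Matrix.adjugate_apply] at h1

-- In the order given by `l` the matrix is triangular with ones on the diagonal. For a descending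
-- knot, `l` is the position along the knot starting from `Q`.
open Classical in
theorem edgeDet_eq_one {A : Type} [CommRing A] (hc : P.IsConnected) (v : P.V) {p q : P.V → A}
    {Q : P.E} {l : P.E → ℕ} (hl : Function.Injective l)
    (h : ∀ x, P.out x ≠ Q → ∀ e, transitionRow p q x e ≠ 0 → l e < l (P.out x)) :
    edgeDet p q Q = 1 := by
  have hM : ∀ e, e ≠ Q → ∀ e', transition p q e e' ≠ 0 → l e' < l e := by
    intro e he e' h'
    obtain ⟨x, rfl⟩ := (outEquiv hc v).surjective e
    refine h x he e' ?_
    rw [← transition_out]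
    exact h'
  have hdet : ((1 - transition p q : Matrix P.E P.E A).updateRow Q (Pi.single Q 1)).det =
      ∏ e, (1 - transition p q : Matrix P.E P.E A).updateRow Q (Pi.single Q 1) e e := by
    let _ : LinearOrder P.E := LinearOrder.lift' l hl
    convert Matrix.det_of_isLowerTriangular ((1 - transition p q : Matrix P.E P.E A).updateRow Q
      (Pi.single Q 1)) ?_
    intro e e' hlt
    have hlt' : l e < l e' := hlt
    have hne : e ≠ e' := fun h => by rw [h] at hlt'; exact hlt'.false
    rw [Matrix.updateRow_apply]
    split_ifs with he
    · subst he
      simp [hne.symm]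
    · have : transition p q e e' = 0 := by
        by_contra hne
        exact (hlt'.trans (hM e he e' hne)).false
      simp [this, hne]
  rw [edgeDet, hdet]
  refine Finset.prod_eq_one fun e _ => ?_
  rw [Matrix.updateRow_apply]
  split_ifs with he
  · subst he
    simp
  · have : transition p q e e = 0 := by
      by_contra hne
      exact (hM e he e hne).false
    simp [this]

-- No transition weight enters `K` from outside, so the matrix is block triangular. The restriction
-- of `u` lies in the kernel of the block of `K`, which is untouched by the row replacement because
-- `Q` lies outside `K`.
open Classical in
theorem edgeDet_eq_zero {A : Type} [CommRing A] [IsDomain A] (hc : P.IsConnected) (v : P.V)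
    {p q : P.V → A} {Q : P.E} {K : P.E → Prop} (hQ : ¬ K Q) {e₀ : P.E} (h₀ : K e₀) {u : P.E → A}
    (hu₀ : u e₀ ≠ 0)
    (hu : ∀ x, K (P.out x) → ∑ e, transitionRow p q x e * u e = u (P.out x))
    (hK : ∀ x, K (P.out x) → ∀ e, ¬ K e → transitionRow p q x e = 0) :
    edgeDet p q Q = 0 := by
  have hM : ∀ e, K e → ∀ e', ¬ K e' → transition p q e e' = 0 := by
    intro e he e' h'
    obtain ⟨x, rfl⟩ := (outEquiv hc v).surjective e
    have := hK x he e' h'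
    rwa [← transition_out] at this
  have hMu : ∀ e, K e → ∑ e', transition p q e e' * u e' = u e := by
    intro e he
    obtain ⟨x, rfl⟩ := (outEquiv hc v).surjective e
    have := hu x he
    rwa [← transition_out] at this
  rw [edgeDet, Matrix.twoBlockTriangular_det' _ K]
  · have h1 : (Matrix.toSquareBlockProp ((1 - transition p q : Matrix P.E P.E A).updateRow Q
      (Pi.single Q 1)) K).det = 0 := by
      rw [← Matrix.exists_mulVec_eq_zero_iff]
      refine ⟨fun e => u e.1, fun h => hu₀ (congrFun h ⟨e₀, h₀⟩), ?_⟩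
      funext ⟨e, he⟩
      have hne : e ≠ Q := fun h => hQ (h ▸ he)
      change ∑ e' : {e // K e}, (1 - transition p q : Matrix P.E P.E A).updateRow Q
        (Pi.single Q 1) e e'.1 * u e'.1 = 0
      simp only [Matrix.updateRow_ne hne, Matrix.sub_apply, sub_mul, Finset.sum_sub_distrib]
      rw [sub_eq_zero, Finset.sum_eq_single (⟨e, he⟩ : {e // K e})]
      · rw [Matrix.one_apply_eq, one_mul]
        refine (hMu e he).symm.trans ?_
        rw [← Fintype.sum_subtype_add_sum_subtype K (fun e' => transition p q e e' * u e')]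
        refine add_eq_left.mpr ?_
        exact Finset.sum_eq_zero fun e' _ => by rw [hM e he e' e'.2, zero_mul]
      · intro e' _ hne'
        rw [Matrix.one_apply_ne (fun h => hne' (Subtype.ext h.symm)), zero_mul]
      · simp
    rw [h1, zero_mul]
  · intro e he e' he'
    have hne : e ≠ Q := fun h => hQ (h ▸ he)
    have hne' : e ≠ e' := fun h => he' (h ▸ he)
    rw [Matrix.updateRow_ne hne, Matrix.sub_apply, Matrix.one_apply_ne hne', hM e he e' he',
      sub_zero]

open Classical in
theorem edgeDet_nonneg (hc : P.IsConnected) (v : P.V) {p q : P.V → ℝ}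
    (hp : ∀ v, 0 ≤ p v ∧ p v ≤ 1) (hq : ∀ v, 0 ≤ q v ∧ q v ≤ 1) (Q : P.E) :
    0 ≤ edgeDet p q Q := by
  set M : Matrix P.E P.E ℝ := transition p q with hM
  have hpos : ∀ e e', 0 ≤ M e e' := by
    intro e e'
    obtain ⟨x, rfl⟩ := (outEquiv hc v).surjective e
    change 0 ≤ transition p q (P.out x) e'
    rw [transition_out]
    have hs : ∀ (a : P.E) (r : ℝ), 0 ≤ r → 0 ≤ (Pi.single a r : P.E → ℝ) e' := fun a r hr => by
      rw [Pi.single_apply]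
      split_ifs
      exacts [hr, le_rfl]
    rcases x with x | x
    · exact add_nonneg (hs _ _ (hp x).1) (hs _ _ (hq x).1)
    · exact add_nonneg (hs _ _ (sub_nonneg.mpr (hp x).2)) (hs _ _ (sub_nonneg.mpr (hq x).2))
  have hsum : ∀ e', ∑ e, M e e' = 1 := by
    intro e'
    have := sum_one_sub_transition hc v p q e'
    simp only [Matrix.sub_apply, Finset.sum_sub_distrib, Matrix.one_apply] at this
    simp only [Finset.sum_ite_eq', Finset.mem_univ, if_true] at this
    linarith
  -- A homotopy from a positive diagonal matrix to one whose determinant is the edge determinant.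
  -- For `s < 1` the columns are strictly diagonally dominant, so the determinant cannot change sign
  -- on the way.
  let B : ℝ → Matrix P.E P.E ℝ := fun s => 1 - s • M + Matrix.single Q Q 1
  have h1 : (B 1).det = edgeDet p q Q := by
    have : B 1 = (1 - M).updateRow Q ((1 - M) Q + Pi.single Q 1) := by
      ext e e'
      rw [Matrix.updateRow_apply]
      split_ifs with h
      · subst h
        simp [B, Matrix.single_apply, Pi.single_apply, eq_comm]
      · simp [B, Ne.symm h]
    rw [this, Matrix.det_updateRow_add, Matrix.updateRow_eq_self, hM, det_one_sub_transition hc v,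
      zero_add, edgeDet]
  have h0 : 0 ≤ (B 0).det := by
    have : B 0 = Matrix.diagonal fun e => if e = Q then 2 else 1 := by
      ext e e'
      by_cases h : e = e'
      · subst h
        by_cases h' : e = Q
        · subst h'; simp [B]; norm_num
        · simp [B, h', Ne.symm h']
      · by_cases h' : e = Q
        · subst h'; simp [B, h]
        · simp [B, h, Ne.symm h']
    rw [this, Matrix.det_diagonal]
    exact Finset.prod_nonneg fun e _ => by split_ifs <;> norm_num
  have hne : ∀ s, 0 ≤ s → s < 1 → (B s).det ≠ 0 := by
    intro s hs hs1
    apply det_ne_zero_of_sum_col_lt_diag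
    intro k
    have h2 : ∑ i ∈ Finset.univ.erase k, ‖B s i k‖ = s * (1 - M k k) := by
      rw [← hsum k, ← Finset.add_sum_erase _ _ (Finset.mem_univ k), add_sub_cancel_left,
        Finset.mul_sum]
      refine Finset.sum_congr rfl fun i hi => ?_
      have hik := Finset.ne_of_mem_erase hi
      have h3 : (Matrix.single Q Q (1 : ℝ)) i k = 0 := by
        rw [Matrix.single_apply, if_neg]
        rintro ⟨rfl, rfl⟩
        exact hik rfl
      have h4 : B s i k = -(s * M i k) := by
        simp [B, h3, hik]
      rw [h4, norm_neg, Real.norm_of_nonneg (mul_nonneg hs (hpos _ _))]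
    have h3 : 0 ≤ (Matrix.single Q Q (1 : ℝ)) k k := by
      rw [Matrix.single_apply]
      split_ifs <;> norm_num
    have h4 : B s k k = 1 - s * M k k + (Matrix.single Q Q (1 : ℝ)) k k := by
      simp [B]
    rw [h2]
    refine lt_of_lt_of_le ?_ (le_abs_self _)
    rw [h4]
    linarith
  by_contra hneg
  rw [not_le, ← h1] at hneg
  have hcont : Continuous fun s => (B s).det := by
    apply Continuous.matrix_det
    fun_prop
  obtain ⟨s, ⟨hs0, hs1⟩, hs⟩ : (0 : ℝ) ∈ (fun s => (B s).det) '' Set.Icc 0 1 :=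
    intermediate_value_Icc' zero_le_one hcont.continuousOn ⟨hneg.le, h0⟩
  rcases hs1.lt_or_eq with hlt | rfl
  · exact hne s hs0 hlt hs
  · exact hneg.ne hs

/-- The weighted count of states, for weights coming from a flow, is the edge determinant. -/
theorem selectionSum_flowWeight (hc : P.IsConnected) (v : P.V) (Q : P.E) {A : Type} [CommRing A]
    [IsDomain A] (p q : P.V → A) :
    selectionSum P.corner (P.awayFrom Q) (fun v => flowWeight (p v) (q v)) = edgeDet p q Q := by
  classical
  obtain ⟨ι, hι, hr⟩ := exists_enumeration hc Q
  obtain ⟨c, hcd⟩ := exists_sign_edgeDet hc v hι hr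
  obtain ⟨ε, hε⟩ := exists_sign_det hc hι hr
  rcases Int.units_eq_one_or (c * ε) with h | h
  · rw [hcd, hε, ← mul_assoc, ← Int.cast_mul, ← Units.val_mul, h]
    simp
  -- Here the universal sign would be `-1`. The values `2/3` and `1/3` make all four flow weights
  -- positive, so nonnegativity of the minor then rules out any selection, and both sides are zero.
  · have h1 := edgeDet_nonneg hc v (p := fun _ => 2 / 3) (q := fun _ => 1 / 3)
      (fun _ => by norm_num) (fun _ => by norm_num) Q
    rw [hcd, hε, ← mul_assoc, ← Int.cast_mul, ← Units.val_mul, h] at h1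
    have hno : ∀ x, ¬ IsSelection P.corner (P.awayFrom Q) x := by
      intro x hx
      have hw : ∀ c, 0 < flowWeight (2 / 3 : ℝ) (1 / 3) c := by
        intro c
        cases c <;> norm_num [flowWeight]
      have h2 : 0 < selectionSum P.corner (P.awayFrom Q)
          (fun _ : P.V => flowWeight (2 / 3 : ℝ) (1 / 3)) := by
        refine Finset.sum_pos' (fun y _ => ?_) ⟨x, Finset.mem_univ _, ?_⟩
        · split_ifs
          exacts [Finset.prod_nonneg fun v _ => (hw _).le, le_rfl]
        · rw [if_pos hx]
          exact Finset.prod_pos fun v _ => hw _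
      simp at h1
      linarith
    have h2 : selectionSum P.corner (P.awayFrom Q) (fun v => flowWeight (p v) (q v)) = 0 :=
      Finset.sum_eq_zero fun x _ => if_neg (hno x)
    rw [hcd, hε, h2, mul_zero, mul_zero]

end SingularLinkDiagram

/-! ### Selections on the smoothed and on the underlying projection -/

theorem card_le_of_surjOn {V R : Type} [Fintype V] [Fintype R] {f : V → R} {X Y : R}
    (hf : Set.SurjOn f Set.univ {r | r ≠ X ∧ r ≠ Y}) :
    Fintype.card R ≤ Fintype.card V + 2 ∧ (X = Y → Fintype.card R ≤ Fintype.card V + 1) := by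
  constructor
  · have h1 : Function.Surjective (Sum.elim f (fun b : Bool => if b then X else Y)) := by
      intro r
      by_cases hX : r = X
      · exact ⟨Sum.inr true, by simp [hX]⟩
      by_cases hY : r = Y
      · exact ⟨Sum.inr false, by simp [hY]⟩
      obtain ⟨v, -, hv⟩ := hf ⟨hX, hY⟩
      exact ⟨Sum.inl v, hv⟩
    simpa using Fintype.card_le_of_surjective _ h1
  · rintro rfl
    have h1 : Function.Surjective (Sum.elim f (fun _ : Unit => X)) := by
      intro r
      by_cases hX : r = X
      · exact ⟨Sum.inr (), by simp [hX]⟩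
      obtain ⟨v, -, hv⟩ := hf ⟨hX, hX⟩
      exact ⟨Sum.inl v, hv⟩
    simpa using Fintype.card_le_of_surjective _ h1

open Classical in
theorem IsSelection.sum_eq {V R M : Type} [Fintype V] [Fintype R] [AddCommMonoid M]
    {reg : V → Corner → R} {S : Set R} {x : V → Corner} (hx : IsSelection reg S x) (g : R → M) :
    ∑ v, g (reg v (x v)) = ∑ r ∈ Finset.univ.filter (· ∈ S), g r := by
  refine Finset.sum_nbij (fun v => reg v (x v)) ?_ ?_ ?_ fun _ _ => rfl
  · intro v _
    simpa using hx.mapsTo (Set.mem_univ v)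
  · intro a _ b _ hab
    exact hx.injOn (Set.mem_univ a) (Set.mem_univ b) hab
  · intro r hr
    obtain ⟨v, -, hv⟩ := hx.surjOn (by simpa using hr)
    exact ⟨v, by simp, hv⟩

namespace SingularLinkDiagram

variable {P : SingularLinkDiagram}

/-- The vertices at which the two strands have been smoothed. -/
abbrev Smoothed (P : SingularLinkDiagram) : Type := {v : P.V // P.kind v = VertexKind.smoothed}

/-- The map from the regions of the underlying projection to those of the smoothed one. -/
def toRegion (P : SingularLinkDiagram) (r : P.R) : P.Region := Quot.mk _ r

theorem toRegion_surjective : Function.Surjective P.toRegion := Quot.mk_surjective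

noncomputable instance : Fintype P.Region :=
  @Fintype.ofFinite _ (Finite.of_surjective _ (toRegion_surjective (P := P)))

theorem regionAt_eq (v : P.V) (c : Corner) : P.regionAt v c = P.toRegion (P.corner v c) := by
  cases c <;> rfl

theorem toRegion_smoothed {v : P.V} (hv : P.kind v = VertexKind.smoothed) :
    P.toRegion (P.corner v Corner.B) = P.toRegion (P.corner v Corner.D) :=
  Quot.sound ⟨v, hv, rfl, rfl⟩

theorem eq_of_toRegion_eq {α : Type*} {f : P.R → α}
    (hf : ∀ v, P.kind v = VertexKind.smoothed →
      f (P.corner v Corner.B) = f (P.corner v Corner.D)) {r s : P.R}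
    (h : P.toRegion r = P.toRegion s) : f r = f s := by
  have := congrArg (Quot.lift f (by
    rintro _ _ ⟨v, hv, rfl, rfl⟩
    exact hf v hv)) h
  exact this

theorem card_crossing_add :
    Nat.card P.Crossing + Nat.card P.Smoothed = Fintype.card P.V := by
  have h : Nat.card (P.Crossing ⊕ P.Smoothed) = Nat.card P.V :=
    Nat.card_congr ((Equiv.sumComm _ _).trans
      (Equiv.sumCompl fun v : P.V => P.kind v = VertexKind.smoothed))
  rw [Nat.card_sum] at h
  rw [h, Nat.card_eq_fintype_card]

/-- The smoothed vertices, regarded as edges between regions, form a forest. -/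
def IsForest (P : SingularLinkDiagram) : Prop :=
  ∀ y : P.V → ℝ, ∃ f : P.R → ℝ, ∀ v, P.kind v = VertexKind.smoothed →
    f (P.corner v Corner.B) - f (P.corner v Corner.D) = y v

theorem card_region_forest :
    Fintype.card P.R ≤ Fintype.card P.Region + Nat.card P.Smoothed ∧
    (P.IsForest ↔ Fintype.card P.R = Fintype.card P.Region + Nat.card P.Smoothed) := by
  classical
  let d : (P.R → ℝ) →ₗ[ℝ] (P.Smoothed → ℝ) :=
    { toFun := fun f v => f (P.corner v.1 Corner.B) - f (P.corner v.1 Corner.D)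
      map_add' := fun f f' => by funext e; simp only [Pi.add_apply]; ring
      map_smul' := fun c f => by funext e; simp [mul_sub] }
  let pb : (P.Region → ℝ) →ₗ[ℝ] (P.R → ℝ) := LinearMap.funLeft ℝ ℝ P.toRegion
  have hpb : Function.Injective pb := LinearMap.funLeft_injective_of_surjective _ _ _
    toRegion_surjective
  -- Functions with equal values at the top and bottom of all smoothed vertices are those that
  -- descend to the merged regions. Rank-nullity for `d` now gives the count, with equality exactly
  -- when `d` is surjective.
  have hker : LinearMap.range pb = LinearMap.ker d := by
    ext f
    rw [LinearMap.mem_ker]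
    constructor
    · rintro ⟨g, rfl⟩
      funext v
      change g (P.toRegion _) - g (P.toRegion _) = 0
      rw [toRegion_smoothed v.2, sub_self]
    · intro hf
      have hf' : ∀ v, P.kind v = VertexKind.smoothed →
          f (P.corner v Corner.B) = f (P.corner v Corner.D) := fun v hv =>
        sub_eq_zero.mp (congrFun hf ⟨v, hv⟩)
      refine ⟨fun r => f (Function.surjInv toRegion_surjective r), ?_⟩
      funext r
      exact eq_of_toRegion_eq hf' (Function.surjInv_eq toRegion_surjective (P.toRegion r))
  have h1 := LinearMap.finrank_range_add_finrank_ker d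
  rw [← hker, LinearMap.finrank_range_of_inj hpb, Module.finrank_pi, Module.finrank_pi] at h1
  have h2 : Module.finrank ℝ (LinearMap.range d) ≤ Nat.card P.Smoothed := by
    have := Submodule.finrank_le (LinearMap.range d)
    rwa [Module.finrank_pi, ← Nat.card_eq_fintype_card] at this
  refine ⟨by omega, ?_⟩
  have h3 : P.IsForest ↔ LinearMap.range d = ⊤ := by
    rw [LinearMap.range_eq_top]
    constructor
    · intro h y
      obtain ⟨f, hf⟩ := h fun v => if hv : P.kind v = VertexKind.smoothed then y ⟨v, hv⟩ else 0
      refine ⟨f, ?_⟩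
      funext ⟨v, hv⟩
      have := hf v hv
      rwa [dif_pos hv] at this
    · intro h y
      obtain ⟨f, hf⟩ := h fun v => y v.1
      exact ⟨f, fun v hv => congrFun hf ⟨v, hv⟩⟩
  rw [h3]
  constructor
  · intro h
    rw [h, finrank_top, Module.finrank_pi, ← Nat.card_eq_fintype_card (α := P.Smoothed)] at h1
    omega
  · intro h
    apply Submodule.eq_top_of_finrank_eq
    rw [Module.finrank_pi, ← Nat.card_eq_fintype_card (α := P.Smoothed)]
    omega

open Classical in
/-- Weights on all vertices, which at a smoothed vertex select the top or the bottom corner. -/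
noncomputable def extendWeight {A : Type} [CommRing A] (P : SingularLinkDiagram)
    (w : P.V → Corner → A) (v : P.V) (c : Corner) : A :=
  if P.kind v = VertexKind.smoothed then
    (if c = Corner.B ∨ c = Corner.D then 1 else 0) else w v c

/-- At smoothed vertices `x` selects the top or the bottom corner. -/
def IsCompatible (P : SingularLinkDiagram) (x : P.V → Corner) : Prop :=
  ∀ v, P.kind v = VertexKind.smoothed → x v = Corner.B ∨ x v = Corner.D

theorem isConnected_of_isSelection {Q : P.E} {x : P.V → Corner}
    (hx : IsSelection P.corner (P.awayFrom Q) x) : P.IsConnected :=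
  isConnected_of_card_le (card_le_of_surjOn hx.surjOn).1

theorem selectionSum_extendWeight_pos {Q : P.E} {x : P.V → Corner}
    (hx : IsSelection P.corner (P.awayFrom Q) x) (hxc : P.IsCompatible x) {w : P.V → Corner → ℝ}
    (hw : ∀ v c, 0 < w v c) : 0 < selectionSum P.corner (P.awayFrom Q) (P.extendWeight w) := by
  classical
  refine Finset.sum_pos' (fun y _ => ?_) ⟨x, Finset.mem_univ _, ?_⟩
  · split_ifs
    · refine Finset.prod_nonneg fun v _ => ?_
      rw [extendWeight]
      split_ifs
      exacts [zero_le_one, le_rfl, (hw _ _).le]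
    · exact le_rfl
  · rw [if_pos hx]
    refine Finset.prod_pos fun v _ => ?_
    rw [extendWeight]
    split_ifs with h1 h2
    exacts [one_pos, (h2 (hxc v h1)).elim, hw _ _]

open Classical in
theorem det_extendWeight_ne_zero {Q : P.E} {x : P.V → Corner}
    (hx : IsSelection P.corner (P.awayFrom Q) x) (hxc : P.IsCompatible x) {w : P.V → Corner → ℝ}
    (hw : ∀ v c, 0 < w v c) {ι : P.V → P.R}
    (hι : Function.Injective ι) (hr : Set.range ι = P.awayFrom Q) :
    (cornerMatrix P.corner ι (P.extendWeight w)).det ≠ 0 := by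
  obtain ⟨ε, hε⟩ := exists_sign_det (isConnected_of_isSelection hx) hι hr
  rw [hε]
  refine mul_ne_zero ?_ (selectionSum_extendWeight_pos hx hxc hw).ne'
  exact_mod_cast ε.ne_zero

/-- At a smoothed vertex the corner matrix is just bottom minus top. A compatible selection makes
the matrix invertible, so these differences can be prescribed arbitrarily. -/
theorem isForest_of_isSelection {Q : P.E} {x : P.V → Corner}
    (hx : IsSelection P.corner (P.awayFrom Q) x) (hxc : P.IsCompatible x) : P.IsForest := by
  classical
  intro y
  obtain ⟨ι, hι, hr⟩ := exists_enumeration (isConnected_of_isSelection hx) Q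
  have hdet := det_extendWeight_ne_zero hx hxc (w := fun _ _ => 1) (fun _ _ => one_pos) hι hr
  set W := cornerMatrix P.corner ι (P.extendWeight fun _ _ => (1 : ℝ)) with hW
  let g : P.V → ℝ := W⁻¹.mulVec (fun v => -y v)
  have hg : W.mulVec g = fun v => -y v := by
    rw [Matrix.mulVec_mulVec, Matrix.mul_nonsing_inv _ (isUnit_iff_ne_zero.mpr hdet),
      Matrix.one_mulVec]
  have hF : ∀ r ∉ Set.range ι, Function.extend ι g 0 r = 0 := fun r hr' => by
    rw [Function.extend_apply' _ _ _ (fun ⟨u, hu⟩ => hr' ⟨u, hu⟩)]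
    rfl
  have hcomp : Function.extend ι g 0 ∘ ι = g := by
    funext u
    exact hι.extend_apply _ _ _
  refine ⟨Function.extend ι g 0, fun v hv => ?_⟩
  have := cornerMatrix_mulVec (reg := P.corner) hι (P.extendWeight fun _ _ => (1 : ℝ)) hF v
  rw [hcomp, hg, Corner.sum_eq] at this
  simp [extendWeight, hv, cornerSign] at this
  linarith

/-- The corner at a smoothed vertex opposite to the top or bottom corner. -/
theorem exists_opposite {c : Corner} (hc : c = Corner.B ∨ c = Corner.D) {v : P.V}
    (hv : P.kind v = VertexKind.smoothed) {f : P.R → ℝ}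
    (hf : f (P.corner v Corner.B) - f (P.corner v Corner.D) = if c = Corner.B then 1 else -1) :
    ∃ r, P.toRegion r = P.toRegion (P.corner v c) ∧ f r = f (P.corner v c) - 1 := by
  rcases hc with rfl | rfl
  · exact ⟨_, (toRegion_smoothed hv).symm, by simp at hf; linarith⟩
  · exact ⟨_, toRegion_smoothed hv, by simp at hf; linarith⟩

/-- A compatible selection for the underlying projection restricts to one for the smoothed
projection. -/
theorem isSelection_restrict {Q : P.E} {x : P.V → Corner}
    (hx : IsSelection P.corner (P.awayFrom Q) x) (hxc : P.IsCompatible x) :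
    IsSelection (fun v : P.Crossing => P.regionAt v.1) (P.AllowedRegion Q) (fun v => x v.1) := by
  classical
  have hH := isForest_of_isSelection hx hxc
  have hcard := card_region_forest.2.mp hH
  rw [card_eq_of_isConnected (isConnected_of_isSelection hx), ← card_crossing_add] at hcard
  let φ : P.Crossing ⊕ Bool → P.Region := Sum.elim (fun v => P.regionAt v.1 (x v.1))
    (fun b => if b then P.toRegion (P.left Q) else P.toRegion (P.right Q))
  have hsurj : Function.Surjective φ := by
    intro ρ
    by_contra hno
    -- The height `f` is 1 larger at the selected corner of a smoothed vertex than at the opposite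
    -- one. A lowest region in the class `ρ` is thus not selected by a smoothed vertex, hence by a
    -- crossing unless it borders `Q`.
    obtain ⟨f, hf⟩ := hH fun v => if x v = Corner.B then 1 else -1
    obtain ⟨r₀, hr₀⟩ := toRegion_surjective ρ
    obtain ⟨r, hr, hmin⟩ := Finset.exists_min_image (Finset.univ.filter fun r => P.toRegion r = ρ) f
      ⟨r₀, by simpa using hr₀⟩
    simp only [Finset.mem_filter, Finset.mem_univ, true_and] at hr hmin
    have hX : r ≠ P.left Q := fun h => hno ⟨Sum.inr true, by simp [φ, ← hr, h]⟩
    have hY : r ≠ P.right Q := fun h => hno ⟨Sum.inr false, by simp [φ, ← hr, h]⟩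
    obtain ⟨v, -, hv⟩ := hx.surjOn ⟨hX, hY⟩
    by_cases hk : P.kind v = VertexKind.smoothed
    · obtain ⟨s, hs1, hs2⟩ := exists_opposite (hxc v hk) hk (hf v hk)
      simp only at hv
      rw [hv] at hs1 hs2
      have := hmin s (hs1.trans hr)
      linarith
    · exact hno ⟨Sum.inl ⟨v, hk⟩, by
        change P.regionAt v (x v) = ρ
        rw [regionAt_eq, ← hr, ← hv]⟩
  have hbij : Function.Bijective φ := by
    rw [Fintype.bijective_iff_surjective_and_card]
    refine ⟨hsurj, ?_⟩
    rw [Fintype.card_sum, Fintype.card_bool, ← Nat.card_eq_fintype_card]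
    omega
  refine ⟨fun v _ => ⟨fun h => ?_, fun h => ?_⟩, fun a _ b _ hab => ?_, fun ρ hρ => ?_⟩
  · have := hbij.1 (a₁ := Sum.inl v) (a₂ := Sum.inr true) h
    simp at this
  · have := hbij.1 (a₁ := Sum.inl v) (a₂ := Sum.inr false) h
    simp at this
  · exact Sum.inl_injective (hbij.1 (a₁ := Sum.inl a) (a₂ := Sum.inl b) hab)
  · obtain ⟨v | b, hv⟩ := hsurj ρ
    · exact ⟨v, trivial, hv⟩
    · cases b
      · exact (hρ.2 hv.symm).elim
      · exact (hρ.1 hv.symm).elim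

theorem eq_of_restrict_eq {Q : P.E} {x x' : P.V → Corner}
    (hx : IsSelection P.corner (P.awayFrom Q) x) (hxc : P.IsCompatible x)
    (hx' : IsSelection P.corner (P.awayFrom Q) x') (hxc' : P.IsCompatible x')
    (h : ∀ v, P.kind v ≠ VertexKind.smoothed → x v = x' v) : x = x' := by
  classical
  obtain ⟨f, hf⟩ := isForest_of_isSelection hx hxc fun v => if x v = Corner.B then 1 else -1
  -- Both selections cover the same regions, hence have equal total height. Each smoothed vertex
  -- where they differ would contribute 1 to the difference, with no cancellation.
  have h1 : ∑ v, (f (P.corner v (x v)) - f (P.corner v (x' v))) = 0 := by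
    rw [Finset.sum_sub_distrib, hx.sum_eq, hx'.sum_eq, sub_self]
  have h2 : ∀ v, f (P.corner v (x v)) - f (P.corner v (x' v)) = if x v = x' v then 0 else 1 := by
    intro v
    split_ifs with hv
    · rw [hv, sub_self]
    · have hk : P.kind v = VertexKind.smoothed := by
        by_contra hk
        exact hv (h v hk)
      have := hf v hk
      rcases hxc v hk with a | a <;> rcases hxc' v hk with b | b <;> rw [a, b] at hv ⊢ <;>
        simp [a] at this hv ⊢ <;> linarith
  simp only [h2] at h1
  have h3 := (Finset.sum_eq_zero_iff_of_nonneg (fun v _ => by split_ifs <;> norm_num)).mp h1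
  funext v
  by_contra hv
  have := h3 v (Finset.mem_univ v)
  rw [if_neg hv] at this
  exact one_ne_zero this

/-- A selection for the smoothed projection extends to the underlying projection. -/
theorem exists_extension {Q : P.E} {y : P.Crossing → Corner}
    (hy : IsSelection (fun v : P.Crossing => P.regionAt v.1) (P.AllowedRegion Q) y) :
    ∃ x : P.V → Corner, IsSelection P.corner (P.awayFrom Q) x ∧ P.IsCompatible x ∧
      ∀ v : P.Crossing, x v.1 = y v := by
  classical
  -- The selection bounds the merged regions by crossings plus two, and each smoothing merges at
  -- most one more pair. With Euler's formula all these bounds are equalities and the projection is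
  -- connected.
  have hcard1 := card_le_of_surjOn hy.surjOn
  rw [← Nat.card_eq_fintype_card (α := P.Crossing)] at hcard1
  have hcr := card_crossing_add (P := P)
  have hreg := card_region_forest (P := P)
  have hc : P.IsConnected := isConnected_of_card_le (by omega)
  have hR := card_eq_of_isConnected hc
  let φ : P.Crossing ⊕ Bool → P.Region := Sum.elim (fun v => P.regionAt v.1 (y v))
    (fun b => if b then P.toRegion (P.left Q) else P.toRegion (P.right Q))
  let τ : P.Crossing ⊕ Bool → P.R := Sum.elim (fun v => P.corner v.1 (y v))
    (fun b => if b then P.left Q else P.right Q)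
  have hφτ : ∀ t, φ t = P.toRegion (τ t) := by
    rintro (v | b)
    · exact regionAt_eq _ _
    · cases b <;> rfl
  have hsurj : Function.Surjective φ := by
    intro ρ
    by_cases hX : ρ = P.toRegion (P.left Q)
    · exact ⟨Sum.inr true, by simp [φ, hX]⟩
    by_cases hY : ρ = P.toRegion (P.right Q)
    · exact ⟨Sum.inr false, by simp [φ, hY]⟩
    obtain ⟨v, -, hv⟩ := hy.surjOn ⟨hX, hY⟩
    exact ⟨Sum.inl v, hv⟩
  have hbij : Function.Bijective φ := by
    rw [Fintype.bijective_iff_surjective_and_card]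
    refine ⟨hsurj, ?_⟩
    rw [Fintype.card_sum, Fintype.card_bool, ← Nat.card_eq_fintype_card]
    omega
  have hτ : Function.Injective τ := fun a b hab => hbij.1 (by rw [hφτ, hφτ, hab])
  have hcardS : Fintype.card P.Smoothed = Fintype.card {r // r ∉ Set.range τ} := by
    have h1 := Fintype.card_subtype_compl (fun r => r ∈ Set.range τ)
    have h2 : Fintype.card {r // r ∈ Set.range τ} = Fintype.card (P.Crossing ⊕ Bool) :=
      Set.card_range_of_injective hτ
    rw [h2, Fintype.card_sum, Fintype.card_bool, ← Nat.card_eq_fintype_card (α := P.Crossing)] at h1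
    rw [h1, ← Nat.card_eq_fintype_card]
    omega
  let e := Fintype.equivOfCardEq hcardS
  -- Smoothed vertices have to be matched with the regions not yet used. A nonzero term of this
  -- incidence determinant is such a matching.
  let I : Matrix P.Smoothed P.Smoothed ℝ := Matrix.of fun s s' =>
    (if P.corner s.1 Corner.B = (e s').1 then 1 else 0) -
      (if P.corner s.1 Corner.D = (e s').1 then 1 else 0)
  have hdet : I.det ≠ 0 := by
    intro h0
    obtain ⟨f, hf, hf0⟩ := Matrix.exists_mulVec_eq_zero_iff.mpr h0
    let F : P.R → ℝ := fun r => if hr : r ∉ Set.range τ then f (e.symm ⟨r, hr⟩) else 0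
    have hsum : ∀ r, ∑ s', (if r = (e s').1 then 1 else 0) * f s' = F r := by
      intro r
      by_cases hr : r ∉ Set.range τ
      · rw [Finset.sum_eq_single (e.symm ⟨r, hr⟩)]
        · rw [Equiv.apply_symm_apply, if_pos rfl, one_mul]
          simp only [F]
          rw [dif_pos hr]
        · intro s' _ hs'
          rw [if_neg, zero_mul]
          intro h
          apply hs'
          rw [Equiv.eq_symm_apply]
          exact Subtype.ext h.symm
        · simp
      · rw [show F r = 0 from dif_neg hr]
        refine Finset.sum_eq_zero fun s' _ => ?_
        rw [if_neg, zero_mul]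
        rintro rfl
        exact hr (e s').2
    -- A kernel vector, extended by zero to the used regions, is constant on merged regions. Each of
    -- these contains a used region, so the vector vanishes.
    have hF : ∀ v, P.kind v = VertexKind.smoothed →
        F (P.corner v Corner.B) = F (P.corner v Corner.D) := by
      intro v hv
      have := congrFun hf0 ⟨v, hv⟩
      simp only [Matrix.mulVec, dotProduct, I, Matrix.of_apply, sub_mul, Finset.sum_sub_distrib,
        hsum, Pi.zero_apply] at this
      linarith
    apply hf
    funext s
    obtain ⟨t, ht⟩ := hsurj (P.toRegion (e s).1)
    rw [hφτ] at ht
    have h1 := eq_of_toRegion_eq hF ht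
    have h2 : F (τ t) = 0 := dif_neg (by simp)
    have h3 : F (e s).1 = f s := by
      simp only [F]
      rw [dif_pos (e s).2]
      simp
    rw [← h3, ← h1, h2]
    rfl
  rw [Matrix.det_apply] at hdet
  obtain ⟨σ, -, hσ⟩ := Finset.exists_ne_zero_of_sum_ne_zero hdet
  have hσ' : ∀ s, I (σ s) s ≠ 0 := fun s hs => hσ (by
    rw [Finset.prod_eq_zero (f := fun i => I (σ i) i) (Finset.mem_univ s) hs, smul_zero])
  let z : ∀ v, P.kind v = VertexKind.smoothed → P.R := fun v hv => (e (σ.symm ⟨v, hv⟩)).1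
  have hz : ∀ v hv, P.corner v Corner.B = z v hv ∨ P.corner v Corner.D = z v hv := by
    intro v hv
    by_contra hne
    push Not at hne
    apply hσ' (σ.symm ⟨v, hv⟩)
    simp only [Equiv.apply_symm_apply, I, Matrix.of_apply]
    rw [if_neg hne.1, if_neg hne.2, sub_zero]
  let x : P.V → Corner := fun v => if hv : P.kind v = VertexKind.smoothed then
    (if P.corner v Corner.B = z v hv then Corner.B else Corner.D) else y ⟨v, hv⟩
  have hxs : ∀ v hv, P.corner v (x v) = z v hv := by
    intro v hv
    simp only [x, dif_pos hv]
    split_ifs with h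
    exacts [h, (hz v hv).resolve_left h]
  have hxc : ∀ v : P.Crossing, x v.1 = y v := fun v => dif_neg v.2
  have hcross : ∀ v (hv : P.kind v ≠ VertexKind.smoothed),
      P.corner v (x v) = τ (Sum.inl ⟨v, hv⟩) := fun v hv => by
    rw [hxc ⟨v, hv⟩]
    rfl
  refine ⟨x, ⟨?_, ?_, ?_⟩, ?_, hxc⟩
  · intro v _
    simp only
    by_cases hv : P.kind v = VertexKind.smoothed
    · rw [hxs v hv]
      have h1 : z v hv ∉ Set.range τ := (e (σ.symm ⟨v, hv⟩)).2
      exact ⟨fun h => h1 ⟨Sum.inr true, h.symm⟩, fun h => h1 ⟨Sum.inr false, h.symm⟩⟩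
    · rw [hcross v hv]
      constructor
      · intro h
        have := hτ (a₁ := Sum.inl ⟨v, hv⟩) (a₂ := Sum.inr true) h
        simp at this
      · intro h
        have := hτ (a₁ := Sum.inl ⟨v, hv⟩) (a₂ := Sum.inr false) h
        simp at this
  · intro a _ b _ hab
    simp only at hab
    by_cases ha : P.kind a = VertexKind.smoothed <;> by_cases hb : P.kind b = VertexKind.smoothed
    · rw [hxs a ha, hxs b hb] at hab
      have := σ.symm.injective (e.injective (Subtype.ext hab))
      exact congrArg Subtype.val this
    · rw [hxs a ha, hcross b hb] at hab
      exact ((e (σ.symm ⟨a, ha⟩)).2 ⟨_, hab.symm⟩).elim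
    · rw [hxs b hb, hcross a ha] at hab
      exact ((e (σ.symm ⟨b, hb⟩)).2 ⟨_, hab⟩).elim
    · rw [hcross a ha, hcross b hb] at hab
      exact congrArg Subtype.val (Sum.inl_injective (hτ hab))
  · intro r hr
    by_cases hrτ : r ∈ Set.range τ
    · obtain ⟨v | b, rfl⟩ := hrτ
      · exact ⟨v.1, trivial, hcross v.1 v.2⟩
      · cases b
        · exact (hr.2 rfl).elim
        · exact (hr.1 rfl).elim
    · refine ⟨(σ (e.symm ⟨r, hrτ⟩)).1, trivial, ?_⟩
      simp only
      rw [hxs _ (σ (e.symm ⟨r, hrτ⟩)).2]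
      simp [z]
  · intro v hv
    simp only [x, dif_pos hv]
    split_ifs
    exacts [Or.inl rfl, Or.inr rfl]

/-- The weighted count of the selections for the smoothed projection, as a weighted count for the
underlying projection. -/
theorem selectionSum_crossing {A : Type} [CommRing A] (Q : P.E) (w : P.V → Corner → A) :
    selectionSum (fun v : P.Crossing => P.regionAt v.1) (P.AllowedRegion Q) (fun v => w v.1) =
      selectionSum P.corner (P.awayFrom Q) (P.extendWeight w) := by
  classical
  unfold selectionSum
  rw [← Finset.sum_filter, ← Finset.sum_filter]
  symm
  -- Incompatible choices have a zero factor at a smoothed vertex; the compatible ones correspond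
  -- bijectively to states of the smoothed projection.
  rw [← Finset.sum_filter_of_ne (p := P.IsCompatible)]
  · refine Finset.sum_nbij (fun x v => x v.1) ?_ ?_ ?_ ?_
    · intro x hx
      simp only [Finset.mem_filter, Finset.mem_univ, true_and] at hx ⊢
      exact isSelection_restrict hx.1 hx.2
    · intro x hx x' hx' h
      simp only [Finset.coe_filter, Finset.mem_filter, Finset.mem_univ, true_and] at hx hx'
      exact eq_of_restrict_eq hx.1 hx.2 hx'.1 hx'.2 fun v hv => congrFun h ⟨v, hv⟩
    · intro y hy
      simp only [Finset.coe_filter, Finset.mem_univ, true_and] at hy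
      obtain ⟨x, hx1, hx2, hx3⟩ := exists_extension hy
      refine ⟨x, ?_, funext hx3⟩
      simp only [Finset.coe_filter, Finset.mem_filter, Finset.mem_univ, true_and]
      exact ⟨hx1, hx2⟩
    · intro x hx
      simp only [Finset.mem_filter, Finset.mem_univ, true_and] at hx
      rw [← Fintype.prod_subtype_mul_prod_subtype (fun v => P.kind v ≠ VertexKind.smoothed)]
      have h1 : ∏ v : {v // ¬ P.kind v ≠ VertexKind.smoothed}, P.extendWeight w v.1 (x v.1) = 1 := by
        refine Finset.prod_eq_one fun v _ => ?_
        rw [extendWeight, if_pos (not_not.mp v.2), if_pos (hx.2 v.1 (not_not.mp v.2))]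
      rw [h1, mul_one]
      exact Finset.prod_congr rfl fun v _ => by rw [extendWeight, if_neg v.2]
  · intro x _ hne v hv
    by_contra hno
    apply hne
    refine Finset.prod_eq_zero (Finset.mem_univ v) ?_
    rw [extendWeight, if_pos hv, if_neg hno]

end SingularLinkDiagram

/-! ### Linearity and rescaling of state sums -/

/-- Each product has exactly one factor from `v`, so the sum is linear in the weights there. This
turns a relation between local weights into a skein relation. -/
theorem selectionSum_add_mul {V R A : Type} [Fintype V] [CommRing A] {reg : V → Corner → R}
    {S : Set R} {w w₁ w₂ : V → Corner → A} {v : V} {m : A}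
    (h₁ : ∀ u, u ≠ v → w u = w₁ u) (h₂ : ∀ u, u ≠ v → w u = w₂ u)
    (hv : ∀ c, w v c = w₁ v c + m * w₂ v c) :
    selectionSum reg S w = selectionSum reg S w₁ + m * selectionSum reg S w₂ := by
  classical
  unfold selectionSum
  rw [Finset.mul_sum, ← Finset.sum_add_distrib]
  refine Finset.sum_congr rfl fun x _ => ?_
  split_ifs
  · have e₁ : ∏ u ∈ Finset.univ.erase v, w₁ u (x u) = ∏ u ∈ Finset.univ.erase v, w u (x u) :=
      Finset.prod_congr rfl fun u hu => by rw [h₁ u (Finset.ne_of_mem_erase hu)]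
    have e₂ : ∏ u ∈ Finset.univ.erase v, w₂ u (x u) = ∏ u ∈ Finset.univ.erase v, w u (x u) :=
      Finset.prod_congr rfl fun u hu => by rw [h₂ u (Finset.ne_of_mem_erase hu)]
    rw [← Finset.mul_prod_erase _ _ (Finset.mem_univ v),
      ← Finset.mul_prod_erase _ (fun u => w₁ u (x u)) (Finset.mem_univ v),
      ← Finset.mul_prod_erase _ (fun u => w₂ u (x u)) (Finset.mem_univ v), hv, e₁, e₂]
    ring
  · ring

theorem prod_T {ι : Type} (s : Finset ι) (f : ι → ℤ) :
    ∏ i ∈ s, (LaurentPolynomial.T (f i) : ℤ[T;T⁻¹]) = LaurentPolynomial.T (∑ i ∈ s, f i) := by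
  classical
  induction s using Finset.induction_on with
  | empty => simp
  | insert a s ha ih =>
    rw [Finset.prod_insert ha, Finset.sum_insert ha, ih, LaurentPolynomial.T_add]

open Classical in
/-- Rescaling the weights by monomials which depend on the vertex and on the region. -/
theorem selectionSum_rescale {V R : Type} [Fintype V] [Fintype R] {reg : V → Corner → R}
    {S : Set R} {w w' : V → Corner → HalfLaurent} {l : V → ℤ} {g : R → ℤ}
    (h : ∀ v c, w v c = LaurentPolynomial.T (l v + g (reg v c)) * w' v c) :
    selectionSum reg S w = LaurentPolynomial.T (∑ v, l v + ∑ r ∈ Finset.univ.filter (· ∈ S), g r) *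
      selectionSum reg S w' := by
  unfold selectionSum
  rw [Finset.mul_sum]
  refine Finset.sum_congr rfl fun x _ => ?_
  split_ifs with hx
  · simp only [h]
    rw [Finset.prod_mul_distrib, prod_T, Finset.sum_add_distrib, hx.sum_eq]
  · ring

theorem selectionSum_eq_zero {V R A : Type} [Fintype V] [CommRing A] {reg : V → Corner → R}
    {S : Set R} (h : ∀ x, ¬ IsSelection reg S x) (w : V → Corner → A) :
    selectionSum reg S w = 0 := by
  classical
  exact Finset.sum_eq_zero fun x _ => if_neg (h x)

open Classical in
/-- The local contributions, extended to smoothed vertices. -/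
noncomputable def kindWeight (k : VertexKind) (c : Corner) : HalfLaurent :=
  if k = VertexKind.smoothed then (if c = Corner.B ∨ c = Corner.D then 1 else 0)
  else SingularLinkDiagram.localContribution k c

namespace SingularLinkDiagram

variable {P : SingularLinkDiagram}

/-- The diagram with the same projection and other vertex types. -/
abbrev withKind (P : SingularLinkDiagram) (κ : P.V → VertexKind) : SingularLinkDiagram :=
  { P with kind := κ }

/-- The state sum of the diagram with vertex types `κ`, as a sum over corners of all vertices. -/
noncomputable def kindSum (P : SingularLinkDiagram) (κ : P.V → VertexKind) (Q : P.E) :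
    HalfLaurent :=
  selectionSum P.corner (P.awayFrom Q) (fun v => kindWeight (κ v))

theorem stateSum_eq_selectionSum (Q : P.E) :
    P.stateSum Q = selectionSum (fun v : P.Crossing => P.regionAt v.1) (P.AllowedRegion Q)
      (fun v => localContribution (P.kind v.1)) := by
  classical
  unfold stateSum selectionSum
  rw [← Finset.sum_filter]
  symm
  exact Finset.sum_subtype _ (p := P.IsKauffmanState Q) (fun x => by
    rw [Finset.mem_filter]
    exact ⟨fun h => h.2, fun h => ⟨@Finset.mem_univ _ (_) x, h⟩⟩) _

theorem extendWeight_localContribution :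
    P.extendWeight (fun v => localContribution (P.kind v)) = fun v => kindWeight (P.kind v) := by
  funext v c
  simp only [extendWeight, kindWeight]

theorem stateSum_eq_kindSum (Q : P.E) : P.stateSum Q = P.kindSum P.kind Q := by
  rw [stateSum_eq_selectionSum, kindSum, ← extendWeight_localContribution,
    ← selectionSum_crossing Q fun v => localContribution (P.kind v)]

theorem stateSum_withKind (κ : P.V → VertexKind) (Q : P.E) :
    (P.withKind κ).stateSum Q = P.kindSum κ Q :=
  stateSum_eq_kindSum (P := P.withKind κ) Q

theorem kindSum_of_not_isConnected (hc : ¬ P.IsConnected) (κ : P.V → VertexKind) (Q : P.E) :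
    P.kindSum κ Q = 0 :=
  selectionSum_eq_zero (fun _ hx => hc (isConnected_of_isSelection hx)) _

theorem kindSum_of_isEmpty (hc : P.IsConnected) [IsEmpty P.V] (κ : P.V → VertexKind) (Q : P.E) :
    P.kindSum κ Q = 1 := by
  classical
  obtain ⟨ι, hι, hr⟩ := exists_enumeration hc Q
  have hx : ∀ x, IsSelection P.corner (P.awayFrom Q) x := by
    intro x
    rw [← hr, Set.range_eq_empty]
    exact ⟨fun v => isEmptyElim v, fun v => isEmptyElim v, fun r hr => hr.elim⟩
  simp [kindSum, selectionSum, hx]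

/-! ### Alexander's determinant -/

/-- The weights with the signs of `cornerSign` removed from Alexander's relation. -/
noncomputable def alexanderWeight (k : VertexKind) (c : Corner) : HalfLaurent :=
  (cornerSign c : HalfLaurent) * alexanderCoeff k c

theorem cornerSign_mul_alexanderWeight (k : VertexKind) (c : Corner) :
    (cornerSign c : HalfLaurent) * alexanderWeight k c = alexanderCoeff k c := by
  rw [alexanderWeight, ← mul_assoc]
  cases c <;> simp [cornerSign]

-- A kernel vector pulls back to the unmerged regions. There the relation at a smoothed vertex holds
-- because top and bottom values agree, and the invertible extended corner matrix forces it to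
-- vanish.
open Classical in
theorem det_cornerMatrix_crossing_ne_zero {Q : P.E} {y : P.Crossing → Corner}
    (hy : IsSelection (fun v : P.Crossing => P.regionAt v.1) (P.AllowedRegion Q) y)
    {ι : P.Crossing → P.Region} (hι : Function.Injective ι) (hr : Set.range ι = P.AllowedRegion Q)
    {w : P.Crossing → Corner → ℝ} (hw : ∀ v c, 0 < w v c) :
    (cornerMatrix (fun v : P.Crossing => P.regionAt v.1) ι w).det ≠ 0 := by
  intro h0
  obtain ⟨x, hx, hxc, -⟩ := exists_extension hy
  obtain ⟨ι', hι', hr'⟩ := exists_enumeration (isConnected_of_isSelection hx) Q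
  obtain ⟨g, hg, hg0⟩ := Matrix.exists_mulVec_eq_zero_iff.mpr h0
  let F : P.Region → ℝ := Function.extend ι g 0
  have hF0 : ∀ r ∉ Set.range ι, F r = 0 := fun r hr' =>
    Function.extend_apply' _ _ _ fun ⟨u, hu⟩ => hr' ⟨u, hu⟩
  have hFι : F ∘ ι = g := funext fun u => hι.extend_apply _ _ _
  let w' : P.V → Corner → ℝ := fun v c =>
    if hv : P.kind v ≠ VertexKind.smoothed then w ⟨v, hv⟩ c else 1
  have hw' : ∀ v c, 0 < w' v c := fun v c => by
    simp only [w']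
    split_ifs
    exacts [hw _ _, one_pos]
  have hFa : ∀ r ∉ Set.range ι', (F ∘ P.toRegion) r = 0 := by
    intro r hr1
    rw [hr'] at hr1
    refine hF0 _ ?_
    rw [hr]
    intro h2
    exact hr1 ⟨fun h => h2.1 (h ▸ rfl), fun h => h2.2 (h ▸ rfl)⟩
  have hker : (cornerMatrix P.corner ι' (P.extendWeight w')).mulVec ((F ∘ P.toRegion) ∘ ι') = 0 := by
    funext v
    rw [cornerMatrix_mulVec hι' _ hFa, Pi.zero_apply]
    by_cases hv : P.kind v = VertexKind.smoothed
    · have := congrArg F (toRegion_smoothed hv)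
      simp [Corner.sum_eq, extendWeight, hv, cornerSign, this]
    · have h1 := congrFun hg0 ⟨v, hv⟩
      rw [← hFι, cornerMatrix_mulVec hι _ hF0, Pi.zero_apply] at h1
      rw [← h1]
      refine Finset.sum_congr rfl fun c _ => ?_
      simp only [extendWeight, if_neg hv, w', dif_pos hv, regionAt_eq, Function.comp_apply]
  have h2 := Matrix.eq_zero_of_mulVec_eq_zero (det_extendWeight_ne_zero hx hxc hw' hι' hr') hker
  apply hg
  rw [← hFι]
  funext u
  obtain ⟨r, hr2⟩ := toRegion_surjective (ι u)
  change F (ι u) = 0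
  rw [← hr2]
  by_cases h3 : r ∈ Set.range ι'
  · obtain ⟨s, rfl⟩ := h3
    exact congrFun h2 s
  · exact hFa r h3

theorem nonsingular_kind_cases {k : VertexKind} (h : k ≠ VertexKind.singular) :
    k = VertexKind.positive ∨ k = VertexKind.negative ∨ k = VertexKind.smoothed := by
  cases k <;> simp_all

/-- The drop of the index from the left corner to the given one. -/
def indexDrop : Corner → ℤ
  | Corner.A => 0
  | Corner.B => 1
  | Corner.C => 2
  | Corner.D => 1

/-- The indices of the corners in terms of the index of the left one. -/
theorem index_corner {ind : P.R → ℤ} (hi : ∀ e, ind (P.left e) = ind (P.right e) + 1) (v : P.V)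
    (c : Corner) : ind (P.corner v c) = ind (P.corner v Corner.A) - indexDrop c := by
  have h1 := hi (P.outL v)
  have h2 := hi (P.outR v)
  have h3 := hi (P.inL v)
  rw [left_outL, right_outL] at h1
  rw [left_outR, right_outR] at h2
  rw [left_inL, right_inL] at h3
  cases c <;> simp only [indexDrop] <;> omega

theorem alexanderWeight_eq {k : VertexKind} (hk : k = VertexKind.positive ∨ k = VertexKind.negative)
    (c : Corner) :
    alexanderWeight k c = LaurentPolynomial.T (indexDrop c) * localContribution k c := by
  have h₁ : (LaurentPolynomial.T 1 * LaurentPolynomial.T 1 : HalfLaurent) =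
    LaurentPolynomial.T 2 := by rw [← LaurentPolynomial.T_add]; norm_num
  have h₂ : (LaurentPolynomial.T 1 * LaurentPolynomial.T (-1) : HalfLaurent) = 1 := by
    rw [← LaurentPolynomial.T_add]; norm_num
  rcases hk with rfl | rfl <;> cases c <;>
    simp [alexanderWeight, alexanderCoeff, localContribution, cornerSign, halfPow, indexDrop,
      h₁, h₂]

theorem exists_selectionSum_alexander (hP : P.Nonsingular) (hc : P.IsConnected) (Q : P.E) :
    ∃ k : ℤ, selectionSum P.corner (P.awayFrom Q)
        (P.extendWeight fun v => alexanderWeight (P.kind v)) =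
      LaurentPolynomial.T k * P.stateSum Q := by
  classical
  obtain ⟨ind, hi⟩ := exists_index hc
  rw [stateSum_eq_kindSum, kindSum]
  -- Alexander's weights differ from the local contributions by the index drop. At a smoothed vertex
  -- the weights do not change, and the shift by 1 cancels the drop at its top and bottom corners.
  refine ⟨_, selectionSum_rescale (l := fun v => ind (P.corner v Corner.A) -
    (if P.kind v = VertexKind.smoothed then 1 else 0)) (g := fun r => -ind r) fun v c => ?_⟩
  rw [index_corner hi v c]
  rcases nonsingular_kind_cases (hP v) with h | h | h
  · simp only [extendWeight, kindWeight, h, reduceCtorEq, if_false]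
    rw [alexanderWeight_eq (Or.inl rfl)]
    congr 2
    ring
  · simp only [extendWeight, kindWeight, h, reduceCtorEq, if_false]
    rw [alexanderWeight_eq (Or.inr rfl)]
    congr 2
    ring
  · simp only [extendWeight, kindWeight, h, if_true]
    cases c <;> simp [indexDrop]

theorem submatrix_alexanderMatrix (ι : P.Crossing → P.Region) :
    P.alexanderMatrix.submatrix id ι = cornerMatrix (fun v : P.Crossing => P.regionAt v.1) ι
      fun v => alexanderWeight (P.kind v.1) := by
  ext v u
  simp only [cornerMatrix, Matrix.of_apply, cornerSign_mul_alexanderWeight]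
  rfl

theorem alexanderDet_eq (hP : P.Nonsingular) (Q : P.E) :
    ∃ (ε : ℤˣ) (k : ℤ),
      P.alexanderDet Q = ((ε : ℤ) : HalfLaurent) * LaurentPolynomial.T k * P.stateSum Q := by
  classical
  -- Without a state both sides are zero, whether or not the Alexander matrix is square.
  by_cases hy : ∃ y, IsSelection (fun v : P.Crossing => P.regionAt v.1) (P.AllowedRegion Q) y
  · obtain ⟨y, hy⟩ := hy
    have hne : Nonempty (P.Crossing ≃ P.AllowedRegion Q) :=
      ⟨(Equiv.Set.univ _).symm.trans (Set.BijOn.equiv _ hy)⟩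
    obtain ⟨x, hx, -, -⟩ := exists_extension hy
    obtain ⟨k, hk⟩ := exists_selectionSum_alexander hP (isConnected_of_isSelection hx) Q
    set ι : P.Crossing → P.Region := fun v => (hne.some v).1 with hιdef
    have hι : Function.Injective ι := Subtype.val_injective.comp hne.some.injective
    have hr : Set.range ι = P.AllowedRegion Q := by
      rw [hιdef, ← Function.comp_def Subtype.val, hne.some.surjective.range_comp, Subtype.range_val]
    obtain ⟨ε, hε⟩ := exists_sign_det_cornerMatrix
      (reg := fun v : P.Crossing => P.regionAt v.1) hι
      (fun w hw => by convert det_cornerMatrix_crossing_ne_zero hy hι hr hw)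
    refine ⟨ε, k, ?_⟩
    rw [mul_assoc, ← hk, ← selectionSum_crossing, ← hr, ← hε, alexanderDet, dif_pos hne,
      submatrix_alexanderMatrix]
    congr!
  · refine ⟨1, 0, ?_⟩
    rw [stateSum_eq_selectionSum, selectionSum_eq_zero (fun x hx => hy ⟨x, hx⟩), mul_zero,
      alexanderDet]
    split_ifs with hne
    · set ι : P.Crossing → P.Region := fun v => (hne.some v).1 with hιdef
      have hι : Function.Injective ι := Subtype.val_injective.comp hne.some.injective
      have hr : Set.range ι = P.AllowedRegion Q := by
        rw [hιdef, ← Function.comp_def Subtype.val, hne.some.surjective.range_comp,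
          Subtype.range_val]
      have h1 := det_cornerMatrix (fun v : P.Crossing => P.regionAt v.1) ι
        fun v => alexanderWeight (P.kind v.1)
      rw [submatrix_alexanderMatrix]
      refine Eq.trans (by congr!) (h1.trans ?_)
      refine Finset.sum_eq_zero fun x _ => ?_
      rw [choiceDet_eq_zero hι fun h => hy ⟨x, hr ▸ h⟩]
      simp
    · rfl

end SingularLinkDiagram

/-! ### Skein relations and independence of the initial point -/

namespace SingularLinkDiagram

variable {P : SingularLinkDiagram}

open Classical in
theorem kindSum_positive (κ : P.V → VertexKind) (v : P.V) (Q : P.E) :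
    P.kindSum (Function.update κ v VertexKind.positive) Q =
      P.kindSum (Function.update κ v VertexKind.singular) Q +
        LaurentPolynomial.T 1 * P.kindSum (Function.update κ v VertexKind.smoothed) Q := by
  refine selectionSum_add_mul (v := v) (fun u hu => by simp [hu]) (fun u hu => by simp [hu])
    fun c => ?_
  cases c <;> simp [kindWeight, localContribution, halfPow]
  ring

open Classical in
theorem kindSum_negative (κ : P.V → VertexKind) (v : P.V) (Q : P.E) :
    P.kindSum (Function.update κ v VertexKind.negative) Q =
      P.kindSum (Function.update κ v VertexKind.singular) Q +
        LaurentPolynomial.T (-1) * P.kindSum (Function.update κ v VertexKind.smoothed) Q := by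
  refine selectionSum_add_mul (v := v) (fun u hu => by simp [hu]) (fun u hu => by simp [hu])
    fun c => ?_
  cases c <;> simp [kindWeight, localContribution, halfPow]

open Classical in
/-- Statements about diagrams with a fixed projection can be proved by resolving the singular
points. -/
theorem singular_induction {motive : (P.V → VertexKind) → Prop}
    (h0 : ∀ κ, (∀ v, κ v ≠ VertexKind.singular) → motive κ)
    (h1 : ∀ κ v, κ v = VertexKind.singular → motive (Function.update κ v VertexKind.positive) →
      motive (Function.update κ v VertexKind.smoothed) → motive κ) (κ : P.V → VertexKind) :
    motive κ := by
  induction hn : (Finset.univ.filter fun v => κ v = VertexKind.singular).card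
    using Nat.strong_induction_on generalizing κ with
  | _ n ih =>
    by_cases hs : ∃ v, κ v = VertexKind.singular
    · obtain ⟨v, hv⟩ := hs
      have key : ∀ k, k ≠ VertexKind.singular → motive (Function.update κ v k) := fun k hk => by
        refine ih _ ?_ _ rfl
        rw [← hn]
        apply Finset.card_lt_card
        rw [Finset.ssubset_iff_of_subset]
        · exact ⟨v, by simpa using hv, by simpa using hk⟩
        · intro u hu
          simp only [Finset.mem_filter, Finset.mem_univ, true_and] at hu ⊢
          by_cases huv : u = v
          · rwa [huv]
          · rwa [Function.update_of_ne huv] at hu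
      exact h1 κ v hv (key _ (by simp)) (key _ (by simp))
    · push Not at hs
      exact h0 κ hs

/-- The transition weights of the vertex types. -/
noncomputable def flowP : VertexKind → HalfLaurent
  | VertexKind.positive => 1 - LaurentPolynomial.T (-2)
  | VertexKind.smoothed => 1
  | _ => 0

/-- The transition weights of the vertex types. -/
noncomputable def flowQ : VertexKind → HalfLaurent
  | VertexKind.positive => 1
  | VertexKind.negative => LaurentPolynomial.T 2
  | _ => 0

/-- The exponent of the monomial which relates `kindWeight` and `flowWeight`. -/
def flowShift : VertexKind → ℤ
  | VertexKind.positive => 2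
  | VertexKind.smoothed => 1
  | _ => 0

/-- Singular vertices are excluded since their top weight is 0, while `flowWeight` is 1 there. -/
theorem kindWeight_eq {k : VertexKind} (hk : k ≠ VertexKind.singular) (c : Corner) :
    kindWeight k c = LaurentPolynomial.T (flowShift k - indexDrop c) *
      flowWeight (flowP k) (flowQ k) c := by
  have h₁ : (LaurentPolynomial.T 2 * LaurentPolynomial.T (-2) : HalfLaurent) = 1 := by
    rw [← LaurentPolynomial.T_add]; norm_num
  have h₂ : (LaurentPolynomial.T 1 * LaurentPolynomial.T (-2) : HalfLaurent) =
      LaurentPolynomial.T (-1) := by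
    rw [← LaurentPolynomial.T_add]; norm_num
  have h₃ : (LaurentPolynomial.T (-2) * LaurentPolynomial.T 2 : HalfLaurent) = 1 := by
    rw [← LaurentPolynomial.T_add]; norm_num
  have h₄ : (LaurentPolynomial.T (-1) * LaurentPolynomial.T 2 : HalfLaurent) =
      LaurentPolynomial.T 1 := by
    rw [← LaurentPolynomial.T_add]; norm_num
  rcases nonsingular_kind_cases hk with rfl | rfl | rfl <;> cases c <;>
    simp [kindWeight, localContribution, halfPow, flowShift, indexDrop, flowWeight, flowP, flowQ,
      h₁, h₂, h₃, h₄]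

open Classical in
theorem sum_awayFrom (hc : P.IsConnected) {ind : P.R → ℤ}
    (hi : ∀ e, ind (P.left e) = ind (P.right e) + 1) (Q : P.E) :
    ∑ r ∈ Finset.univ.filter (· ∈ P.awayFrom Q), ind r = ∑ r, ind r + 1 - 2 * ind (P.left Q) := by
  obtain ⟨ι, hι, hr⟩ := exists_enumeration hc Q
  rw [sum_regions hι (left_ne_right hc Q) hr ind, hi Q]
  have : ∑ r ∈ Finset.univ.filter (· ∈ P.awayFrom Q), ind r = ∑ u, ind (ι u) := by
    symm
    refine Finset.sum_nbij ι (fun u _ => ?_) (fun a _ b _ h => hι h) (fun r h => ?_) fun _ _ => rfl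
    · simp [← hr]
    · simp only [Finset.coe_filter, Finset.mem_univ, true_and, ← hr] at h
      simpa using h
  rw [this]
  ring

/-- The state sum of an ordinary link is, up to a monomial, a minor of the transition matrix. -/
theorem exists_kindSum_eq_edgeDet (hc : P.IsConnected) (v : P.V) {ind : P.R → ℤ}
    (hi : ∀ e, ind (P.left e) = ind (P.right e) + 1) {κ : P.V → VertexKind}
    (hκ : ∀ v, κ v ≠ VertexKind.singular) :
    ∃ k : ℤ, ∀ Q, P.kindSum κ Q = LaurentPolynomial.T (k - 2 * ind (P.left Q)) *
      edgeDet (fun v => flowP (κ v)) (fun v => flowQ (κ v)) Q := by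
  classical
  refine ⟨∑ v, (flowShift (κ v) - ind (P.corner v Corner.A)) + ∑ r, ind r + 1, fun Q => ?_⟩
  rw [← selectionSum_flowWeight hc v, kindSum, selectionSum_rescale (g := ind)
    (l := fun v => flowShift (κ v) - ind (P.corner v Corner.A))
    (w' := fun v => flowWeight (flowP (κ v)) (flowQ (κ v)))]
  · rw [sum_awayFrom hc hi Q]
    congr 2
    ring
  · intro v c
    rw [kindWeight_eq (hκ v), index_corner hi v c]
    congr 2
    ring

/-- The powers of `T` given by the index of the left region form a right fixed vector of the
transition matrix, nowhere zero; it compares minors at different edges and makes the block of a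
split component singular. -/
theorem transitionRow_index {ind : P.R → ℤ} (hi : ∀ e, ind (P.left e) = ind (P.right e) + 1)
    {κ : P.V → VertexKind} (hκ : ∀ v, κ v ≠ VertexKind.singular) (x : P.V ⊕ P.V) :
    ∑ e, transitionRow (fun v => flowP (κ v)) (fun v => flowQ (κ v)) x e *
      LaurentPolynomial.T (2 * ind (P.left e)) =
      LaurentPolynomial.T (2 * ind (P.left (P.out x))) := by
  have h2 : ∀ n : ℤ, (LaurentPolynomial.T n : HalfLaurent) = LaurentPolynomial.T 2 *
      LaurentPolynomial.T (n - 2) := fun n => by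
    rw [← LaurentPolynomial.T_add]; congr 1; ring
  have h1 : (LaurentPolynomial.T (-2) * LaurentPolynomial.T 2 : HalfLaurent) = 1 := by
    rw [← LaurentPolynomial.T_add]; norm_num
  rcases x with v | v
  · have hB := index_corner hi v Corner.D
    rw [(transitionRow_dot _ _ _ v).1, left_inL, left_inR, hB]
    change _ = LaurentPolynomial.T (2 * ind (P.left (P.outL v)))
    rw [left_outL]
    simp only [indexDrop, mul_one, mul_sub]
    rw [h2 (2 * ind _)]
    rcases nonsingular_kind_cases (hκ v) with h | h | h <;> simp only [h, flowP, flowQ]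
    · linear_combination (-LaurentPolynomial.T (2 * ind (P.corner v Corner.A) - 2)) * h1
    · ring
    · ring
  · have hB := index_corner hi v Corner.D
    have hD := index_corner hi v Corner.B
    rw [(transitionRow_dot _ _ _ v).2, left_inL, left_inR, hB]
    change _ = LaurentPolynomial.T (2 * ind (P.left (P.outR v)))
    rw [left_outR, hD]
    simp only [indexDrop, mul_one, mul_sub]
    rw [h2 (2 * ind _)]
    rcases nonsingular_kind_cases (hκ v) with h | h | h <;> simp only [h, flowP, flowQ]
    · linear_combination (LaurentPolynomial.T (2 * ind (P.corner v Corner.A) - 2)) * h1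
    · ring
    · ring

/-- The state sum does not depend on the initial point. -/
theorem kindSum_eq_kindSum (κ : P.V → VertexKind) (Q Q' : P.E) :
    P.kindSum κ Q = P.kindSum κ Q' := by
  classical
  induction κ using singular_induction with
  | h0 κ hκ =>
    by_cases hc : P.IsConnected
    · rcases isEmpty_or_nonempty P.V with hV | ⟨⟨v⟩⟩
      · rw [kindSum_of_isEmpty hc, kindSum_of_isEmpty hc]
      · obtain ⟨ind, hi⟩ := exists_index hc
        obtain ⟨k, hk⟩ := exists_kindSum_eq_edgeDet hc v hi hκ
        -- The minors at two edges are proportional to the entries of the fixed vector, and the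
        -- monomial relating state sum and minor compensates exactly this ratio.
        have := edgeDet_mul hc v (transitionRow_index hi hκ) Q Q'
        have h3 : ∀ Q₀ Q₁ : P.E, (LaurentPolynomial.T (k - 2 * ind (P.left Q₀)) : HalfLaurent) =
            LaurentPolynomial.T (k - 2 * ind (P.left Q₀) - 2 * ind (P.left Q₁)) *
              LaurentPolynomial.T (2 * ind (P.left Q₁)) := fun Q₀ Q₁ => by
          rw [← LaurentPolynomial.T_add]; congr 1; ring
        rw [hk, hk, h3 Q Q', h3 Q' Q, mul_assoc, mul_assoc, mul_comm _ (edgeDet _ _ _), this,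
          mul_comm (LaurentPolynomial.T (2 * ind (P.left Q))), sub_right_comm]
    · rw [kindSum_of_not_isConnected hc, kindSum_of_not_isConnected hc]
  | h1 κ v hv h₁ h₂ =>
    -- The singular state sum is the positive one minus a multiple of the smoothed one, and both are
    -- already known not to depend on the edge.
    rw [kindSum_positive, kindSum_positive, h₂, ← hv, Function.update_eq_self] at h₁
    exact add_right_cancel h₁

end SingularLinkDiagram

/-! ### Link components, descending knots and split links -/

namespace SingularLinkDiagram

variable {P : SingularLinkDiagram}

/-- How a strand that enters a vertex leaves it. -/
def turn (P : SingularLinkDiagram) (κ : P.V → VertexKind) :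
    Equiv.Perm (P.V ⊕ P.V) :=
  Function.Involutive.toPerm
    (Sum.elim (fun v => if κ v = VertexKind.smoothed then Sum.inl v else Sum.inr v)
      (fun v => if κ v = VertexKind.smoothed then Sum.inr v else Sum.inl v)) (by
    rintro (v | v) <;> by_cases h : κ v = VertexKind.smoothed <;> simp [h])

theorem turn_inl (κ : P.V → VertexKind) (v : P.V) :
    P.turn κ (Sum.inl v) = if κ v = VertexKind.smoothed then Sum.inl v else Sum.inr v :=
  rfl

theorem turn_inr (κ : P.V → VertexKind) (v : P.V) :
    P.turn κ (Sum.inr v) = if κ v = VertexKind.smoothed then Sum.inr v else Sum.inl v :=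
  rfl

/-- The permutation of the edges given by following the link. -/
noncomputable def strandPerm (hc : P.IsConnected) (v₀ : P.V) (κ : P.V → VertexKind) :
    Equiv.Perm P.E :=
  (inEquiv hc v₀).symm.trans ((P.turn κ).trans (outEquiv hc v₀))

theorem strandPerm_in (hc : P.IsConnected) (v₀ : P.V) (κ : P.V → VertexKind) (x : P.V ⊕ P.V) :
    strandPerm hc v₀ κ (Sum.elim P.inL P.inR x) = P.out (P.turn κ x) := by
  have : Sum.elim P.inL P.inR x = inEquiv hc v₀ x := rfl
  rw [this, strandPerm, Equiv.trans_apply, Equiv.symm_apply_apply]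
  rfl

theorem strandPerm_of_follows (hc : P.IsConnected) (v₀ : P.V) {κ : P.V → VertexKind} {e e' : P.E}
    (h : (P.withKind κ).Follows e e') : strandPerm hc v₀ κ e = e' := by
  classical
  obtain ⟨v, ⟨hv, ⟨rfl, rfl⟩ | ⟨rfl, rfl⟩⟩ | ⟨hv, ⟨rfl, rfl⟩ | ⟨rfl, rfl⟩⟩⟩ := h
  · exact (strandPerm_in hc v₀ κ (Sum.inl v)).trans
      (congrArg P.out (show P.turn κ (Sum.inl v) = Sum.inr v from if_neg hv))
  · exact (strandPerm_in hc v₀ κ (Sum.inr v)).trans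
      (congrArg P.out (show P.turn κ (Sum.inr v) = Sum.inl v from if_neg hv))
  · exact (strandPerm_in hc v₀ κ (Sum.inl v)).trans
      (congrArg P.out (show P.turn κ (Sum.inl v) = Sum.inl v from if_pos hv))
  · exact (strandPerm_in hc v₀ κ (Sum.inr v)).trans
      (congrArg P.out (show P.turn κ (Sum.inr v) = Sum.inr v from if_pos hv))

/-- Every edge follows the one that enters the same vertex on its strand. -/
theorem follows_turn (κ : P.V → VertexKind) (x : P.V ⊕ P.V) :
    (P.withKind κ).Follows (Sum.elim P.inL P.inR (P.turn κ x)) (P.out x) := by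
  classical
  rcases x with v | v
  · rw [turn_inl]
    split_ifs with hv
    · exact ⟨v, Or.inr ⟨hv, Or.inl ⟨rfl, rfl⟩⟩⟩
    · exact ⟨v, Or.inl ⟨hv, Or.inr ⟨rfl, rfl⟩⟩⟩
  · rw [turn_inr]
    split_ifs with hv
    · exact ⟨v, Or.inr ⟨hv, Or.inr ⟨rfl, rfl⟩⟩⟩
    · exact ⟨v, Or.inl ⟨hv, Or.inl ⟨rfl, rfl⟩⟩⟩

theorem sameCycle_of_eqvGen (hc : P.IsConnected) (v₀ : P.V) {κ : P.V → VertexKind} {e e' : P.E}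
    (h : Relation.EqvGen (P.withKind κ).Follows e e') : (strandPerm hc v₀ κ).SameCycle e e' := by
  induction h with
  | rel e e' h => exact ⟨1, by rw [zpow_one, strandPerm_of_follows hc v₀ h]⟩
  | refl e => exact Equiv.Perm.SameCycle.refl _ _
  | symm _ _ _ ih => exact ih.symm
  | trans _ _ _ _ _ ih₁ ih₂ => exact ih₁.trans ih₂

theorem isConnected_of_isKnot {κ : P.V → VertexKind} (h : (P.withKind κ).IsKnot) :
    P.IsConnected := by
  obtain ⟨e₀⟩ := P.nonemptyE
  have hq : ∀ e e', Relation.EqvGen (P.withKind κ).Follows e e' →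
      (Quot.mk (fun e e' : P.E => ∃ v, e ∈ P.star v ∧ e' ∈ P.star v) e) = Quot.mk _ e' := by
    intro e e' h
    induction h with
    | rel e e' h =>
      obtain ⟨v, ⟨-, ⟨rfl, rfl⟩ | ⟨rfl, rfl⟩⟩ | ⟨-, ⟨rfl, rfl⟩ | ⟨rfl, rfl⟩⟩⟩ := h <;>
        exact Quot.sound ⟨v, by simp [star], by simp [star]⟩
    | refl e => rfl
    | symm _ _ _ ih => exact ih.symm
    | trans _ _ _ _ _ ih₁ ih₂ => exact ih₁.trans ih₂
  refine Nat.card_eq_one_iff_unique.mpr ⟨⟨?_⟩, ⟨Quot.mk _ e₀⟩⟩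
  rintro ⟨e⟩ ⟨e'⟩
  exact hq e e' (h e e')

/-- Smoothing a crossing of a knot gives a link with more than one component. -/
theorem not_isKnot_update {κ : P.V → VertexKind} (h : (P.withKind κ).IsKnot) {v : P.V}
    (hv : κ v ≠ VertexKind.smoothed) {κ' : P.V → VertexKind}
    (hκ' : ∀ u, u ≠ v → κ' u = κ u) (hv' : κ' v = VertexKind.smoothed) :
    ¬ (P.withKind κ').IsKnot := by
  classical
  intro h'
  have hc := isConnected_of_isKnot h
  -- On a knot the strand permutation is one cycle through all edges, so its sign depends only on
  -- their number. Smoothing a crossing composes it with a transposition, which changes the sign.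
  have hsign : ∀ κ₀ : P.V → VertexKind, (P.withKind κ₀).IsKnot →
      Equiv.Perm.sign (strandPerm hc v κ₀) = -(-1) ^ Fintype.card P.E := by
    intro κ₀ h₀
    have hsc := fun e e' => sameCycle_of_eqvGen hc v (h₀ e e')
    have hne : ∀ e, strandPerm hc v κ₀ e ≠ e := by
      intro e he
      have h1 : ∀ e', e' = e := fun e' => by
        obtain ⟨n, hn⟩ := hsc e e'
        rw [← hn]
        exact Equiv.Perm.zpow_apply_eq_self_of_apply_eq_self he n
      exact inL_ne_inR v v ((h1 _).trans (h1 _).symm)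
    have hcyc : (strandPerm hc v κ₀).IsCycle :=
      ⟨P.inL v, hne _, fun e _ => hsc _ e⟩
    rw [hcyc.sign]
    have : (strandPerm hc v κ₀).support = Finset.univ := by
      ext e
      simp [hne e]
    rw [this, Finset.card_univ]
  have hswap : strandPerm hc v κ' = strandPerm hc v κ * Equiv.swap (P.inL v) (P.inR v) := by
    ext e
    obtain ⟨x, rfl⟩ := (inEquiv hc v).surjective e
    change strandPerm hc v κ' (Sum.elim P.inL P.inR x) =
      strandPerm hc v κ (Equiv.swap (P.inL v) (P.inR v) (Sum.elim P.inL P.inR x))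
    have hL := strandPerm_in hc v κ (Sum.inl v)
    have hR := strandPerm_in hc v κ (Sum.inr v)
    rw [turn_inl, if_neg hv] at hL
    rw [turn_inr, if_neg hv] at hR
    rw [strandPerm_in]
    rcases x with u | u <;> by_cases hu : u = v
    · subst hu
      rw [turn_inl, if_pos hv', Sum.elim_inl, Equiv.swap_apply_left]
      exact hR.symm
    · rw [Sum.elim_inl, Equiv.swap_apply_of_ne_of_ne (fun h => hu (inL_injective h))
        (inL_ne_inR u v)]
      have := strandPerm_in hc v κ (Sum.inl u)
      rw [Sum.elim_inl] at this
      rw [this, turn_inl, turn_inl, hκ' u hu]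
    · subst hu
      rw [turn_inr, if_pos hv', Sum.elim_inr, Equiv.swap_apply_right]
      exact hL.symm
    · rw [Sum.elim_inr, Equiv.swap_apply_of_ne_of_ne (fun h => inL_ne_inR v u h.symm)
        (fun h => hu (inR_injective h))]
      have := strandPerm_in hc v κ (Sum.inr u)
      rw [Sum.elim_inr] at this
      rw [this, turn_inr, turn_inr, hκ' u hu]
  have h1 := hsign κ' h'
  rw [hswap, Equiv.Perm.sign_mul, Equiv.Perm.sign_swap (inL_ne_inR v v), hsign κ h] at h1
  have h2 : ∀ s : ℤˣ, s * -1 ≠ s := by decide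
  exact h2 _ h1

/-- Position of an edge on a knot, as seen from an initial edge. -/
theorem exists_position (hc : P.IsConnected) (v₀ : P.V) {κ : P.V → VertexKind}
    (h : (P.withKind κ).IsKnot) (Q : P.E) :
    ∃ l : P.E → ℕ, Function.Injective l ∧
      ∀ e e', (P.withKind κ).Follows e e' → e' ≠ Q → l e < l e' := by
  classical
  have hex : ∀ e, ∃ n : ℕ, ((strandPerm hc v₀ κ) ^ n) Q = e := fun e =>
    (sameCycle_of_eqvGen hc v₀ (h Q e)).exists_nat_pow_eq
  refine ⟨fun e => Nat.find (hex e), fun e e' hee => ?_, fun e e' hf he' => ?_⟩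
  · have h1 := Nat.find_spec (hex e)
    have h2 := Nat.find_spec (hex e')
    simp only at hee
    rw [← h1, hee, h2]
  · have h2 := Nat.find_spec (hex e')
    simp only
    cases hm : Nat.find (hex e') with
    | zero =>
      rw [hm] at h2
      exact (he' h2.symm).elim
    | succ m =>
      rw [hm, pow_succ', Equiv.Perm.mul_apply, ← strandPerm_of_follows hc v₀ hf] at h2
      exact Nat.lt_succ_of_le (Nat.find_min' _ ((strandPerm hc v₀ κ).injective h2))

theorem follows_congr {κ κ' : P.V → VertexKind}
    (h : ∀ v, κ' v = VertexKind.smoothed ↔ κ v = VertexKind.smoothed) :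
    (P.withKind κ').Follows = (P.withKind κ).Follows := by
  funext e e'
  have : ∀ v, (P.withKind κ').kind v = VertexKind.smoothed ↔
    (P.withKind κ).kind v = VertexKind.smoothed := h
  simp only [Follows, ne_eq, this]

/-- A knot becomes descending after suitable crossing changes. -/
theorem exists_kindSum_eq_T [Nonempty P.V] {κ : P.V → VertexKind}
    (h : (P.withKind κ).IsKnot) (Q : P.E) :
    ∃ (κ' : P.V → VertexKind) (k : ℤ), (∀ v, κ' v ≠ VertexKind.singular) ∧
      (∀ v, κ' v = VertexKind.smoothed ↔ κ v = VertexKind.smoothed) ∧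
      P.kindSum κ' Q = LaurentPolynomial.T k := by
  classical
  obtain ⟨v₀⟩ := ‹Nonempty P.V›
  have hc := isConnected_of_isKnot h
  obtain ⟨l, hl, hlt⟩ := exists_position hc v₀ h Q
  obtain ⟨ind, hi⟩ := exists_index hc
  -- The strand entering first is made the upper one: from bottom left at a positive crossing, from
  -- bottom right at a negative one. The upper outgoing edge receives weight only from its own
  -- strand, the lower one possibly from both, hence only from earlier edges.
  let κ' : P.V → VertexKind := fun v => if κ v = VertexKind.smoothed then VertexKind.smoothed
    else if l (P.inL v) < l (P.inR v) then VertexKind.positive else VertexKind.negative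
  have hns : ∀ v, κ' v ≠ VertexKind.singular := fun v => by
    simp only [κ']
    split_ifs <;> simp
  have hsm : ∀ v, κ' v = VertexKind.smoothed ↔ κ v = VertexKind.smoothed := fun v => by
    simp only [κ']
    split_ifs <;> simp [*]
  obtain ⟨k, hk⟩ := exists_kindSum_eq_edgeDet hc v₀ hi hns
  refine ⟨κ', k - 2 * ind (P.left Q), hns, hsm, (hk Q).trans ?_⟩
  rw [edgeDet_eq_one hc v₀ hl, mul_one]
  intro x hx e he
  have hf := hlt _ _ (follows_turn κ x) hx
  rcases x with v | v
  · rw [turn_inl] at hf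
    by_cases hv : κ v = VertexKind.smoothed
    · have hv' : κ' v = VertexKind.smoothed := if_pos hv
      have : e = P.inL v := by
        by_contra hne
        simp [transitionRow, hv', flowP, flowQ, hne] at he
      rw [if_pos hv] at hf
      rw [this]
      exact hf
    · rw [if_neg hv] at hf
      by_cases hlr : l (P.inL v) < l (P.inR v)
      · have : e = P.inL v ∨ e = P.inR v := by
          by_contra! hne
          simp [transitionRow, hne] at he
        rcases this with rfl | rfl
        exacts [hlr.trans hf, hf]
      · have hv' : κ' v = VertexKind.negative := by simp [κ', hv, hlr]
        have : e = P.inR v := by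
          by_contra hne
          simp [transitionRow, hv', flowP, flowQ, hne] at he
        rw [this]
        exact hf
  · rw [turn_inr] at hf
    by_cases hv : κ v = VertexKind.smoothed
    · have hv' : κ' v = VertexKind.smoothed := if_pos hv
      have : e = P.inR v := by
        by_contra hne
        simp [transitionRow, hv', flowP, flowQ, hne] at he
      rw [if_pos hv] at hf
      rw [this]
      exact hf
    · rw [if_neg hv] at hf
      by_cases hlr : l (P.inL v) < l (P.inR v)
      · have hv' : κ' v = VertexKind.positive := by simp [κ', hv, hlr]
        have : e = P.inL v := by
          by_contra hne
          simp [transitionRow, hv', flowP, flowQ, hne] at he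
        rw [this]
        exact hf
      · have : e = P.inL v ∨ e = P.inR v := by
          by_contra! hne
          simp [transitionRow, hne] at he
        rcases this with rfl | rfl
        exacts [hf, (not_lt.mp hlr).trans_lt hf]

/-- After suitable crossing changes a link with more than one component is split. -/
theorem exists_kindSum_eq_zero {κ : P.V → VertexKind} (h : ¬ (P.withKind κ).IsKnot) :
    ∃ κ' : P.V → VertexKind, (∀ v, κ' v ≠ VertexKind.singular) ∧
      (∀ v, κ' v = VertexKind.smoothed ↔ κ v = VertexKind.smoothed) ∧
      ∀ Q, P.kindSum κ' Q = 0 := by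
  classical
  simp only [IsKnot, not_forall] at h
  obtain ⟨e₀, Q₀, hQ⟩ : ∃ e₀ Q₀ : P.E, ¬ Relation.EqvGen (P.withKind κ).Follows e₀ Q₀ := h
  let K : P.E → Prop := Relation.EqvGen (P.withKind κ).Follows e₀
  -- Where the component `K` of `e₀` meets other components it becomes the upper strand, so no
  -- weight enters it from outside.
  let κ' : P.V → VertexKind := fun v => if κ v = VertexKind.smoothed then VertexKind.smoothed
    else if K (P.inL v) then VertexKind.positive else VertexKind.negative
  have hns : ∀ v, κ' v ≠ VertexKind.singular := fun v => by
    simp only [κ']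
    split_ifs <;> simp
  have hsm : ∀ v, κ' v = VertexKind.smoothed ↔ κ v = VertexKind.smoothed := fun v => by
    simp only [κ']
    split_ifs <;> simp [*]
  refine ⟨κ', hns, hsm, fun Q => ?_⟩
  by_cases hc : P.IsConnected
  swap
  · exact kindSum_of_not_isConnected hc _ _
  rcases isEmpty_or_nonempty P.V with hV | ⟨⟨v₀⟩⟩
  · rw [edge_unique_of_isEmpty hc Q₀ e₀] at hQ
    exact (hQ (Relation.EqvGen.refl _)).elim
  obtain ⟨ind, hi⟩ := exists_index hc
  obtain ⟨k, hk⟩ := exists_kindSum_eq_edgeDet hc v₀ hi hns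
  have hKf : ∀ e e', (P.withKind κ).Follows e e' → K e' → K e := fun e e' hf hK =>
    hK.trans _ _ _ ((Relation.EqvGen.rel _ _ hf).symm)
  -- The initial point is first moved off `K`, so that the singular block stays intact.
  rw [kindSum_eq_kindSum κ' Q Q₀, hk, edgeDet_eq_zero hc v₀ (K := K) hQ (Relation.EqvGen.refl e₀)
    (u := fun e => LaurentPolynomial.T (2 * ind (P.left e))) (LaurentPolynomial.isUnit_T _).ne_zero
    (fun x _ => transitionRow_index hi hns x), mul_zero]
  intro x hx e he
  have hf := hKf _ _ (follows_turn κ x) hx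
  rcases x with v | v
  · rw [turn_inl] at hf
    by_cases hv : κ v = VertexKind.smoothed
    · have hv' : κ' v = VertexKind.smoothed := if_pos hv
      rw [if_pos hv] at hf
      have hne : e ≠ P.inL v := fun h => he (h ▸ hf)
      simp [transitionRow, hv', flowP, flowQ, hne]
    · rw [if_neg hv] at hf
      have hne : e ≠ P.inR v := fun h => he (h ▸ hf)
      by_cases hL : K (P.inL v)
      · have hne' : e ≠ P.inL v := fun h => he (h ▸ hL)
        simp [transitionRow, hne, hne']
      · have hv' : κ' v = VertexKind.negative := by simp [κ', hv, hL]
        simp [transitionRow, hv', flowP, flowQ, hne]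
  · rw [turn_inr] at hf
    by_cases hv : κ v = VertexKind.smoothed
    · have hv' : κ' v = VertexKind.smoothed := if_pos hv
      rw [if_pos hv] at hf
      have hne : e ≠ P.inR v := fun h => he (h ▸ hf)
      simp [transitionRow, hv', flowP, flowQ, hne]
    · rw [if_neg hv] at hf
      have hne : e ≠ P.inL v := fun h => he (h ▸ hf)
      have hv' : κ' v = VertexKind.positive := by
        simp only [κ']
        exact (if_neg hv).trans (if_pos hf)
      simp [transitionRow, hv', flowP, flowQ, hne]

end SingularLinkDiagram

/-! ### Units and evaluations of Laurent polynomials -/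

theorem LaurentPolynomial.exists_eq_T_of_isUnit {u : ℤ[T;T⁻¹]} (hu : IsUnit u) :
    ∃ (ε : ℤˣ) (k : ℤ), u = ((ε : ℤ) : ℤ[T;T⁻¹]) * LaurentPolynomial.T k := by
  obtain ⟨w, hw⟩ := hu.exists_right_inv
  obtain ⟨m, p, hp⟩ := u.exists_T_pow
  obtain ⟨n, q, hq⟩ := w.exists_T_pow
  -- Clearing denominators in a unit and its inverse gives two polynomials with product a power of
  -- the prime `X`; so each is a unit times a power of `X`.
  have h1 : p * q = Polynomial.X ^ (m + n) := by
    apply Polynomial.toLaurent_injective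
    rw [map_mul, hp, hq, Polynomial.toLaurent_X_pow, mul_mul_mul_comm, hw, one_mul,
      ← LaurentPolynomial.T_add]
    push_cast
    rfl
  obtain ⟨i, -, c, hc⟩ := (dvd_prime_pow Polynomial.prime_X _).mp ⟨q, h1.symm⟩
  obtain ⟨r, hr, hrc⟩ := Polynomial.isUnit_iff.mp c.isUnit
  obtain ⟨ε, rfl⟩ := hr
  have hε : ((ε : ℤ) : ℤ[T;T⁻¹]) * ((ε : ℤ) : ℤ[T;T⁻¹]) = 1 := by
    rw [← Int.cast_mul, ← Units.val_mul, Int.units_mul_self, Units.val_one, Int.cast_one]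
  refine ⟨ε, i - m, ?_⟩
  have h2 : u * LaurentPolynomial.T m * ((ε : ℤ) : ℤ[T;T⁻¹]) = LaurentPolynomial.T i := by
    rw [← hp, ← Polynomial.toLaurent_X_pow, ← hc, ← hrc, map_mul, Polynomial.toLaurent_C]
    congr 1
  rw [LaurentPolynomial.T_sub, ← h2]
  have h3 : (LaurentPolynomial.T m * LaurentPolynomial.T (-m) : ℤ[T;T⁻¹]) = 1 := by
    rw [← LaurentPolynomial.T_add]; simp
  linear_combination (-u) * h3 - u * LaurentPolynomial.T m * LaurentPolynomial.T (-m) * hε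

theorem map_selectionSum {V R A B : Type} [Fintype V] [CommRing A] [CommRing B] (f : A →+* B)
    (reg : V → Corner → R) (S : Set R) (w : V → Corner → A) :
    f (selectionSum reg S w) = selectionSum reg S fun v c => f (w v c) := by
  classical
  simp only [selectionSum, map_sum, apply_ite f, map_prod, map_zero]

/-- Evaluation at `T^{1/2} = 1`. -/
noncomputable abbrev evalOne : HalfLaurent →+* ℤ :=
  LaurentPolynomial.eval₂ (RingHom.id ℤ) (1 : ℤˣ)

/-- The unit `1 + ε`. -/
def dualUnit : (DualNumber ℤ)ˣ where
  val := 1 + DualNumber.eps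
  inv := 1 - DualNumber.eps
  val_inv := by
    rw [mul_sub, mul_one, add_mul, one_mul, DualNumber.eps_mul_eps]
    abel
  inv_val := by
    rw [mul_add, mul_one, sub_mul, one_mul, DualNumber.eps_mul_eps]
    abel

theorem dualUnit_zpow (n : ℤ) : (((dualUnit ^ n : (DualNumber ℤ)ˣ) : DualNumber ℤ)).fst = 1 ∧
    (((dualUnit ^ n : (DualNumber ℤ)ˣ) : DualNumber ℤ)).snd = n := by
  have h1 : ((dualUnit : DualNumber ℤ)) = 1 + DualNumber.eps := rfl
  have h2 : ((dualUnit⁻¹ : (DualNumber ℤ)ˣ) : DualNumber ℤ) = 1 - DualNumber.eps := rfl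
  induction n using Int.induction_on with
  | zero => simp
  | succ n ih => simp [zpow_add_one, h1, add_comm]
  | pred n ih => simp [zpow_sub_one, h2, ih, -zpow_neg]; ring

/-- Evaluation at `T^{1/2} = 1 + ε`. -/
noncomputable def evalDual : HalfLaurent →+* DualNumber ℤ :=
  LaurentPolynomial.eval₂ (algebraMap ℤ (DualNumber ℤ)) dualUnit

/-- The two components record the value and the derivative at `T^{1/2} = 1`; the derivative detects
the exponent of a monomial. -/
theorem evalDual_T (n : ℤ) : (evalDual (LaurentPolynomial.T n)).fst = 1 ∧
    (evalDual (LaurentPolynomial.T n)).snd = n := by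
  rw [evalDual, LaurentPolynomial.eval₂_T]
  exact dualUnit_zpow n

theorem evalOne_T (n : ℤ) : evalOne (LaurentPolynomial.T n) = 1 := by
  rw [LaurentPolynomial.eval₂_T]
  simp

theorem fst_evalDual (p : HalfLaurent) : (evalDual p).fst = evalOne p := by
  induction p using LaurentPolynomial.induction_on' with
  | add p q hp hq => rw [map_add, map_add, TrivSqZeroExt.fst_add, hp, hq]
  | C_mul_T n a =>
    rw [map_mul, map_mul, TrivSqZeroExt.fst_mul, (evalDual_T n).1, evalOne_T, evalDual,
      LaurentPolynomial.eval₂_C, LaurentPolynomial.eval₂_C]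
    rfl

/-- The unit `-T^{1/2}`. -/
noncomputable def negUnit : HalfLaurentˣ where
  val := -LaurentPolynomial.T 1
  inv := -LaurentPolynomial.T (-1)
  val_inv := by
    rw [neg_mul_neg, ← LaurentPolynomial.T_add]
    simp
  inv_val := by
    rw [neg_mul_neg, ← LaurentPolynomial.T_add]
    simp

theorem negUnit_zpow (n : ℤ) : ((negUnit ^ n : HalfLaurentˣ) : HalfLaurent) =
    ((((-1 : ℤˣ) ^ n : ℤˣ) : ℤ) : HalfLaurent) * LaurentPolynomial.T n := by
  have h1 : (negUnit : HalfLaurent) = -LaurentPolynomial.T 1 := rfl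
  have h2 : ((negUnit⁻¹ : HalfLaurentˣ) : HalfLaurent) = -LaurentPolynomial.T (-1) := rfl
  induction n using Int.induction_on with
  | zero => simp
  | succ n ih =>
    rw [zpow_add_one, zpow_add_one, Units.val_mul, ih, h1, LaurentPolynomial.T_add, Units.val_mul]
    push_cast
    ring
  | pred n ih =>
    rw [zpow_sub_one, zpow_sub_one, Units.val_mul, ih, h2, sub_eq_add_neg, LaurentPolynomial.T_add,
      Units.val_mul, inv_neg_one, Units.val_neg, Units.val_one]
    push_cast
    ring

/-- The substitution `T^{1/2} ↦ -T^{1/2}`. -/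
noncomputable def negHalf : HalfLaurent →+* HalfLaurent :=
  LaurentPolynomial.eval₂ LaurentPolynomial.C negUnit

theorem negHalf_T (n : ℤ) : negHalf (LaurentPolynomial.T n) =
    ((((-1 : ℤˣ) ^ n : ℤˣ) : ℤ) : HalfLaurent) * LaurentPolynomial.T n := by
  rw [negHalf, LaurentPolynomial.eval₂_T, negUnit_zpow]

theorem negHalf_negHalf (p : HalfLaurent) : negHalf (negHalf p) = p := by
  induction p using LaurentPolynomial.induction_on' with
  | add p q hp hq => rw [map_add, map_add, hp, hq]
  | C_mul_T n a =>
    have h1 : negHalf (LaurentPolynomial.C a) = LaurentPolynomial.C a := by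
      rw [negHalf, LaurentPolynomial.eval₂_C]
    have h2 : ((((-1 : ℤˣ) ^ n : ℤˣ) : ℤ) : HalfLaurent) * ((((-1 : ℤˣ) ^ n : ℤˣ) : ℤ)) = 1 := by
      rw [← Int.cast_mul, ← Units.val_mul, Int.units_mul_self, Units.val_one, Int.cast_one]
    rw [map_mul, map_mul, h1, h1, negHalf_T, map_mul, negHalf_T, map_intCast]
    linear_combination LaurentPolynomial.C a * LaurentPolynomial.T n * h2

/-! ### Crossing changes, normalization and symmetry -/

namespace SingularLinkDiagram

variable {P : SingularLinkDiagram}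

/-- A quantity of ordinary diagrams that is unaffected by crossing changes only depends on the
smoothed vertices. -/
theorem eq_of_crossing_changes {α : Type*} {f : (P.V → VertexKind) → α} {κ κ' : P.V → VertexKind}
    (hκ : ∀ v, κ v ≠ VertexKind.singular) (hκ' : ∀ v, κ' v ≠ VertexKind.singular)
    (hs : ∀ v, κ' v = VertexKind.smoothed ↔ κ v = VertexKind.smoothed)
    (h : ∀ κ₁ : P.V → VertexKind, (∀ v, κ₁ v ≠ VertexKind.singular) →
      (∀ v, κ₁ v = VertexKind.smoothed ↔ κ v = VertexKind.smoothed) →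
      ∀ v, κ₁ v ≠ VertexKind.smoothed →
        f (open Classical in Function.update κ₁ v VertexKind.positive) =
          f (open Classical in Function.update κ₁ v VertexKind.negative)) :
    f κ' = f κ := by
  classical
  -- The vertices are changed one at a time; at each step the two types agree or form a pair of
  -- opposite crossings.
  have key : ∀ s : Finset P.V, f (s.piecewise κ' κ) = f κ := by
    intro s
    induction s using Finset.induction_on with
    | empty => rw [Finset.piecewise_empty]
    | insert v s hv ih =>
      rw [Finset.piecewise_insert, ← ih]
      set κ₁ := s.piecewise κ' κ with hκ₁
      have hns : ∀ u, κ₁ u ≠ VertexKind.singular := fun u => by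
        rw [hκ₁, Finset.piecewise]
        split_ifs
        exacts [hκ' u, hκ u]
      have hsm : ∀ u, κ₁ u = VertexKind.smoothed ↔ κ u = VertexKind.smoothed := fun u => by
        rw [hκ₁, Finset.piecewise]
        split_ifs
        exacts [hs u, Iff.rfl]
      have hvs : κ' v = VertexKind.smoothed ↔ κ₁ v = VertexKind.smoothed :=
        (hs v).trans (hsm v).symm
      have hv₁ : f (Function.update κ₁ v (κ' v)) = f (Function.update κ₁ v (κ₁ v)) := by
        have hch := h κ₁ hns hsm v
        rcases nonsingular_kind_cases (hκ' v) with h1 | h1 | h1 <;>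
          rcases nonsingular_kind_cases (hns v) with h2 | h2 | h2 <;> rw [h1, h2] <;>
          first
          | exact hch (by simp [h2])
          | exact (hch (by simp [h2])).symm
          | simp [h1, h2] at hvs
      rwa [Function.update_eq_self] at hv₁
  have := key Finset.univ
  rwa [Finset.piecewise_univ] at this

end SingularLinkDiagram

namespace SingularLinkDiagram

variable {P : SingularLinkDiagram}

open Classical in
/-- A solution of the skein relation which vanishes, after suitable crossing changes, on every
ordinary diagram vanishes on all ordinary diagrams. -/
theorem eq_zero_of_skein {d : (P.V → VertexKind) → HalfLaurent}
    (hd : ∀ κ v, d (Function.update κ v VertexKind.positive) -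
      d (Function.update κ v VertexKind.negative) =
        (LaurentPolynomial.T 1 - LaurentPolynomial.T (-1)) *
          d (Function.update κ v VertexKind.smoothed))
    (h0 : ∀ κ : P.V → VertexKind, (∀ v, κ v ≠ VertexKind.singular) → ∃ κ' : P.V → VertexKind,
      (∀ v, κ' v ≠ VertexKind.singular) ∧
      (∀ v, κ' v = VertexKind.smoothed ↔ κ v = VertexKind.smoothed) ∧ d κ' = 0)
    (κ : P.V → VertexKind) (hκ : ∀ v, κ v ≠ VertexKind.singular) : d κ = 0 := by
  induction hn : (Finset.univ.filter fun v => κ v ≠ VertexKind.smoothed).card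
    using Nat.strong_induction_on generalizing κ with
  | _ n ih =>
    obtain ⟨κ', hκ', hs, h'⟩ := h0 κ hκ
    rw [← h']
    refine (eq_of_crossing_changes hκ hκ' hs fun κ₁ h₁ hs₁ v hv => ?_).symm
    -- A crossing change alters `d` by a multiple of its value on the smoothed diagram, which has
    -- fewer crossings and so is covered by induction.
    rw [← sub_eq_zero, hd, ih _ ?_ _ ?_ rfl, mul_zero]
    · rw [← hn]
      apply Finset.card_lt_card
      rw [Finset.ssubset_iff_of_subset]
      · exact ⟨v, by simpa using fun h => hv ((hs₁ v).mpr h), by simp⟩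
      · intro u hu
        simp only [Finset.mem_filter, Finset.mem_univ, true_and] at hu ⊢
        by_cases huv : u = v
        · rw [huv] at hu
          simp at hu
        · rw [Function.update_of_ne huv] at hu
          exact fun h => hu ((hs₁ u).mpr h)
    · intro u
      by_cases huv : u = v
      · rw [huv, Function.update_self]
        simp
      · rw [Function.update_of_ne huv]
        exact h₁ u

open Classical in
theorem kindSum_skein (Q : P.E) (κ : P.V → VertexKind) (v : P.V) :
    P.kindSum (Function.update κ v VertexKind.positive) Q -
      P.kindSum (Function.update κ v VertexKind.negative) Q =
        (LaurentPolynomial.T 1 - LaurentPolynomial.T (-1)) *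
          P.kindSum (Function.update κ v VertexKind.smoothed) Q := by
  rw [kindSum_positive, kindSum_negative]
  ring

/-- The skein factor `T^{1/2} - T^{-1/2}` vanishes at 1. -/
theorem evalOne_eq_of_smoothed_iff (Q : P.E) {κ κ' : P.V → VertexKind}
    (hκ : ∀ v, κ v ≠ VertexKind.singular) (hκ' : ∀ v, κ' v ≠ VertexKind.singular)
    (hs : ∀ v, κ' v = VertexKind.smoothed ↔ κ v = VertexKind.smoothed) :
    evalOne (P.kindSum κ' Q) = evalOne (P.kindSum κ Q) := by
  refine eq_of_crossing_changes (f := fun κ => evalOne (P.kindSum κ Q)) hκ hκ' hs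
    fun κ₁ _ _ v _ => ?_
  rw [← sub_eq_zero, ← map_sub, kindSum_skein, map_mul, map_sub, evalOne_T, evalOne_T, sub_self,
    zero_mul]

theorem evalOne_of_not_isKnot (Q : P.E) {κ : P.V → VertexKind}
    (hκ : ∀ v, κ v ≠ VertexKind.singular) (h : ¬ (P.withKind κ).IsKnot) :
    evalOne (P.kindSum κ Q) = 0 := by
  obtain ⟨κ', h1, h2, h3⟩ := exists_kindSum_eq_zero h
  rw [← evalOne_eq_of_smoothed_iff Q hκ h1 h2, h3, map_zero]

/-- The mirror image of an ordinary crossing. -/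
def mirror : VertexKind → VertexKind
  | VertexKind.positive => VertexKind.negative
  | VertexKind.negative => VertexKind.positive
  | k => k

theorem mirror_eq_smoothed (k : VertexKind) :
    mirror k = VertexKind.smoothed ↔ k = VertexKind.smoothed := by
  cases k <;> simp [mirror]

theorem mirror_ne_singular {k : VertexKind} (hk : k ≠ VertexKind.singular) :
    mirror k ≠ VertexKind.singular := by
  cases k <;> simp_all [mirror]

theorem kindSum_mirror (κ : P.V → VertexKind) (Q : P.E) :
    P.kindSum (fun v => mirror (κ v)) Q = LaurentPolynomial.invert (P.kindSum κ Q) := by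
  have h := map_selectionSum ((LaurentPolynomial.invert (R := ℤ)) : HalfLaurent →+* HalfLaurent)
    P.corner (P.awayFrom Q) fun v => kindWeight (κ v)
  refine Eq.trans ?_ h.symm
  rw [kindSum]
  congr 1
  funext v c
  cases κ v <;> cases c <;>
    simp [mirror, kindWeight, localContribution, halfPow, sub_eq_add_neg, add_comm]

-- For a knot even the derivative at 1 survives crossing changes: the smoothed diagram is not a
-- knot, so its state sum vanishes at 1, and the skein factor vanishes there as well.
open Classical in
theorem evalDual_eq_of_smoothed_iff (Q : P.E) {κ κ' : P.V → VertexKind}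
    (h : (P.withKind κ).IsKnot)
    (hκ : ∀ v, κ v ≠ VertexKind.singular) (hκ' : ∀ v, κ' v ≠ VertexKind.singular)
    (hs : ∀ v, κ' v = VertexKind.smoothed ↔ κ v = VertexKind.smoothed) :
    evalDual (P.kindSum κ' Q) = evalDual (P.kindSum κ Q) := by
  refine eq_of_crossing_changes (f := fun κ => evalDual (P.kindSum κ Q)) hκ hκ' hs
    fun κ₁ h₁ hs₁ v hv => ?_
  have hk₁ : (P.withKind κ₁).IsKnot := by
    intro e e'
    have := h e e'
    rwa [← follows_congr hs₁] at this
  have hk₂ := not_isKnot_update hk₁ hv (κ' := Function.update κ₁ v VertexKind.smoothed)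
    (fun u hu => Function.update_of_ne hu _ _) (Function.update_self _ _ _)
  have h0 := evalOne_of_not_isKnot Q (fun u => by
    by_cases hu : u = v
    · rw [hu, Function.update_self]
      simp
    · rw [Function.update_of_ne hu]
      exact h₁ u) hk₂
  rw [← fst_evalDual] at h0
  rw [← sub_eq_zero, ← map_sub, kindSum_skein, map_mul, map_sub]
  apply TrivSqZeroExt.ext
  · rw [TrivSqZeroExt.fst_mul, h0, mul_zero, TrivSqZeroExt.fst_zero]
  · rw [DualNumber.snd_mul, h0, mul_zero, add_zero, TrivSqZeroExt.fst_sub, (evalDual_T _).1,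
      (evalDual_T _).1, sub_self, zero_mul, TrivSqZeroExt.snd_zero]

/-- After suitable crossing changes the state sum of a knot is `1`. -/
theorem exists_kindSum_eq_one (Q : P.E) {κ : P.V → VertexKind}
    (h : (P.withKind κ).IsKnot) :
    ∃ κ' : P.V → VertexKind, (∀ v, κ' v ≠ VertexKind.singular) ∧
      (∀ v, κ' v = VertexKind.smoothed ↔ κ v = VertexKind.smoothed) ∧ P.kindSum κ' Q = 1 := by
  rcases isEmpty_or_nonempty P.V with hV | hV
  · exact ⟨κ, fun v => isEmptyElim v, fun v => isEmptyElim v,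
      kindSum_of_isEmpty (isConnected_of_isKnot h) κ Q⟩
  obtain ⟨κ', k, h1, h2, h3⟩ := exists_kindSum_eq_T h Q
  refine ⟨κ', h1, h2, ?_⟩
  have hk' : (P.withKind κ').IsKnot := by
    intro e e'
    have := h e e'
    rwa [← follows_congr h2] at this
  -- The mirror image arises by crossing changes and has state sum with exponent `-k`. Equal
  -- derivatives at 1 give `k = -k`.
  have h4 := evalDual_eq_of_smoothed_iff Q hk' h1 (κ' := fun v => mirror (κ' v))
    (fun v => mirror_ne_singular (h1 v)) (fun v => mirror_eq_smoothed _)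
  rw [kindSum_mirror, h3, LaurentPolynomial.invert_T] at h4
  have h5 := congrArg TrivSqZeroExt.snd h4
  rw [(evalDual_T _).2, (evalDual_T _).2] at h5
  rw [h3, show k = 0 by omega, LaurentPolynomial.T_zero]

theorem evalOne_of_isKnot (Q : P.E) {κ : P.V → VertexKind}
    (hκ : ∀ v, κ v ≠ VertexKind.singular) (h : (P.withKind κ).IsKnot) :
    evalOne (P.kindSum κ Q) = 1 := by
  obtain ⟨κ', h1, h2, h3⟩ := exists_kindSum_eq_one Q h
  rw [← evalOne_eq_of_smoothed_iff Q hκ h1 h2, h3, map_one]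

/-- The state sum is invariant under `T^{1/2} ↦ -T^{-1/2}`. -/
theorem negHalf_invert_kindSum (Q : P.E) {κ : P.V → VertexKind}
    (hκ : ∀ v, κ v ≠ VertexKind.singular) :
    negHalf (LaurentPolynomial.invert (P.kindSum κ Q)) = P.kindSum κ Q := by
  classical
  rw [← sub_eq_zero]
  -- The skein factor is fixed by `T^{1/2} ↦ -T^{-1/2}`, so the difference again solves the skein
  -- relation; it vanishes where the state sum is 0 or 1.
  refine eq_zero_of_skein (d := fun κ => negHalf (LaurentPolynomial.invert (P.kindSum κ Q)) -
    P.kindSum κ Q) (fun κ v => ?_) (fun κ hκ => ?_) κ hκ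
  · have h1 := kindSum_skein Q κ v
    have h2 := congrArg (fun p => negHalf (LaurentPolynomial.invert p)) h1
    have h3 : negHalf (LaurentPolynomial.T 1) = -LaurentPolynomial.T 1 := by
      rw [negHalf_T]; simp
    have h4 : negHalf (LaurentPolynomial.T (-1)) = -LaurentPolynomial.T (-1) := by
      rw [negHalf_T]; simp
    simp only [map_sub, map_mul, LaurentPolynomial.invert_T, h3, h4, neg_neg] at h2
    linear_combination h2 - h1
  · by_cases hk : (P.withKind κ).IsKnot
    · obtain ⟨κ', h1, h2, h3⟩ := exists_kindSum_eq_one Q hk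
      exact ⟨κ', h1, h2, by simp [h3]⟩
    · obtain ⟨κ', h1, h2, h3⟩ := exists_kindSum_eq_zero hk
      exact ⟨κ', h1, h2, by simp [h3]⟩

/-- The flow weights contain only integral powers of `T`. The state sum is therefore one
half-integral monomial times a Laurent polynomial in `T`, and has a definite parity in `T^{1/2}`. -/
theorem negHalf_kindSum (Q : P.E) {κ : P.V → VertexKind}
    (hκ : ∀ v, κ v ≠ VertexKind.singular) :
    negHalf (P.kindSum κ Q) = P.kindSum κ Q ∨ negHalf (P.kindSum κ Q) = -P.kindSum κ Q := by
  by_cases hc : P.IsConnected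
  swap
  · left
    rw [kindSum_of_not_isConnected hc, map_zero]
  rcases isEmpty_or_nonempty P.V with hV | ⟨⟨v⟩⟩
  · left
    rw [kindSum_of_isEmpty hc, map_one]
  obtain ⟨ind, hi⟩ := exists_index hc
  obtain ⟨k, hk⟩ := exists_kindSum_eq_edgeDet hc v hi hκ
  have h1 : negHalf (LaurentPolynomial.T 2) = LaurentPolynomial.T 2 := by
    rw [negHalf_T]; simp
  have h2 : negHalf (LaurentPolynomial.T (-2)) = LaurentPolynomial.T (-2) := by
    rw [negHalf_T]; simp
  have h3 : ∀ (k : VertexKind) (c : Corner), negHalf (flowWeight (flowP k) (flowQ k) c) =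
      flowWeight (flowP k) (flowQ k) c := by
    intro k c
    cases k <;> cases c <;> simp [flowWeight, flowP, flowQ, h1, h2]
  rw [hk, ← selectionSum_flowWeight hc v, map_mul, map_selectionSum, negHalf_T]
  simp only [h3]
  rcases Int.units_eq_one_or ((-1 : ℤˣ) ^ (k - 2 * ind (P.left Q))) with h | h <;> rw [h]
  · left
    simp
  · right
    simp

theorem invert_kindSum (Q : P.E) {κ : P.V → VertexKind}
    (hκ : ∀ v, κ v ≠ VertexKind.singular) :
    LaurentPolynomial.invert (P.kindSum κ Q) = P.kindSum κ Q ∨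
      LaurentPolynomial.invert (P.kindSum κ Q) = -P.kindSum κ Q := by
  have h := congrArg negHalf (negHalf_invert_kindSum Q hκ)
  rw [negHalf_negHalf] at h
  rw [h]
  exact negHalf_kindSum Q hκ

theorem associated_alexanderDet (hP : P.Nonsingular) (Q : P.E) :
    Associated (P.stateSum Q) (P.alexanderDet Q) := by
  obtain ⟨ε, k, h⟩ := alexanderDet_eq hP Q
  have hu : IsUnit (((ε : ℤ) : HalfLaurent) * LaurentPolynomial.T k) :=
    (ε.isUnit.map (Int.castRingHom HalfLaurent)).mul (LaurentPolynomial.isUnit_T k)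
  obtain ⟨u, hu⟩ := hu
  exact ⟨u, by rw [hu, h, mul_comm]⟩

theorem isSymmetrizedAlexander_kindSum {κ : P.V → VertexKind}
    (hκ : ∀ v, κ v ≠ VertexKind.singular) (Q : P.E) :
    (P.withKind κ).IsSymmetrizedAlexander (P.kindSum κ Q) where
  associated e := by
    have := associated_alexanderDet (P := P.withKind κ) hκ e
    rw [stateSum_withKind] at this
    rwa [kindSum_eq_kindSum κ Q e]
  symmetric := invert_kindSum Q hκ
  eval_one h := evalOne_of_isKnot Q hκ h

/-- Any symmetrized Alexander polynomial is associated to the state sum, and zero is associated only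
to itself. -/
theorem IsSymmetrizedAlexander.eq_zero {p : HalfLaurent} {κ : P.V → VertexKind}
    (hκ : ∀ v, κ v ≠ VertexKind.singular) (hp : (P.withKind κ).IsSymmetrizedAlexander p) {Q : P.E}
    (h : P.kindSum κ Q = 0) : p = 0 := by
  have h1 := (hp.associated Q).trans ((isSymmetrizedAlexander_kindSum hκ Q).associated Q).symm
  rwa [h, associated_zero_iff_eq_zero] at h1

/-- The symmetrized Alexander polynomial of a knot is unique. -/
theorem IsSymmetrizedAlexander.unique {D : SingularLinkDiagram} (hD : D.IsKnot)
    {p q : HalfLaurent} (hp : D.IsSymmetrizedAlexander p) (hq : D.IsSymmetrizedAlexander q) :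
    p = q := by
  obtain ⟨Q⟩ := D.nonemptyE
  obtain ⟨u, hu⟩ := (hq.associated Q).trans (hp.associated Q).symm
  obtain ⟨ε, k, hεk⟩ := LaurentPolynomial.exists_eq_T_of_isUnit u.isUnit
  have hp1 : evalOne p = 1 := hp.eval_one hD
  have hq1 : evalOne q = 1 := hq.eval_one hD
  have hq0 : q ≠ 0 := by
    rintro rfl
    simp at hq1
  -- The two polynomials differ by a unit `± T^{k/2}`, and their common value 1 at `T^{1/2} = 1`
  -- fixes the sign.
  have hε : (ε : ℤ) = 1 := by
    have := congrArg evalOne hu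
    rw [map_mul, hεk, map_mul, evalOne_T, hp1, hq1, map_intCast] at this
    simpa using this
  rw [hε, Int.cast_one, one_mul] at hεk
  rw [hεk] at hu
  -- Symmetry of both polynomials makes `T^{-k/2}` equal to `± T^{k/2}`; the value at 1 excludes the
  -- minus sign, and the derivative then forces `k = 0`.
  have hT : ∀ s : HalfLaurent, LaurentPolynomial.T (-k) = s * LaurentPolynomial.T k →
      (s = 1 ∨ s = -1) → k = 0 := by
    intro s hs hs1
    have hd := congrArg evalDual hs
    have h1 := congrArg TrivSqZeroExt.fst hd
    have h2 := congrArg TrivSqZeroExt.snd hd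
    rcases hs1 with rfl | rfl
    · rw [one_mul, (evalDual_T _).2, (evalDual_T _).2] at h2
      omega
    · rw [neg_one_mul, map_neg, TrivSqZeroExt.fst_neg, (evalDual_T _).1, (evalDual_T _).1] at h1
      omega
  have hi := congrArg LaurentPolynomial.invert hu
  rw [map_mul, LaurentPolynomial.invert_T] at hi
  have hk : k = 0 := by
    rcases hp.symmetric with h1 | h1 <;> rcases hq.symmetric with h2 | h2 <;>
      rw [h1, h2, ← hu] at hi
    · exact hT 1 (mul_left_cancel₀ hq0 (by linear_combination hi)) (Or.inl rfl)
    · exact hT (-1) (mul_left_cancel₀ hq0 (by linear_combination -hi)) (Or.inr rfl)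
    · exact hT (-1) (mul_left_cancel₀ hq0 (by linear_combination hi)) (Or.inr rfl)
    · exact hT 1 (mul_left_cancel₀ hq0 (by linear_combination -hi)) (Or.inl rfl)
  rw [← hu, hk, LaurentPolynomial.T_zero, mul_one]

/-! ### Existence and uniqueness of the Alexander polynomial -/

theorem IsAlexanderPolynomial.eq_kindSum {Δ : SingularLinkDiagram → HalfLaurent}
    (hΔ : IsAlexanderPolynomial Δ) (Q : P.E) (κ : P.V → VertexKind) :
    Δ (P.withKind κ) = P.kindSum κ Q := by
  classical
  have hpos : ∀ (κ : P.V → VertexKind) v, κ v = VertexKind.singular →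
      Δ (P.withKind (Function.update κ v VertexKind.positive)) = Δ (P.withKind κ) +
        LaurentPolynomial.T 1 * Δ (P.withKind (Function.update κ v VertexKind.smoothed)) :=
    fun κ v hv => hΔ.skein_positive (P.withKind κ) v hv
  have hneg : ∀ (κ : P.V → VertexKind) v, κ v = VertexKind.singular →
      Δ (P.withKind (Function.update κ v VertexKind.negative)) = Δ (P.withKind κ) +
        LaurentPolynomial.T (-1) * Δ (P.withKind (Function.update κ v VertexKind.smoothed)) :=
    fun κ v hv => hΔ.skein_negative (P.withKind κ) v hv
  induction κ using singular_induction with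
  | h0 κ hκ =>
    rw [← sub_eq_zero]
    refine eq_zero_of_skein (d := fun κ => Δ (P.withKind κ) - P.kindSum κ Q)
      (fun κ v => ?_) (fun κ hκ => ?_) κ hκ
    -- Making `v` singular and subtracting the two singular relations yields the ordinary skein
    -- relation for `Δ`.
    · have h1 := hpos (Function.update κ v VertexKind.singular) v (Function.update_self _ _ _)
      have h2 := hneg (Function.update κ v VertexKind.singular) v (Function.update_self _ _ _)
      have h3 := kindSum_skein Q κ v
      rw [Function.update_idem, Function.update_idem] at h1 h2
      linear_combination h1 - h2 - h3
    -- Knots need no crossing change, by uniqueness. A link with several components is changed into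
    -- a diagram with zero state sum, where `Δ` vanishes too; no comparison of signs is needed.
    · by_cases hk : (P.withKind κ).IsKnot
      · refine ⟨κ, hκ, fun _ => Iff.rfl, ?_⟩
        rw [sub_eq_zero]
        exact (hΔ.ordinary (P.withKind κ) hκ).unique hk (isSymmetrizedAlexander_kindSum hκ Q)
      · obtain ⟨κ', h1, h2, h3⟩ := exists_kindSum_eq_zero hk
        refine ⟨κ', h1, h2, ?_⟩
        rw [h3, sub_zero]
        exact (hΔ.ordinary (P.withKind κ') h1).eq_zero h1 (h3 Q)
  | h1 κ v hv h₁ h₂ =>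
    have h3 := kindSum_positive κ v Q
    rw [← hv, Function.update_eq_self] at h3
    have h4 := hpos κ v hv
    rw [h₁, h₂] at h4
    linear_combination h3 - h4

/-- The arbitrary edge is the same for all vertex types on a projection, so the skein relations hold
with one common initial point. -/
theorem isAlexanderPolynomial_stateSum :
    IsAlexanderPolynomial fun P => P.stateSum (Classical.arbitrary P.E) where
  ordinary P hP := by
    have := isSymmetrizedAlexander_kindSum (P := P) hP (Classical.arbitrary P.E)
    rw [← stateSum_eq_kindSum] at this
    exact this
  skein_positive P v hv := by
    classical
    have h3 := kindSum_positive P.kind v (Classical.arbitrary P.E)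
    rw [← hv, Function.update_eq_self, ← stateSum_eq_kindSum, ← stateSum_withKind,
      ← stateSum_withKind] at h3
    exact h3
  skein_negative P v hv := by
    classical
    have h3 := kindSum_negative P.kind v (Classical.arbitrary P.E)
    rw [← hv, Function.update_eq_self, ← stateSum_eq_kindSum, ← stateSum_withKind,
      ← stateSum_withKind] at h3
    exact h3

end SingularLinkDiagram

theorem proposition3p2 :
    (∃! Δ : SingularLinkDiagram → HalfLaurent, SingularLinkDiagram.IsAlexanderPolynomial Δ) ∧
    ∀ Δ : SingularLinkDiagram → HalfLaurent, SingularLinkDiagram.IsAlexanderPolynomial Δ →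
      ∀ (P : SingularLinkDiagram) (Q : P.E), Δ P = P.stateSum Q := by
  have key : ∀ Δ : SingularLinkDiagram → HalfLaurent,
      SingularLinkDiagram.IsAlexanderPolynomial Δ →
      ∀ (P : SingularLinkDiagram) (Q : P.E), Δ P = P.stateSum Q := fun Δ hΔ P Q =>
    (hΔ.eq_kindSum Q P.kind).trans (SingularLinkDiagram.stateSum_eq_kindSum Q).symm
  exact ⟨⟨_, SingularLinkDiagram.isAlexanderPolynomial_stateSum,
    fun Δ hΔ => funext fun P => key Δ hΔ P _⟩, key⟩
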